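/- Setting. Let $G$ be a simple graph on $[n]=\{1,\dots,n\}$, identified with its adjacency matrix over $\mathbb Z_2$, and let $|G\rangle=\prod_{\{i,j\}\in E(G)}\mathrm{CZ}_{ij}\,|+\rangle^{\otimes n}$. The interfaces are the parties $1,\dots,n$ and the source $S$. Allowed corrections. For $M\subseteq[n]$ and $H'=[n]\setminus M$ write $G_{H'}$ for the adjacency matrix of the subgraph induced on $H'$ and $\Gamma\in\mathbb Z_2^{M\times H'}$ for the biadjacency matrix between $H'$ and $M$, and fix any factorization $\Gamma=V\begin{bmatrix}I_r&R\\0&0\end{bmatrix}U$ with $U,V$ invertible. For $x,z\in\mathbb Z_2^{H'}$ put $f(M,x,z)=\top$ iff the last $|H'|-r$ entries of $Ux$ vanish and $(U^T)^{-1}(z\oplus G_{H'}x)=\begin{bmatrix}b\\R^Tb\end{bmatrix}$ for some $b\in\mathbb Z_2^r$; otherwise $f(M,x,z)=\bot$. Resource $\mathsf{Verif}^f$. It receives $c_S\in\{\top,\bot\}$ from the source; if $c_S=\bot$ it sends $\bot$ to all parties and stops. Otherwise it creates $|G\rangle$ and waits for $c_i\in\{0,1,\bot\}$ from every party; if some $c_i=\bot$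 it sends $\bot$ to all parties and stops. Let $M=\{i:c_i=1\}$, $H'=[n]\setminus M$. For $i\in M$ it sends the $i$-th qubit to party $i$, and it waits for corrections $(a_i,b_i)\in(\mathbb Z_2^{H'})^2$ from every $i\in M$; let $x=\bigoplus_{i\in M}a_i$, $z=\bigoplus_{i\in M}b_i$. If $M\ne\emptyset$ and $f(M,x,z)=\bot$ it sends $\bot$ to all parties and stops. Otherwise it applies $X^xZ^z$ to the qubits in $H'$ and sends the $i$-th qubit to party $i$ for each $i\in H'$. Its filter for $S$ sends $\top$; its filter for party $i$ sends $c_i=0$ and forwards the messages of the resource. Resource $\mathsf{CoinFlip}$. It samples $x\in\{0,1\}^n$ uniformly and waits for $c_i\in\{\top,\bot\}$ from every party. If all are $\top$ it sends $x$ to all parties. Otherwise it sends $x$ to every party with $c_i=\bot$ and waits for $c_i'\in\{\top,\bot\}$ from each of these; if some $c_i'=\bot$ it sends $\bot$ to all parties, otherwise it sends $x$ to all parties. Its filter sends $c_i=\top$ when party $i$ asks for a coin flip and forwards the answers. Resource $\mathsf{Verif}$. It creates $|G\rangle$ and waits for $c_i\in\{\top,\bot\}$ from every $i\in[n]\cup\{S\}$.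 If all are $\top$ it sends the $i$-th qubit to party $i$ for every $i\in[n]$. Otherwise it sends the $i$-th qubit to each party $i$ with $c_i=\bot$ and waits for $c_i'\in\{\top,\bot\}$ from each interface with $c_i=\bot$; if some $c_i'=\bot$ it sends $\bot$ on all interfaces, otherwise it sends the $i$-th qubit to party $i$ for each party with $c_i=\top$. Its filters send $c_i=\top$ and forward to party $i$ the messages of the resource (the filter of $S$ forwards nothing). Both $\mathsf{Verif}^f$ and $\mathsf{Verif}$ also contain a channel that forwards arbitrary (classical and quantum) messages between any two interfaces; the filters block it. Protocol $\tau$. Party $i$ receives its qubit from $\mathsf{Verif}^f$, then asks $\mathsf{CoinFlip}$ for $x$, then applies $X^{x_i}Z^{(Gx)_i}$ to its qubit and outputs it. If one of the resources sends $\bot$, it outputs $\bot$ and stops. The source does nothing beyond its filter. Theorem. The protocol $\tau$ perfectly realizes $\mathsf{Verif}$ from $\mathsf{Verif}^f\,\|\,\mathsf{CoinFlip}$: for every set $H\subseteq[n]\cup\{S\}$ of honest interfaces there is a simulator $\sigma$, a single quantum converter attached to all interfaces of $\mathsf{Verif}$ outside $H$, such that $$\tau_H\,\bot_H\,(\mathsf{Verif}^f\,\|\,\mathsf{CoinFlip})\;\approx_0\;\bot_H\,\mathsf{Verif}\,\sigma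 .$$ Here $\approx_0$ means that every computationally unbounded quantum distinguisher, connected to all the outer interfaces, outputs $1$ with the same probability in both cases, where the distinguisher is activated whenever the system it interacts with has nothing left to do without further input. (The case where $H$ contains all interfaces is the correctness of the protocol.) -/

import Mathlib

/-!
Quantum interactive systems with classical control, the composition operations of abstract
cryptography, and the resources, filters and protocol for verified graph state sharing.

Quantum data is modelled by named qubits in one shared register. Sending a qubit means handing over
the exclusive right to act on it, so that a message only carries the names of the qubits sent.
-/

namespace GraphVerif

noncomputable section

/-- The interfaces: `some i` is the `i`-th party, `none` is the source. -/
abbrev Party (n : ℕ) := Option (Fin n)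

/-- All interfaces, in a fixed order. -/
def parties (n : ℕ) : List (Party n) := none :: (List.finRange n).map some

/-- Names of qubits: `Sum.inl i` is the `i`-th qubit of the graph state, the names `Sum.inr k` are
those of the qubits that the environment brings along. -/
abbrev Name (n : ℕ) := Fin n ⊕ ℕ

/-- Messages. -/
inductive Msg (n : ℕ) where
  /-- the symbol `⊤` -/
  | top
  /-- the symbol `⊥` -/
  | bot
  /-- the value `0` of the bit announcing an honest party -/
  | zero
  /-- the value `1` of the bit announcing a dishonest party -/
  | one
  /-- the request of a party for a coin flip -/
  | ask
  /-- a string of `n` bits -/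
  | bits (x : Fin n → ZMod 2)
  /-- a list of `X`-corrections and a list of `Z`-corrections -/
  | corr (a b : Fin n → ZMod 2)
  /-- a qubit -/
  | qubit (q : Name n)
  /-- a message on the communication channel: the peer (recipient when it is sent, sender when it is
  delivered), a classical word, and any set of qubits -/
  | chan (peer : Party n) (w : List Bool) (qs : Finset (Name n))

/-- The qubits that a message hands over. -/
def Msg.qubits {n : ℕ} : Msg n → Finset (Name n)
  | .qubit q => {q}
  | .chan _ _ qs => qs
  | _ => ∅

/-! ### Quantum operations -/

/-- An operator on the qubits in `supp`, in the computational basis. -/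
structure Gate (n : ℕ) where
  supp : Finset (Name n)
  mat : Matrix (supp → ZMod 2) (supp → ZMod 2) ℂ

/-- The operator `mat ⊗ 1` on the register with qubits `W`, for `supp ⊆ W`. -/
def Gate.embed {n : ℕ} (g : Gate n) (W : Finset (Name n)) :
    Matrix (W → ZMod 2) (W → ZMod 2) ℂ :=
  let restr : (W → ZMod 2) → (g.supp → ZMod 2) :=
    fun s q => if h : q.1 ∈ W then s ⟨q.1, h⟩ else 0
  fun s t => if ∀ q : W, q.1 ∉ g.supp → s q = t q then g.mat (restr s) (restr t) else 0

/-- Apply a list of operators, the head first, to a (subnormalized) density matrix. -/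
def applyGates {n : ℕ} (W : Finset (Name n)) (gs : List (Gate n))
    (ρ : Matrix (W → ZMod 2) (W → ZMod 2) ℂ) : Matrix (W → ZMod 2) (W → ZMod 2) ℂ :=
  gs.foldl (fun ρ g => g.embed W * ρ * (g.embed W).conjTranspose) ρ

/-- The operator `X^a Z^b` on the qubits in `E`. -/
def pauli {n : ℕ} (E : Finset (Name n)) (a b : Name n → ZMod 2) : Gate n where
  supp := E
  mat := fun s t =>
    if ∀ q : E, s q = t q + a q then ∏ q : E, (if b q = 1 ∧ t q = 1 then (-1 : ℂ) else 1) else 0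

/-- The `n` qubits of the graph state. -/
def graphQubits (n : ℕ) : Finset (Name n) := Finset.univ.map Function.Embedding.inl

/-- The unitary `(∏_{edges} CZ) H^{⊗ n}`, which turns `|0⟩^{⊗ n}` into the graph state `|G⟩`. -/
def createGraph {n : ℕ} (G : SimpleGraph (Fin n)) [DecidableRel G.Adj] : Gate n where
  supp := graphQubits n
  mat :=
    let bit : (graphQubits n → ZMod 2) → Fin n → ZMod 2 :=
      fun s i => s ⟨Sum.inl i, by simp [graphQubits]⟩
    Matrix.diagonal (fun s =>
      ∏ e ∈ (Finset.univ : Finset (Fin n × Fin n)).filter (fun e => e.1 < e.2 ∧ G.Adj e.1 e.2),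
        (if bit s e.1 = 1 ∧ bit s e.2 = 1 then (-1 : ℂ) else 1)) *
    Matrix.of (fun s t =>
      ∏ i : Fin n, ((Real.sqrt 2 : ℂ)⁻¹ * (if bit s i = 1 ∧ bit t i = 1 then (-1 : ℂ) else 1)))

/-- The outcomes of a quantum instrument: every branch consists of the Kraus operator of the
outcome, written as a product of operators that are applied from left to right, and of the
outcome. -/
abbrev Branches (n : ℕ) (α : Type) := List (List (Gate n) × α)

/-- Sequential composition of instruments. -/
def Branches.andThen {n : ℕ} {α β : Type} (l : Branches n α) (f : α → Branches n β) :
    Branches n β :=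
  l.flatMap fun b => (f b.2).map fun b' => (b.1 ++ b'.1, b'.2)

/-! ### Systems, resources, converters -/

/-- For every interface in `I` and every port in `κ` of that interface, the messages on it. -/
abbrev Batch (n : ℕ) (I κ : Type) := I → κ → List (Msg n)

/-- The names of all the qubits in a batch, with multiplicity. -/
def Batch.names {n : ℕ} {I κ : Type} [Fintype I] [Fintype κ] (b : Batch n I κ) :
    Multiset (Name n) :=
  ∑ i, ∑ k, ((b i k).map fun m => m.qubits.val).sum

/-- An interactive system: given its classical state and the incoming messages, it performs a
quantum instrument and, depending on the outcome, changes its state and sends messages. It is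
`active` when it goes on without waiting for a message. -/
structure System (n : ℕ) (α β : Type) where
  State : Type
  init : State
  step : State → α → Branches n (State × β)
  active : State → Prop

/-- A resource. -/
abbrev Resource (n : ℕ) (κ : Type) := System n (Batch n (Party n) κ) (Batch n (Party n) κ)

/-- A converter at the interfaces `I`, with inner ports `κ` and outer ports `κ'`: it maps the
messages from the resource and from outside to messages to the resource and to the outside. -/
abbrev Converter (n : ℕ) (I κ κ' : Type) :=
  System n (Batch n I κ × Batch n I κ') (Batch n I κ × Batch n I κ')

/-- Parallel composition of resources. -/
def System.par {n : ℕ} {κ₁ κ₂ : Type} (R : Resource n κ₁) (S : Resource n κ₂) :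
    Resource n (κ₁ ⊕ κ₂) where
  State := R.State × S.State
  init := (R.init, S.init)
  step s inp :=
    Branches.andThen (R.step s.1 fun i k => inp i (.inl k)) fun r =>
    Branches.andThen (S.step s.2 fun i k => inp i (.inr k)) fun t =>
      [([], ((r.1, t.1), fun i k => Sum.elim (r.2 i) (t.2 i) k))]
  active s := R.active s.1 ∨ S.active s.2

/-- The resource obtained by plugging a converter into a resource. The last two components of the
state are the messages under way to the resource and to the converter. -/
def System.attach {n : ℕ} {κ κ' : Type} (R : Resource n κ) (C : Converter n (Party n) κ κ') :
    Resource n κ' where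
  State := R.State × C.State × Batch n (Party n) κ × Batch n (Party n) κ
  init := (R.init, C.init, fun _ _ => [], fun _ _ => [])
  step s inp :=
    Branches.andThen (R.step s.1 s.2.2.1) fun r =>
    Branches.andThen (C.step s.2.1 (s.2.2.2, inp)) fun c =>
      [([], ((r.1, c.1, c.2.1, r.2), c.2.2))]
  active s := R.active s.1 ∨ C.active s.2.1 ∨
    s.2.2.1 ≠ (fun _ _ => []) ∨ s.2.2.2 ≠ (fun _ _ => [])

/-- A converter at a single interface that applies operators under classical control, without
measuring or sampling. Its step maps the state, the messages from the resource and those from outside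
to the new state, the operators applied, the messages to the resource and those to the outside. -/
structure LocalConverter (n : ℕ) (κ κ' : Type) where
  State : Type
  init : State
  step : State → (κ → List (Msg n)) → (κ' → List (Msg n)) →
    State × List (Gate n) × (κ → List (Msg n)) × (κ' → List (Msg n))
  active : State → Prop

/-- The converter that forwards all messages in both directions. -/
def LocalConverter.forward (n : ℕ) (κ : Type) : LocalConverter n κ κ where
  State := Unit
  init := ()
  step _ fromIn fromOut := ((), [], fromOut, fromIn)
  active _ := False

/-- The converter at the interfaces `I` that forwards all messages in both directions. -/
def forward (n : ℕ) (I κ : Type) : Converter n I κ κ where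
  State := Unit
  init := ()
  step _ inp := [([], ((), inp.2, inp.1))]
  active _ := False

/-- The local converters `π i` at the interfaces `i ∈ H`, and the single converter `σ` at all the
other interfaces. -/
def joint {n : ℕ} {κ κ' : Type} (H : Finset (Party n)) (π : Party n → LocalConverter n κ κ')
    (σ : Converter n {i // i ∉ H} κ κ') : Converter n (Party n) κ κ' where
  State := (∀ i, (π i).State) × σ.State
  init := (fun i => (π i).init, σ.init)
  step s inp :=
    let loc := fun i => (π i).step (s.1 i) (inp.1 i) (inp.2 i)
    (σ.step s.2 (fun i => inp.1 i, fun i => inp.2 i)).map fun b =>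
      (((parties n).filter (· ∈ H)).flatMap (fun i => (loc i).2.1) ++ b.1,
        ((fun i => if i ∈ H then (loc i).1 else s.1 i), b.2.1),
        (fun i => if h : i ∈ H then (loc i).2.2.1 else b.2.2.1 ⟨i, h⟩),
        (fun i => if h : i ∈ H then (loc i).2.2.2 else b.2.2.2 ⟨i, h⟩))
  active s := (∃ i ∈ H, (π i).active (s.1 i)) ∨ σ.active s.2

/-- The converter is physical: it starts without qubits; every step is a quantum instrument
(Kraus operators `K` with `∑ Kᴴ K = 1`) on qubits that it holds or has just received, it only sends
such qubits, none of them twice, and it no longer holds what it has sent. (Incoming qubits are always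
distinct from each other and from those held.) -/
def System.IsPhysical {n : ℕ} {I κ κ' : Type} [Fintype I] [Fintype κ] [Fintype κ']
    (C : Converter n I κ κ') : Prop :=
  ∃ held : C.State → Finset (Name n), held C.init = ∅ ∧
    ∀ s inp, (inp.1.names + inp.2.names + (held s).val).Nodup → ∃ avail : Finset (Name n),
      avail = held s ∪ inp.1.names.toFinset ∪ inp.2.names.toFinset ∧
      ∃ E ⊆ avail, ∃ L : List (Matrix (E → ZMod 2) (E → ZMod 2) ℂ ×
          C.State × Batch n I κ × Batch n I κ'),
        C.step s inp = L.map (fun b => ([⟨E, b.1⟩], b.2)) ∧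
        (L.map fun b => b.1.conjTranspose * b.1).sum = 1 ∧
        ∀ b ∈ L, (b.2.2.1.names + b.2.2.2.names).Nodup ∧
          (b.2.2.1.names + b.2.2.2.names).toFinset ⊆ avail ∧
          held b.2.1 ⊆ avail \ (b.2.2.1.names + b.2.2.2.names).toFinset

/-! ### Distinguishers -/

/-- What a distinguisher does once it is activated. -/
inductive Act (n : ℕ) (κ : Type) where
  /-- stop and output a bit -/
  | halt (b : Bool)
  /-- send a message to a port of an interface -/
  | send (i : Party n) (k : κ) (m : Msg n)

/-- A computationally unbounded distinguisher. It starts with `anc` qubits of its own. When it is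
activated, it gets the messages that arrived since its last activation on each of the ports and
performs an arbitrary quantum instrument on the set `h` of all the qubits that it holds. -/
structure Distinguisher (n : ℕ) (κ : Type) where
  anc : ℕ
  Mem : Type
  init : Mem
  act : Mem → Batch n (Party n) κ → (h : Finset (Name n)) →
    List (Matrix (h → ZMod 2) (h → ZMod 2) ℂ × Mem × Act n κ)
  complete : ∀ mem box h, ((act mem box h).map fun b => b.1.conjTranspose * b.1).sum = 1
  sends_held : ∀ mem box h, ∀ b ∈ act mem box h, ∀ i k m,
    b.2.2 = Act.send i k m → m.qubits ⊆ h

/-- The qubits that a distinguisher starts with. -/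
def ancQubits (n m : ℕ) : Finset (Name n) := (Finset.range m).map Function.Embedding.inr

/-- The register of an execution. -/
abbrev register (n m : ℕ) : Finset (Name n) := graphQubits n ∪ ancQubits n m

open Classical in
/-- The probability that the distinguisher outputs `1` within the given number of steps, from a state
`s` of the resource, messages `box` waiting for the distinguisher, its memory `mem`, its qubits `h`
and the density matrix `ρ`. The distinguisher is activated whenever the resource is not active, and
then either halts or sends a message. -/
def acceptIn {n : ℕ} {κ : Type} [Fintype κ] [DecidableEq κ] (R : Resource n κ)
    (D : Distinguisher n κ) : ℕ → R.State → Batch n (Party n) κ → D.Mem → Finset (Name n) →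
      Matrix (register n D.anc → ZMod 2) (register n D.anc → ZMod 2) ℂ → ℝ
  | 0, _, _, _, _, _ => 0
  | T + 1, s, box, mem, h, ρ =>
    if R.active s then
      ((R.step s fun _ _ => []).map fun b =>
        acceptIn R D T b.2.1 (fun i k => box i k ++ b.2.2 i k) mem (h ∪ b.2.2.names.toFinset)
          (applyGates _ b.1 ρ)).sum
    else
      ((D.act mem box h).map fun d =>
        let ρ' := applyGates _ [⟨h, d.1⟩] ρ
        match d.2.2 with
        | .halt b => if b then ρ'.trace.re else 0
        | .send i k m =>
          ((R.step s fun i' k' => if i' = i ∧ k' = k then [m] else []).map fun b =>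
            acceptIn R D T b.2.1 b.2.2 d.2.1 ((h \ m.qubits) ∪ b.2.2.names.toFinset)
              (applyGates _ b.1 ρ')).sum).sum

/-- The probability that the distinguisher, connected to the resource, outputs `1`. All qubits are
`|0⟩` at the start. -/
def outputProb {n : ℕ} {κ : Type} [Fintype κ] [DecidableEq κ] (R : Resource n κ)
    (D : Distinguisher n κ) : ℝ :=
  (⨆ T : ℕ, ENNReal.ofReal (acceptIn R D T R.init (fun _ _ => []) D.init (ancQubits n D.anc)
    (Matrix.single 0 0 1))).toReal

/-- `R ≈_ε S`. -/
def Indist {n : ℕ} {κ : Type} [Fintype κ] [DecidableEq κ] (ε : ℝ) (R S : Resource n κ) : Prop :=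
  ∀ D : Distinguisher n κ, |outputProb R D - outputProb S D| ≤ ε

/-- The protocol `π` (which uses `R` through the filters `botR`) `ε`-realizes `S` (with filters
`botS`): for every set `H` of honest interfaces there is a simulator `σ` at all the other interfaces
with `π_H botR_H R ≈_ε botS_H S σ`. -/
def SecurelyRealizes {n : ℕ} {κ κS : Type} [Fintype κ] [DecidableEq κ] [Fintype κS] (ε : ℝ)
    (R : Resource n κ) (botR π : Party n → LocalConverter n κ κ)
    (S : Resource n κS) (botS : Party n → LocalConverter n κS κ) : Prop :=
  ∀ H : Finset (Party n), ∃ σ : Converter n {i // i ∉ H} κS κ, σ.IsPhysical ∧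
    Indist ε
      ((R.attach (joint H botR (forward n _ κ))).attach (joint H π (forward n _ κ)))
      (S.attach (joint H botS σ))

/-! ### Reading messages -/

/-- The value already received, or else the first suitable one among new messages. -/
def firstOf {n : ℕ} {α : Type} (parse : Msg n → Option α) (old : Option α) (l : List (Msg n)) :
    Option α :=
  old <|> l.findSome? parse

/-- `⊤` (`true`) or `⊥` (`false`). -/
def readFlag {n : ℕ} : Msg n → Option Bool
  | .top => some true
  | .bot => some false
  | _ => none

/-- The announcement of a party to the resource with corrections. -/
inductive Announce where
  | zero
  | one
  | bot
  deriving DecidableEq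

def readAnnounce {n : ℕ} : Msg n → Option Announce
  | .zero => some .zero
  | .one => some .one
  | .bot => some .bot
  | _ => none

def readCorr {n : ℕ} : Msg n → Option ((Fin n → ZMod 2) × (Fin n → ZMod 2))
  | .corr a b => some (a, b)
  | _ => none

/-- Send `m i` to every party `i ∈ A`, and nothing to the source. -/
def sendTo {n : ℕ} (A : Finset (Fin n)) (m : Fin n → Msg n) : Batch n (Party n) Unit :=
  fun p _ => match p with
    | none => []
    | some i => if i ∈ A then [m i] else []

/-! ### The communication channel -/

/-- Forwards any classical words and qubits from any interface to any interface. -/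
def channel (n : ℕ) : Resource n Unit where
  State := Unit
  init := ()
  step _ inp := [([], ((), fun j _ => (parties n).flatMap fun i => (inp i ()).filterMap fun m =>
    match m with
    | .chan k w qs => if k = j then some (.chan i w qs) else none
    | _ => none))]
  active _ := False

/-! ### The resource with corrections -/

inductive VPhase where
  | waitSource
  | waitParties
  | waitCorrections
  | done
  deriving DecidableEq

structure VState (n : ℕ) where
  phase : VPhase
  source : Option Bool
  c : Fin n → Option Announce
  corr : Fin n → Option ((Fin n → ZMod 2) × (Fin n → ZMod 2))

/-- The parties that announced `1`. -/
def VState.M {n : ℕ} (s : VState n) : Finset (Fin n) :=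
  Finset.univ.filter fun i => s.c i = some .one

def VState.record {n : ℕ} (s : VState n) (inp : Batch n (Party n) Unit) : VState n where
  phase := s.phase
  source := firstOf readFlag s.source (inp none ())
  c := fun i => firstOf readAnnounce (s.c i) (inp (some i) ())
  corr := fun i =>
    if s.phase = .waitCorrections ∧ i ∈ s.M then firstOf readCorr (s.corr i) (inp (some i) ())
    else s.corr i

/-- Everything that the current phase waits for has arrived. -/
def VState.ready {n : ℕ} (s : VState n) : Prop :=
  match s.phase with
  | .waitSource => s.source.isSome
  | .waitParties => ∀ i, (s.c i).isSome
  | .waitCorrections => ∀ i ∈ s.M, (s.corr i).isSome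
  | .done => False

/-- The sum of the `X`-corrections. -/
def VState.x {n : ℕ} (s : VState n) (i : Fin n) : ZMod 2 :=
  ∑ j ∈ s.M, (s.corr j).elim 0 fun p => p.1 i

/-- The sum of the `Z`-corrections. -/
def VState.z {n : ℕ} (s : VState n) (i : Fin n) : ZMod 2 :=
  ∑ j ∈ s.M, (s.corr j).elim 0 fun p => p.2 i

/-- The type of the test `f(M, x, z)` of corrections: `x` and `z` are indexed by the parties not in
`M`. -/
abbrev CorrTest (n : ℕ) :=
  (M : Finset (Fin n)) → ({i // i ∉ M} → ZMod 2) → ({i // i ∉ M} → ZMod 2) → Prop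

open Classical in
/-- The next phase, once everything that the current one waits for has arrived. -/
def VState.advance {n : ℕ} (G : SimpleGraph (Fin n)) [DecidableRel G.Adj] (f : CorrTest n)
    (s : VState n) : List (Gate n) × VState n × Batch n (Party n) Unit :=
  let abort := ([], { s with phase := .done }, sendTo Finset.univ fun _ => .bot)
  match s.phase with
  | .waitSource =>
    if s.source = some true then
      ([createGraph G], { s with phase := .waitParties }, fun _ _ => [])
    else abort
  | .waitParties =>
    if ∃ i, s.c i = some .bot then abort
    else if s.M = ∅ then
      ([], { s with phase := .done }, sendTo Finset.univ fun i => .qubit (.inl i))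
    else
      ([], { s with phase := .waitCorrections }, sendTo s.M fun i => .qubit (.inl i))
  | .waitCorrections =>
    if f s.M (fun i => s.x i) (fun i => s.z i) then
      ([pauli (s.Mᶜ.map Function.Embedding.inl) (Sum.elim s.x 0) (Sum.elim s.z 0)],
        { s with phase := .done }, sendTo s.Mᶜ fun i => .qubit (.inl i))
    else abort
  | .done => ([], s, fun _ _ => [])

open Classical in
/-- The resource with corrections, without the communication channel. -/
def verifCorrCore {n : ℕ} (G : SimpleGraph (Fin n)) [DecidableRel G.Adj] (f : CorrTest n) :
    Resource n Unit where
  State := VState n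
  init := ⟨.waitSource, none, fun _ => none, fun _ => none⟩
  step s inp :=
    let s' := s.record inp
    if s'.ready then [((s'.advance G f).1, (s'.advance G f).2)] else [([], (s', fun _ _ => []))]
  active s := s.ready

/-- The resource with corrections. The port `inl ()` is the main one, `inr ()` the channel. -/
def verifCorr {n : ℕ} (G : SimpleGraph (Fin n)) [DecidableRel G.Adj] (f : CorrTest n) :
    Resource n (Unit ⊕ Unit) :=
  (verifCorrCore G f).par (channel n)

/-! ### The coin flip -/

inductive FPhase where
  | create
  | waitParties
  | waitConfirm
  | done
  deriving DecidableEq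

structure CoinState (n : ℕ) where
  phase : FPhase
  x : Fin n → ZMod 2
  c : Fin n → Option Bool
  c' : Fin n → Option Bool

/-- The parties that sent `c_i = ⊥`. -/
def CoinState.A {n : ℕ} (s : CoinState n) : Finset (Fin n) :=
  Finset.univ.filter fun i => s.c i = some false

def CoinState.record {n : ℕ} (s : CoinState n) (inp : Batch n (Party n) Unit) : CoinState n where
  phase := s.phase
  x := s.x
  c := fun i => firstOf readFlag (s.c i) (inp (some i) ())
  c' := fun i =>
    if s.phase = .waitConfirm ∧ i ∈ s.A then firstOf readFlag (s.c' i) (inp (some i) ())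
    else s.c' i

def CoinState.ready {n : ℕ} (s : CoinState n) : Prop :=
  match s.phase with
  | .create => True
  | .waitParties => ∀ i, (s.c i).isSome
  | .waitConfirm => ∀ i ∈ s.A, (s.c' i).isSome
  | .done => False

open Classical in
def CoinState.advance {n : ℕ} (s : CoinState n) :
    Branches n (CoinState n × Batch n (Party n) Unit) :=
  match s.phase with
  | .create =>
    (Finset.univ : Finset (Fin n → ZMod 2)).toList.map fun x =>
      ([⟨∅, (Real.sqrt ((2 : ℝ) ^ n) : ℂ)⁻¹ • 1⟩],
        ({ s with phase := .waitParties, x := x }, fun _ _ => []))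
  | .waitParties =>
    if s.A = ∅ then
      [([], ({ s with phase := .done }, sendTo Finset.univ fun _ => .bits s.x))]
    else
      [([], ({ s with phase := .waitConfirm }, sendTo s.A fun _ => .bits s.x))]
  | .waitConfirm =>
    if ∃ i ∈ s.A, s.c' i = some false then
      [([], ({ s with phase := .done }, sendTo Finset.univ fun _ => .bot))]
    else
      [([], ({ s with phase := .done }, sendTo Finset.univ fun _ => .bits s.x))]
  | .done => [([], (s, fun _ _ => []))]

open Classical in
/-- The coin-flipping resource: a uniformly random string `x` of `n` bits, which parties with
`c_i = ⊥` get to see before they decide whether to abort. -/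
def coinFlip (n : ℕ) : Resource n Unit where
  State := CoinState n
  init := ⟨.create, 0, fun _ => none, fun _ => none⟩
  step s inp :=
    let s' := s.record inp
    if s'.ready then s'.advance else [([], (s', fun _ _ => []))]
  active s := s.ready

/-! ### The resource without corrections -/

structure WState (n : ℕ) where
  phase : FPhase
  c : Party n → Option Bool
  c' : Party n → Option Bool

/-- The interfaces that sent `c_i = ⊥`. -/
def WState.A {n : ℕ} (s : WState n) : Finset (Party n) :=
  Finset.univ.filter fun i => s.c i = some false

def WState.record {n : ℕ} (s : WState n) (inp : Batch n (Party n) Unit) : WState n where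
  phase := s.phase
  c := fun i => firstOf readFlag (s.c i) (inp i ())
  c' := fun i =>
    if s.phase = .waitConfirm ∧ i ∈ s.A then firstOf readFlag (s.c' i) (inp i ())
    else s.c' i

def WState.ready {n : ℕ} (s : WState n) : Prop :=
  match s.phase with
  | .create => True
  | .waitParties => ∀ i, (s.c i).isSome
  | .waitConfirm => ∀ i ∈ s.A, (s.c' i).isSome
  | .done => False

open Classical in
def WState.advance {n : ℕ} (G : SimpleGraph (Fin n)) [DecidableRel G.Adj] (s : WState n) :
    List (Gate n) × WState n × Batch n (Party n) Unit :=
  match s.phase with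
  | .create => ([createGraph G], { s with phase := .waitParties }, fun _ _ => [])
  | .waitParties =>
    if s.A = ∅ then
      ([], { s with phase := .done }, sendTo Finset.univ fun i => .qubit (.inl i))
    else
      ([], { s with phase := .waitConfirm },
        sendTo (Finset.univ.filter fun i => some i ∈ s.A) fun i => .qubit (.inl i))
  | .waitConfirm =>
    if ∃ i ∈ s.A, s.c' i = some false then
      ([], { s with phase := .done }, fun _ _ => [.bot])
    else
      ([], { s with phase := .done },
        sendTo (Finset.univ.filter fun i => some i ∉ s.A) fun i => .qubit (.inl i))
  | .done => ([], s, fun _ _ => [])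

open Classical in
/-- The resource without corrections, without the communication channel. -/
def verifCore {n : ℕ} (G : SimpleGraph (Fin n)) [DecidableRel G.Adj] : Resource n Unit where
  State := WState n
  init := ⟨.create, fun _ => none, fun _ => none⟩
  step s inp :=
    let s' := s.record inp
    if s'.ready then [((s'.advance G).1, (s'.advance G).2)] else [([], (s', fun _ _ => []))]
  active s := s.ready

/-- The resource without corrections. The port `inl ()` is the main one, `inr ()` the channel. -/
def verif {n : ℕ} (G : SimpleGraph (Fin n)) [DecidableRel G.Adj] : Resource n (Unit ⊕ Unit) :=
  (verifCore G).par (channel n)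

/-! ### Filters and protocol -/

/-- The ports of an interface of the real resource: main port and channel of the resource with
corrections, port of the coin flip. -/
abbrev RealPort := (Unit ⊕ Unit) ⊕ Unit

/-- Messages on the main port only. -/
def onMain {n : ℕ} (l : List (Msg n)) : RealPort → List (Msg n)
  | .inl (.inl _) => l
  | _ => []

/-- The filters of the resource with corrections and of the coin flip. A party announces `0` and has
its messages on the main port forwarded, while the channel is blocked; on request it sends `⊤` to the
coin flip, whose answers are forwarded. The source sends `⊤`. The state tells whether the
announcement has been made. -/
def filterReal (n : ℕ) : Party n → LocalConverter n RealPort RealPort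
  | none =>
    { State := Bool
      init := false
      step := fun started _ _ =>
        (true, [], onMain (if started then [] else [.top]), fun _ => [])
      active := fun started => started = false }
  | some _ =>
    { State := Bool
      init := false
      step := fun started fromIn fromOut =>
        (true, [],
          (fun k => match k with
            | .inl (.inl _) => (if started then [] else [.zero]) ++ fromOut (.inl (.inl ()))
            | .inl (.inr _) => []
            | .inr _ => (fromOut (.inr ())).filterMap fun m =>
                match m with
                | .ask => some .top
                | _ => none),
          (fun k => match k with
            | .inl (.inl _) => fromIn (.inl (.inl ()))
            | .inl (.inr _) => []
            | .inr _ => fromIn (.inr ())))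
      active := fun started => started = false }

/-- The filters of the resource without corrections: they send `⊤`; what a party receives on the
main port is forwarded, the channel is blocked. -/
def filterIdeal (n : ℕ) (p : Party n) : LocalConverter n (Unit ⊕ Unit) RealPort where
  State := Bool
  init := false
  step := fun started fromIn _ =>
    (true, [],
      (fun k => match k with
        | .inl _ => if started then [] else [.top]
        | .inr _ => []),
      onMain (if p = none then [] else fromIn (.inl ())))
  active := fun started => started = false

inductive TauState (n : ℕ) where
  | waitQubit
  | waitCoin (q : Name n)
  | done

def readQubit {n : ℕ} : Msg n → Option (Option (Name n))
  | .qubit q => some (some q)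
  | .bot => some none
  | _ => none

def readBits {n : ℕ} : Msg n → Option (Option (Fin n → ZMod 2))
  | .bits x => some (some x)
  | .bot => some none
  | _ => none

/-- The protocol of party `i`: get a qubit, then ask for a coin flip `x`, then apply
`X^{x_i} Z^{(G x)_i}` to the qubit and output it; if either of the resources aborts, output `⊥` and
stop. -/
def tauParty {n : ℕ} (G : SimpleGraph (Fin n)) [DecidableRel G.Adj] (i : Fin n) :
    LocalConverter n RealPort RealPort where
  State := TauState n
  init := .waitQubit
  step := fun s fromIn _ =>
    match s with
    | .waitQubit =>
      match (fromIn (.inl (.inl ()))).findSome? readQubit with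
      | none => (.waitQubit, [], fun _ => [], fun _ => [])
      | some none => (.done, [], fun _ => [], onMain [.bot])
      | some (some q) =>
        (.waitCoin q, [], fun k => match k with
          | .inl _ => []
          | .inr _ => [.ask], fun _ => [])
    | .waitCoin q =>
      match (fromIn (.inr ())).findSome? readBits with
      | none => (.waitCoin q, [], fun _ => [], fun _ => [])
      | some none => (.done, [], fun _ => [], onMain [.bot])
      | some (some x) =>
        (.done,
          [pauli {q} (fun _ => x i) (fun _ => (G.adjMatrix (ZMod 2)).mulVec x i)],
          fun _ => [], onMain [.qubit q])
    | .done => (.done, [], fun _ => [], fun _ => [])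
  active := fun _ => False

/-- The protocol; the source has nothing to do. -/
def tau {n : ℕ} (G : SimpleGraph (Fin n)) [DecidableRel G.Adj] :
    Party n → LocalConverter n RealPort RealPort
  | none => .forward n RealPort
  | some i => tauParty G i

/-! ### The allowed corrections -/

/-- The biadjacency matrix from the parties outside `M` to those in `M`. -/
def biadj {n : ℕ} (G : SimpleGraph (Fin n)) [DecidableRel G.Adj] (M : Finset (Fin n)) :
    Matrix {i // i ∈ M} {i // i ∉ M} (ZMod 2) :=
  (G.adjMatrix (ZMod 2)).submatrix Subtype.val Subtype.val

/-- A factorization `Γ = V [1 R; 0 0] U` with invertible `U` and `V`. -/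
structure GaussForm {μ η : Type} [Fintype μ] [DecidableEq μ] [Fintype η] [DecidableEq η]
    (Γ : Matrix μ η (ZMod 2)) where
  r : ℕ
  k : ℕ
  l : ℕ
  U : Matrix (Fin r ⊕ Fin k) η (ZMod 2)
  Uinv : Matrix η (Fin r ⊕ Fin k) (ZMod 2)
  V : Matrix μ (Fin r ⊕ Fin l) (ZMod 2)
  Vinv : Matrix (Fin r ⊕ Fin l) μ (ZMod 2)
  R : Matrix (Fin r) (Fin k) (ZMod 2)
  U_mul : U * Uinv = 1
  mul_U : Uinv * U = 1
  V_mul : V * Vinv = 1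
  mul_V : Vinv * V = 1
  eq : Γ = V * (Matrix.fromBlocks 1 R 0 0 : Matrix (Fin r ⊕ Fin l) (Fin r ⊕ Fin k) (ZMod 2)) * U

/-- The test of corrections: all but the first `r` entries of `U x` vanish, and
`(Uᵀ)⁻¹ (z + G_H x)` is of the form `(b, Rᵀ b)`. -/
def allowed {n : ℕ} (G : SimpleGraph (Fin n)) [DecidableRel G.Adj]
    (F : ∀ M : Finset (Fin n), GaussForm (biadj G M)) : CorrTest n :=
  fun M x z =>
    (∀ j, (F M).U.mulVec x (.inr j) = 0) ∧
    ∃ b : Fin (F M).r → ZMod 2,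
      (F M).Uinv.transpose.mulVec
          (z + ((G.adjMatrix (ZMod 2)).submatrix Subtype.val Subtype.val).mulVec x) =
        Sum.elim b ((F M).R.transpose.mulVec b)

end

end GraphVerif

/-! The operators K_a = X^a Z^{Ga} fix the graph state up to a sign, so that on the graph state the
restriction of K_a to a set of qubits has the same effect as its restriction to the complementary
set (`conj_stab_univ_create`, `conj_stab_compl_create`). Signs do not matter, because operators only
enter by conjugation of density matrices. Pauli operators are therefore handled by adding exponent
vectors over Z_2.

The simulator announces ⊥ at all dishonest interfaces and thereby gets the dishonest qubits of the
graph state. It draws a uniform string y and applies K_y to them, which amounts to applying K_y to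
the honest qubits, although it cannot touch these. This is the operator that the honest parties
apply at the very end of the protocol if the coin flip yields y. The simulator then runs the
resource with corrections and the coin flip by itself and hands out its own qubits.

Corrections (x, z) that pass the test are the restriction of some K_a to the parties outside M,
because z + G_{H'} x lies in the range of the transposed biadjacency matrix (`exists_isShift`). The
simulator applies them to the dishonest qubits outside M. On the honest qubits they are made up for
by changing the string: the ideal execution with string y corresponds to the real one with string y
+ a (`conj_pauliOn_stab`). As long as an honest party has not asked for the coin, which it does only
after getting its qubit, the string has not been disclosed. Hence it can still be translated by a,
and a translate of a uniform string is uniform.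

Both acceptance probabilities are thus sums over strings, and they are compared as sums by a
bisimulation between families of configurations (`IsBisim.sum_value_eq`). Before the qubits are
released, the family of all real configurations is related to the family of all ideal ones
(`Early`). At the release the members are matched up by the translation, and from then on single
configurations are related (`Late`).

In all these relations the ideal density matrix is the conjugate of the real one by a unitary on
qubits that the distinguisher does not hold. Such a unitary commutes with all that the distinguisher
does and preserves the trace. It contains the creation of the graph state as long as a dishonest
source has kept the real resource from creating it. If the protocol succeeds, the operators of the
honest parties cancel the unitary before their qubits are output. After an abort it may remain,
since those qubits are never output.

If all interfaces are honest, the string y of the simulator acts on no qubit at all, and the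
operators of the honest parties combine to a full stabilizer, which acts trivially on the graph
state. -/

namespace GraphVerif

noncomputable section

open Matrix
open scoped ComplexOrder

/-- Density matrices on the register of an execution. -/
abbrev Mat (n m : ℕ) := Matrix (register n m → ZMod 2) (register n m → ZMod 2) ℂ

/-- The batch with the message `m` on port `k` of interface `i`. -/
def single {n : ℕ} {κ : Type} [DecidableEq κ] (i : Party n) (k : κ) (m : Msg n) :
    Batch n (Party n) κ :=
  fun i' k' => if i' = i ∧ k' = k then [m] else []

/-- Concatenation of batches. -/
def Batch.append {n : ℕ} {I κ : Type} (a b : Batch n I κ) : Batch n I κ := fun i k => a i k ++ b i k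

/-- The batch without messages. -/
def Batch.empty (n : ℕ) (I κ : Type) : Batch n I κ := fun _ _ => []

lemma Batch.append_empty {n : ℕ} {I κ : Type} (a : Batch n I κ) :
    a.append (Batch.empty n I κ) = a := by
  funext i k; simp [Batch.append, Batch.empty]

lemma Batch.empty_append {n : ℕ} {I κ : Type} (a : Batch n I κ) :
    (Batch.empty n I κ).append a = a := by
  funext i k; simp [Batch.append, Batch.empty]

lemma Batch.append_assoc {n : ℕ} {I κ : Type} (a b c : Batch n I κ) :
    (a.append b).append c = a.append (b.append c) := by
  funext i k; simp [Batch.append]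

lemma Batch.names_append {n : ℕ} {I κ : Type} [Fintype I] [Fintype κ] (a b : Batch n I κ) :
    (a.append b).names = a.names + b.names := by
  simp [Batch.names, Batch.append, Finset.sum_add_distrib]

lemma Batch.names_empty {n : ℕ} {I κ : Type} [Fintype I] [Fintype κ] :
    (Batch.empty n I κ).names = 0 := by
  simp [Batch.names, Batch.empty]

lemma applyGates_nil {n : ℕ} (W : Finset (Name n)) (ρ : Matrix (W → ZMod 2) (W → ZMod 2) ℂ) :
    applyGates W [] ρ = ρ := rfl

lemma applyGates_append {n : ℕ} (W : Finset (Name n)) (a b : List (Gate n))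
    (ρ : Matrix (W → ZMod 2) (W → ZMod 2) ℂ) :
    applyGates W (a ++ b) ρ = applyGates W b (applyGates W a ρ) := by
  simp [applyGates]

lemma applyGates_cons {n : ℕ} (W : Finset (Name n)) (g : Gate n) (b : List (Gate n))
    (ρ : Matrix (W → ZMod 2) (W → ZMod 2) ℂ) :
    applyGates W (g :: b) ρ =
      applyGates W b (g.embed W * ρ * (g.embed W).conjTranspose) := rfl

lemma applyGates_posSemidef {n : ℕ} (W : Finset (Name n)) (gs : List (Gate n))
    {ρ : Matrix (W → ZMod 2) (W → ZMod 2) ℂ} (h : ρ.PosSemidef) :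
    (applyGates W gs ρ).PosSemidef := by
  induction gs generalizing ρ with
  | nil => exact h
  | cons g gs ih => rw [applyGates_cons]; exact ih (h.mul_mul_conjTranspose_same _)

lemma trace_re_nonneg {ι : Type*} [Fintype ι] {ρ : Matrix ι ι ℂ} (h : ρ.PosSemidef) :
    0 ≤ ρ.trace.re := by
  classical
  exact (Complex.le_def.1 h.trace_nonneg).1

/-! ### Acceptance probabilities -/

section Accept

variable {n : ℕ} {κ : Type} [Fintype κ] [DecidableEq κ]

open Classical in
lemma acceptIn_active (R : Resource n κ) (D : Distinguisher n κ) (T : ℕ) (s : R.State)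
    (box : Batch n (Party n) κ) (mem : D.Mem) (h : Finset (Name n)) (ρ : Mat n D.anc)
    (hs : R.active s) :
    acceptIn R D (T + 1) s box mem h ρ =
      ((R.step s (Batch.empty n _ κ)).map fun b =>
        acceptIn R D T b.2.1 (box.append b.2.2) mem (h ∪ b.2.2.names.toFinset)
          (applyGates _ b.1 ρ)).sum := by
  rw [acceptIn, if_pos hs]
  rfl

open Classical in
lemma acceptIn_inactive (R : Resource n κ) (D : Distinguisher n κ) (T : ℕ) (s : R.State)
    (box : Batch n (Party n) κ) (mem : D.Mem) (h : Finset (Name n)) (ρ : Mat n D.anc)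
    (hs : ¬ R.active s) :
    acceptIn R D (T + 1) s box mem h ρ =
      ((D.act mem box h).map fun d =>
        match d.2.2 with
        | .halt b => if b then (applyGates _ [⟨h, d.1⟩] ρ).trace.re else 0
        | .send i k m =>
          ((R.step s (single i k m)).map fun b =>
            acceptIn R D T b.2.1 b.2.2 d.2.1 ((h \ m.qubits) ∪ b.2.2.names.toFinset)
              (applyGates _ b.1 (applyGates _ [⟨h, d.1⟩] ρ))).sum).sum := by
  rw [acceptIn, if_neg hs]
  congr 2

lemma acceptIn_nonneg (R : Resource n κ) (D : Distinguisher n κ) (T : ℕ) (s : R.State)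
    (box : Batch n (Party n) κ) (mem : D.Mem) (h : Finset (Name n)) (ρ : Mat n D.anc)
    (hρ : ρ.PosSemidef) : 0 ≤ acceptIn R D T s box mem h ρ := by
  induction T generalizing s box mem h ρ with
  | zero => simp [acceptIn]
  | succ T ih =>
    by_cases hs : R.active s
    · rw [acceptIn_active _ _ _ _ _ _ _ _ hs]
      refine List.sum_nonneg fun x hx => ?_
      obtain ⟨b, -, rfl⟩ := List.mem_map.1 hx
      exact ih _ _ _ _ _ (applyGates_posSemidef _ _ hρ)
    · rw [acceptIn_inactive _ _ _ _ _ _ _ _ hs]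
      refine List.sum_nonneg fun x hx => ?_
      obtain ⟨⟨K, mem', a⟩, -, rfl⟩ := List.mem_map.1 hx
      have hK := applyGates_posSemidef _ [⟨h, K⟩] hρ
      cases a with
      | halt b =>
        simp only
        split_ifs
        · exact trace_re_nonneg hK
        · rfl
      | send i k m =>
        refine List.sum_nonneg fun x hx => ?_
        obtain ⟨b, -, rfl⟩ := List.mem_map.1 hx
        exact ih _ _ _ _ _ (applyGates_posSemidef _ _ hK)

/-- One more step can only add accepting branches, and every branch has nonnegative weight because
density matrices stay positive semidefinite. The resulting monotonicity is what lets the supremum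
over the number of steps pass through finite sums. -/
lemma acceptIn_le_succ (R : Resource n κ) (D : Distinguisher n κ) (T : ℕ) (s : R.State)
    (box : Batch n (Party n) κ) (mem : D.Mem) (h : Finset (Name n)) (ρ : Mat n D.anc)
    (hρ : ρ.PosSemidef) :
    acceptIn R D T s box mem h ρ ≤ acceptIn R D (T + 1) s box mem h ρ := by
  induction T generalizing s box mem h ρ with
  | zero => exact (le_of_eq (by simp [acceptIn])).trans (acceptIn_nonneg _ _ _ _ _ _ _ _ hρ)
  | succ T ih =>
    by_cases hs : R.active s
    · rw [acceptIn_active _ _ _ _ _ _ _ _ hs, acceptIn_active _ _ _ _ _ _ _ _ hs]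
      exact List.sum_le_sum fun b _ => ih _ _ _ _ _ (applyGates_posSemidef _ _ hρ)
    · rw [acceptIn_inactive _ _ _ _ _ _ _ _ hs, acceptIn_inactive _ _ _ _ _ _ _ _ hs]
      refine List.sum_le_sum fun d _ => ?_
      rcases d with ⟨K, mem', a⟩
      have hK := applyGates_posSemidef _ [⟨h, K⟩] hρ
      cases a with
      | halt b => exact le_rfl
      | send i k m =>
        exact List.sum_le_sum fun b _ => ih _ _ _ _ _ (applyGates_posSemidef _ _ hK)

lemma acceptIn_mono (R : Resource n κ) (D : Distinguisher n κ) (s : R.State)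
    (box : Batch n (Party n) κ) (mem : D.Mem) (h : Finset (Name n)) (ρ : Mat n D.anc)
    (hρ : ρ.PosSemidef) : Monotone fun T => acceptIn R D T s box mem h ρ :=
  monotone_nat_of_le_succ fun T => acceptIn_le_succ R D T s box mem h ρ hρ

/-- The probability that the distinguisher outputs `1`, from a given configuration. -/
def value (R : Resource n κ) (D : Distinguisher n κ) (s : R.State)
    (box : Batch n (Party n) κ) (mem : D.Mem) (h : Finset (Name n)) (ρ : Mat n D.anc) : ENNReal :=
  ⨆ T : ℕ, ENNReal.ofReal (acceptIn R D T s box mem h ρ)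

lemma monotone_ofReal_acceptIn (R : Resource n κ) (D : Distinguisher n κ) (s : R.State)
    (box : Batch n (Party n) κ) (mem : D.Mem) (h : Finset (Name n)) (ρ : Mat n D.anc)
    (hρ : ρ.PosSemidef) : Monotone fun T => ENNReal.ofReal (acceptIn R D T s box mem h ρ) :=
  fun _ _ hT => ENNReal.ofReal_le_ofReal (acceptIn_mono R D s box mem h ρ hρ hT)

lemma value_eq_iSup_succ (R : Resource n κ) (D : Distinguisher n κ) (s : R.State)
    (box : Batch n (Party n) κ) (mem : D.Mem) (h : Finset (Name n)) (ρ : Mat n D.anc)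
    (hρ : ρ.PosSemidef) :
    value R D s box mem h ρ = ⨆ T : ℕ, ENNReal.ofReal (acceptIn R D (T + 1) s box mem h ρ) :=
  ((monotone_ofReal_acceptIn R D s box mem h ρ hρ).iSup_nat_add 1).symm

lemma ofReal_list_sum {α : Type*} (l : List α) (f : α → ℝ) (hf : ∀ a ∈ l, 0 ≤ f a) :
    ENNReal.ofReal (l.map f).sum = (l.map fun a => ENNReal.ofReal (f a)).sum := by
  induction l with
  | nil => simp
  | cons a l ih =>
    simp only [List.map_cons, List.sum_cons]
    rw [ENNReal.ofReal_add (hf a (by simp)), ih fun b hb => hf b (by simp [hb])]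
    exact List.sum_nonneg fun x hx => by
      obtain ⟨b, hb, rfl⟩ := List.mem_map.1 hx
      exact hf b (by simp [hb])

lemma iSup_list_sum {α : Type*} (l : List α) (f : α → ℕ → ENNReal)
    (hf : ∀ a ∈ l, Monotone (f a)) :
    ⨆ T, (l.map fun a => f a T).sum = (l.map fun a => ⨆ T, f a T).sum := by
  induction l with
  | nil => simp
  | cons a l ih =>
    simp only [List.map_cons, List.sum_cons]
    rw [← ih fun b hb => hf b (by simp [hb]), ENNReal.iSup_add_iSup_of_monotone (hf a (by simp))]
    intro i j hij
    exact List.sum_le_sum fun b hb => hf b (by simp [hb]) hij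

/-- In the limit the step count disappears, so that the recursion of `acceptIn` becomes an equation
for `value`. Systems that take different numbers of steps for the same reaction become comparable in
this way. -/
lemma value_active (R : Resource n κ) (D : Distinguisher n κ) (s : R.State)
    (box : Batch n (Party n) κ) (mem : D.Mem) (h : Finset (Name n)) (ρ : Mat n D.anc)
    (hρ : ρ.PosSemidef) (hs : R.active s) :
    value R D s box mem h ρ =
      ((R.step s (Batch.empty n _ κ)).map fun b =>
        value R D b.2.1 (box.append b.2.2) mem (h ∪ b.2.2.names.toFinset)
          (applyGates _ b.1 ρ)).sum := by
  rw [value_eq_iSup_succ _ _ _ _ _ _ _ hρ]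
  simp_rw [acceptIn_active _ _ _ _ _ _ _ _ hs]
  unfold value
  refine Eq.trans ?_ (iSup_list_sum (R.step s (Batch.empty n _ κ)) (fun b T => ENNReal.ofReal (acceptIn R D T b.2.1
    (box.append b.2.2) mem (h ∪ b.2.2.names.toFinset) (applyGates _ b.1 ρ))) ?_)
  · exact iSup_congr fun T => ofReal_list_sum _ _ fun b _ =>
      acceptIn_nonneg _ _ _ _ _ _ _ _ (applyGates_posSemidef _ _ hρ)
  · exact fun b _ => monotone_ofReal_acceptIn _ _ _ _ _ _ _ (applyGates_posSemidef _ _ hρ)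

lemma value_inactive (R : Resource n κ) (D : Distinguisher n κ) (s : R.State)
    (box : Batch n (Party n) κ) (mem : D.Mem) (h : Finset (Name n)) (ρ : Mat n D.anc)
    (hρ : ρ.PosSemidef) (hs : ¬ R.active s) :
    value R D s box mem h ρ =
      ((D.act mem box h).map fun d =>
        match d.2.2 with
        | .halt b => if b then ENNReal.ofReal (applyGates _ [⟨h, d.1⟩] ρ).trace.re else 0
        | .send i k m =>
          ((R.step s (single i k m)).map fun b =>
            value R D b.2.1 b.2.2 d.2.1 ((h \ m.qubits) ∪ b.2.2.names.toFinset)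
              (applyGates _ b.1 (applyGates _ [⟨h, d.1⟩] ρ))).sum).sum := by
  rw [value_eq_iSup_succ _ _ _ _ _ _ _ hρ]
  simp_rw [acceptIn_inactive _ _ _ _ _ _ _ _ hs]
  have key : ∀ d ∈ D.act mem box h, ∀ T, (0 : ℝ) ≤ match d.2.2 with
        | .halt b => if b then (applyGates _ [⟨h, d.1⟩] ρ).trace.re else 0
        | .send i k m =>
          ((R.step s (single i k m)).map fun b =>
            acceptIn R D T b.2.1 b.2.2 d.2.1 ((h \ m.qubits) ∪ b.2.2.names.toFinset)
              (applyGates _ b.1 (applyGates _ [⟨h, d.1⟩] ρ))).sum := by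
    rintro ⟨K, mem', a⟩ - T
    have hK := applyGates_posSemidef _ [⟨h, K⟩] hρ
    cases a with
    | halt b =>
      simp only
      split_ifs
      · exact trace_re_nonneg hK
      · rfl
    | send i k m =>
      refine List.sum_nonneg fun x hx => ?_
      obtain ⟨b, -, rfl⟩ := List.mem_map.1 hx
      exact acceptIn_nonneg _ _ _ _ _ _ _ _ (applyGates_posSemidef _ _ hK)
  rw [iSup_congr fun T => ofReal_list_sum _ _ fun d hd => (key d hd T), iSup_list_sum]
  · congr 2
    funext d
    rcases d with ⟨K, mem', a⟩
    have hK := applyGates_posSemidef _ [⟨h, K⟩] hρ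
    cases a with
    | halt b => cases b <;> simp
    | send i k m =>
      simp only
      unfold value
      rw [← iSup_list_sum]
      · exact iSup_congr fun T => ofReal_list_sum _ _ fun b _ =>
          acceptIn_nonneg _ _ _ _ _ _ _ _ (applyGates_posSemidef _ _ hK)
      · exact fun b _ => monotone_ofReal_acceptIn _ _ _ _ _ _ _ (applyGates_posSemidef _ _ hK)
  · rintro ⟨K, mem', a⟩ - T T' hT
    have hK := applyGates_posSemidef _ [⟨h, K⟩] hρ
    apply ENNReal.ofReal_le_ofReal
    cases a with
    | halt b => exact le_rfl
    | send i k m =>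
      exact List.sum_le_sum fun b _ => acceptIn_mono _ _ _ _ _ _ _
        (applyGates_posSemidef _ _ hK) hT

set_option linter.unusedSectionVars false

/-! ### Runs without intervention of the distinguisher -/

/-- From state `s`, the resource goes to state `s'` without further input, while applying the
given operators and sending the given messages. -/
inductive Runs (m : ℕ) (R : Resource n κ) :
    R.State → List (Gate n) → Batch n (Party n) κ → R.State → Prop
  | refl (s : R.State) : Runs m R s [] (Batch.empty n _ κ) s
  | cons {s s' s'' : R.State} {gs gs' : List (Gate n)} {out out' : Batch n (Party n) κ}
      (hstep : R.step s (Batch.empty n _ κ) = [(gs, s', out)])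
      (hidle : ¬ R.active s → s' = s ∧ out = Batch.empty n _ κ ∧
        ∀ ρ : Mat n m, applyGates _ gs ρ = ρ)
      (htail : Runs m R s' gs' out' s'') :
      Runs m R s (gs ++ gs') (out.append out') s''

lemma Runs.trans {m : ℕ} {R : Resource n κ} {s s' s'' : R.State} {gs gs' : List (Gate n)}
    {out out' : Batch n (Party n) κ} (h : Runs m R s gs out s') (h' : Runs m R s' gs' out' s'') :
    Runs m R s (gs ++ gs') (out.append out') s'' := by
  induction h with
  | refl => rw [Batch.empty_append]; exact h'
  | cons hstep hidle _ ih =>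
    rw [List.append_assoc, Batch.append_assoc]
    exact .cons hstep hidle (ih h')

/-- Every active step of the run uses up one unit of the bound, so the same bound goes further from
the end of the run. A step from an inactive state is not executed at all; `Runs` admits it only if
it changes nothing, so that a round may be described by a fixed number of steps whether or not all
of them are needed. -/
lemma Runs.acceptIn_le {D : Distinguisher n κ} {R : Resource n κ} {s s' : R.State}
    {gs : List (Gate n)} {out : Batch n (Party n) κ} (hr : Runs D.anc R s gs out s') (T : ℕ)
    (box : Batch n (Party n) κ) (mem : D.Mem) (h : Finset (Name n)) (ρ : Mat n D.anc)
    (hρ : ρ.PosSemidef) :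
    acceptIn R D T s box mem h ρ ≤
      acceptIn R D T s' (box.append out) mem (h ∪ out.names.toFinset) (applyGates _ gs ρ) := by
  induction hr generalizing box h ρ T with
  | refl s => simp [Batch.append_empty, Batch.names_empty, applyGates_nil]
  | @cons s s₁ s₂ gs gs' out out' hstep hidle _ ih =>
    have hρ' := applyGates_posSemidef (register n D.anc) gs hρ
    rw [Batch.names_append, Multiset.toFinset_add, ← Finset.union_assoc, ← Batch.append_assoc,
      applyGates_append]
    by_cases hs : R.active s
    · cases T with
      | zero => simp [acceptIn]
      | succ T =>
        rw [acceptIn_active _ _ _ _ _ _ _ _ hs, hstep]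
        simp only [List.map_cons, List.map_nil, List.sum_cons, List.sum_nil, add_zero]
        refine (ih T _ _ _ hρ').trans ?_
        exact acceptIn_le_succ _ _ _ _ _ _ _ _ (applyGates_posSemidef _ _ hρ')
    · obtain ⟨rfl, rfl, hg⟩ := hidle hs
      have := ih T box h ρ hρ
      simpa [Batch.append_empty, Batch.names_empty, hg] using this

lemma Runs.value_eq {D : Distinguisher n κ} {R : Resource n κ} {s s' : R.State}
    {gs : List (Gate n)} {out : Batch n (Party n) κ} (hr : Runs D.anc R s gs out s')
    (box : Batch n (Party n) κ) (mem : D.Mem) (h : Finset (Name n)) (ρ : Mat n D.anc)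
    (hρ : ρ.PosSemidef) :
    value R D s box mem h ρ =
      value R D s' (box.append out) mem (h ∪ out.names.toFinset) (applyGates _ gs ρ) := by
  induction hr generalizing box h ρ with
  | refl s => simp [Batch.append_empty, Batch.names_empty, applyGates_nil]
  | @cons s s₁ s₂ gs gs' out out' hstep hidle _ ih =>
    have hρ' := applyGates_posSemidef (register n D.anc) gs hρ
    rw [Batch.names_append, Multiset.toFinset_add, ← Finset.union_assoc, ← Batch.append_assoc,
      applyGates_append]
    by_cases hs : R.active s
    · rw [value_active _ _ _ _ _ _ _ hρ hs, hstep]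
      simp only [List.map_cons, List.map_nil, List.sum_cons, List.sum_nil, add_zero]
      exact ih _ _ _ hρ'
    · obtain ⟨rfl, rfl, hg⟩ := hidle hs
      have := ih box h ρ hρ
      simpa [Batch.append_empty, Batch.names_empty, hg] using this

/-- The resource reacts to the messages `inp` by going to state `s'`, while applying the given
operators and sending the given messages. -/
def Reacts (m : ℕ) (R : Resource n κ) (s : R.State) (inp : Batch n (Party n) κ)
    (gs : List (Gate n)) (out : Batch n (Party n) κ) (s' : R.State) : Prop :=
  ∃ gs₁ s₁ out₁ gs₂ out₂, R.step s inp = [(gs₁, s₁, out₁)] ∧ Runs m R s₁ gs₂ out₂ s' ∧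
    gs = gs₁ ++ gs₂ ∧ out = out₁.append out₂

lemma Reacts.trans {m : ℕ} {R : Resource n κ} {s s' s'' : R.State} {inp : Batch n (Party n) κ}
    {gs gs' : List (Gate n)} {out out' : Batch n (Party n) κ} (h : Reacts m R s inp gs out s')
    (h' : Runs m R s' gs' out' s'') :
    Reacts m R s inp (gs ++ gs') (out.append out') s'' := by
  obtain ⟨gs₁, s₁, out₁, gs₂, out₂, h1, h2, rfl, rfl⟩ := h
  exact ⟨gs₁, s₁, out₁, gs₂ ++ gs', out₂.append out', h1, h2.trans h', by simp,
    by rw [Batch.append_assoc]⟩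

lemma Reacts.acceptIn_le {D : Distinguisher n κ} {R : Resource n κ} {s s' : R.State}
    {inp : Batch n (Party n) κ}
    {gs : List (Gate n)} {out : Batch n (Party n) κ} (hr : Reacts D.anc R s inp gs out s') (T : ℕ)
    (mem : D.Mem) (h : Finset (Name n)) (ρ : Mat n D.anc) (hρ : ρ.PosSemidef) :
    ((R.step s inp).map fun b =>
        acceptIn R D T b.2.1 b.2.2 mem (h ∪ b.2.2.names.toFinset) (applyGates _ b.1 ρ)).sum ≤
      acceptIn R D T s' out mem (h ∪ out.names.toFinset) (applyGates _ gs ρ) := by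
  obtain ⟨gs₁, s₁, out₁, gs₂, out₂, h1, h2, rfl, rfl⟩ := hr
  rw [h1, Batch.names_append, Multiset.toFinset_add, ← Finset.union_assoc, applyGates_append]
  simp only [List.map_cons, List.map_nil, List.sum_cons, List.sum_nil, add_zero]
  exact h2.acceptIn_le T out₁ mem _ _ (applyGates_posSemidef _ _ hρ)

lemma Reacts.value_eq {D : Distinguisher n κ} {R : Resource n κ} {s s' : R.State}
    {inp : Batch n (Party n) κ}
    {gs : List (Gate n)} {out : Batch n (Party n) κ} (hr : Reacts D.anc R s inp gs out s')
    (mem : D.Mem) (h : Finset (Name n)) (ρ : Mat n D.anc) (hρ : ρ.PosSemidef) :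
    ((R.step s inp).map fun b =>
        value R D b.2.1 b.2.2 mem (h ∪ b.2.2.names.toFinset) (applyGates _ b.1 ρ)).sum =
      value R D s' out mem (h ∪ out.names.toFinset) (applyGates _ gs ρ) := by
  obtain ⟨gs₁, s₁, out₁, gs₂, out₂, h1, h2, rfl, rfl⟩ := hr
  rw [h1, Batch.names_append, Multiset.toFinset_add, ← Finset.union_assoc, applyGates_append]
  simp only [List.map_cons, List.map_nil, List.sum_cons, List.sum_nil, add_zero]
  exact h2.value_eq out₁ mem _ _ (applyGates_posSemidef _ _ hρ)

/-! ### Bisimulations -/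

/-- A relation between families of configurations of two resources that is preserved by whatever
a distinguisher does, until the families may be matched up with each other so that the matching
configurations satisfy the relation `Exit`. -/
def IsBisim {Y : Type} (m : ℕ) (R S : Resource n κ)
    (Rel : (Y → R.State) → (Y → Mat n m) → (Y → S.State) → (Y → Mat n m) → Finset (Name n) → Prop)
    (Exit : R.State → Mat n m → S.State → Mat n m → Finset (Name n) → Prop) : Prop :=
  ∀ s ρ t ρ' h, Rel s ρ t ρ' h →
    (∀ y, ¬ R.active (s y) ∧ ¬ S.active (t y) ∧ (ρ y).PosSemidef ∧ (ρ' y).PosSemidef ∧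
      (ρ y).trace = (ρ' y).trace) ∧
    (∀ K : Matrix (h → ZMod 2) (h → ZMod 2) ℂ,
      Rel s (fun y => applyGates _ [⟨h, K⟩] (ρ y)) t (fun y => applyGates _ [⟨h, K⟩] (ρ' y)) h) ∧
    (∀ i k msg, msg.qubits ⊆ h → ∃ (gs : Y → List (Gate n)) (out : Y → Batch n (Party n) κ)
        (s' : Y → R.State) (gs' : Y → List (Gate n)) (out' : Y → Batch n (Party n) κ)
        (t' : Y → S.State),
      (∀ y, Reacts m R (s y) (single i k msg) (gs y) (out y) (s' y)) ∧
      (∀ y, Reacts m S (t y) (single i k msg) (gs' y) (out' y) (t' y)) ∧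
      ((∃ o : Batch n (Party n) κ, (∀ y, out y = o ∧ out' y = o) ∧
          Rel s' (fun y => applyGates _ (gs y) (ρ y)) t' (fun y => applyGates _ (gs' y) (ρ' y))
            ((h \ msg.qubits) ∪ o.names.toFinset)) ∨
        ∃ e : Y ≃ Y, ∀ y, out (e y) = out' y ∧
          Exit (s' (e y)) (applyGates _ (gs (e y)) (ρ (e y))) (t' y) (applyGates _ (gs' y) (ρ' y))
            ((h \ msg.qubits) ∪ (out' y).names.toFinset)))

lemma IsBisim.symm {Y : Type} {m : ℕ} {R S : Resource n κ}
    {Rel : (Y → R.State) → (Y → Mat n m) → (Y → S.State) → (Y → Mat n m) → Finset (Name n) → Prop}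
    {Exit : R.State → Mat n m → S.State → Mat n m → Finset (Name n) → Prop}
    (hb : IsBisim m R S Rel Exit) :
    IsBisim m S R (fun t ρ' s ρ h => Rel s ρ t ρ' h) (fun t ρ' s ρ h => Exit s ρ t ρ' h) := by
  intro t ρ' s ρ h hrel
  obtain ⟨h1, h2, h3⟩ := hb s ρ t ρ' h hrel
  refine ⟨fun y => ?_, h2, fun i k msg hm => ?_⟩
  · obtain ⟨a, b, c, d, e⟩ := h1 y
    exact ⟨b, a, d, c, e.symm⟩
  · obtain ⟨gs, out, s', gs', out', t', ha, hb', hc⟩ := h3 i k msg hm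
    refine ⟨gs', out', t', gs, out, s', hb', ha, ?_⟩
    rcases hc with ⟨o, ho, hr⟩ | ⟨e, he⟩
    · exact .inl ⟨o, fun y => (ho y).symm, hr⟩
    · refine .inr ⟨e.symm, fun y => ?_⟩
      have := he (e.symm y)
      rw [Equiv.apply_symm_apply] at this
      refine ⟨this.1.symm, ?_⟩
      rw [this.1]
      exact this.2

lemma list_sum_finset_sum {α : Type*} {Y : Type} [Fintype Y] (l : List α) (f : Y → α → ENNReal) :
    ∑ y, (l.map (f y)).sum = (l.map fun a => ∑ y, f y a).sum := by
  induction l with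
  | nil => simp
  | cons a l ih => simp [Finset.sum_add_distrib, ih]

/-- Induction on the number of steps on the side of `R` only; `S` enters with its full value, so its
own number of steps is irrelevant. The distinguisher sees the same messages in all members of both
families and holds the same qubits, hence takes the same branches, and the sum over the family moves
inside the sum over its branches. If it halts, the traces agree member by member. -/
lemma IsBisim.sum_acceptIn_le {Y : Type} [Fintype Y] {R S : Resource n κ} {D : Distinguisher n κ}
    {Rel : (Y → R.State) → (Y → Mat n D.anc) → (Y → S.State) → (Y → Mat n D.anc) →
      Finset (Name n) → Prop}
    {Exit : R.State → Mat n D.anc → S.State → Mat n D.anc → Finset (Name n) → Prop}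
    (hb : IsBisim D.anc R S Rel Exit)
    (hexit : ∀ s ρ t ρ' h, Exit s ρ t ρ' h → ∀ box mem,
      value R D s box mem h ρ ≤ value S D t box mem h ρ')
    (T : ℕ) {s ρ t ρ' h} (hrel : Rel s ρ t ρ' h) (box : Batch n (Party n) κ) (mem : D.Mem) :
    ∑ y, ENNReal.ofReal (acceptIn R D T (s y) box mem h (ρ y)) ≤
      ∑ y, value S D (t y) box mem h (ρ' y) := by
  induction T generalizing s ρ t ρ' h box mem with
  | zero => simp [acceptIn]
  | succ T ih =>
    obtain ⟨h1, h2, h3⟩ := hb s ρ t ρ' h hrel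
    have hval : ∀ y, value S D (t y) box mem h (ρ' y) = _ := fun y =>
      value_inactive S D (t y) box mem h (ρ' y) (h1 y).2.2.2.1 (h1 y).2.1
    have hacc : ∀ y, ENNReal.ofReal (acceptIn R D (T + 1) (s y) box mem h (ρ y)) = _ := fun y =>
      congrArg ENNReal.ofReal (acceptIn_inactive R D T (s y) box mem h (ρ y) (h1 y).1)
    simp_rw [hval, hacc]
    have key : ∀ y, ∀ d ∈ D.act mem box h, (0 : ℝ) ≤ match d.2.2 with
        | .halt b => if b then (applyGates _ [⟨h, d.1⟩] (ρ y)).trace.re else 0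
        | .send i k m =>
          ((R.step (s y) (single i k m)).map fun b =>
            acceptIn R D T b.2.1 b.2.2 d.2.1 ((h \ m.qubits) ∪ b.2.2.names.toFinset)
              (applyGates _ b.1 (applyGates _ [⟨h, d.1⟩] (ρ y)))).sum := by
      rintro y ⟨K, mem', a⟩ -
      have hK := applyGates_posSemidef _ [⟨h, K⟩] (h1 y).2.2.1
      cases a with
      | halt b =>
        simp only
        split_ifs
        · exact trace_re_nonneg hK
        · rfl
      | send i k m =>
        refine List.sum_nonneg fun x hx => ?_
        obtain ⟨b, -, rfl⟩ := List.mem_map.1 hx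
        exact acceptIn_nonneg _ _ _ _ _ _ _ _ (applyGates_posSemidef _ _ hK)
    rw [Finset.sum_congr rfl fun y _ => ofReal_list_sum _ _ (key y), list_sum_finset_sum,
      list_sum_finset_sum]
    refine List.sum_le_sum fun d hd => ?_
    rcases d with ⟨K, mem', a⟩
    have hrelK := h2 K
    obtain ⟨k1, -, k3⟩ := hb _ _ _ _ _ hrelK
    cases a with
    | halt b =>
      cases b with
      | false => simp
      | true =>
        simp only [if_true]
        exact le_of_eq (Finset.sum_congr rfl fun y _ => by rw [(k1 y).2.2.2.2])
    | send i k m =>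
      have hm := D.sends_held mem box h _ hd i k m rfl
      obtain ⟨gs, out, s', gs', out', t', ha, hb', hc⟩ := k3 i k m hm
      simp only
      have e1 : ∀ y, ENNReal.ofReal ((R.step (s y) (single i k m)).map fun b =>
            acceptIn R D T b.2.1 b.2.2 mem' ((h \ m.qubits) ∪ b.2.2.names.toFinset)
              (applyGates _ b.1 (applyGates _ [⟨h, K⟩] (ρ y)))).sum ≤ _ := fun y =>
        ENNReal.ofReal_le_ofReal ((ha y).acceptIn_le T mem' (h \ m.qubits) _ (k1 y).2.2.1)
      have e2 : ∀ y, ((S.step (t y) (single i k m)).map fun b =>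
            value S D b.2.1 b.2.2 mem' ((h \ m.qubits) ∪ b.2.2.names.toFinset)
              (applyGates _ b.1 (applyGates _ [⟨h, K⟩] (ρ' y)))).sum = _ := fun y =>
        (hb' y).value_eq mem' (h \ m.qubits) _ (k1 y).2.2.2.1
      refine (Finset.sum_le_sum fun y _ => e1 y).trans ?_
      rw [Finset.sum_congr rfl fun y _ => e2 y]
      rcases hc with ⟨o, ho, hr⟩ | ⟨e, he⟩
      · have := ih hr o mem'
        simpa only [(ho _).1, (ho _).2] using this
      -- From here on members with different indices correspond to each other. Only the sum over the
      -- whole family is being compared, so it may be rearranged along `e`.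
      · rw [← e.sum_comp]
        refine Finset.sum_le_sum fun y _ => ?_
        rw [(he y).1]
        exact (le_iSup (fun T => ENNReal.ofReal (acceptIn R D T _ _ _ _ _)) T).trans
          (hexit _ _ _ _ _ (he y).2 _ _)

lemma IsBisim.sum_value_le {Y : Type} [Fintype Y] {R S : Resource n κ} {D : Distinguisher n κ}
    {Rel : (Y → R.State) → (Y → Mat n D.anc) → (Y → S.State) → (Y → Mat n D.anc) →
      Finset (Name n) → Prop}
    {Exit : R.State → Mat n D.anc → S.State → Mat n D.anc → Finset (Name n) → Prop}
    (hb : IsBisim D.anc R S Rel Exit)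
    (hexit : ∀ s ρ t ρ' h, Exit s ρ t ρ' h → ∀ box mem,
      value R D s box mem h ρ ≤ value S D t box mem h ρ')
    {s ρ t ρ' h} (hrel : Rel s ρ t ρ' h) (box : Batch n (Party n) κ) (mem : D.Mem) :
    ∑ y, value R D (s y) box mem h (ρ y) ≤ ∑ y, value S D (t y) box mem h (ρ' y) := by
  have hpos := fun y => ((hb s ρ t ρ' h hrel).1 y).2.2.1
  unfold value
  rw [ENNReal.finsetSum_iSup_of_monotone fun y =>
    monotone_ofReal_acceptIn R D (s y) box mem h (ρ y) (hpos y)]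
  exact iSup_le fun T => hb.sum_acceptIn_le hexit T hrel box mem

/-- Each one-sided bound compares finitely many steps on one side with the limit on the other, and
the notion of bisimulation is symmetric, the matching being replaced by its inverse. -/
lemma IsBisim.sum_value_eq {Y : Type} [Fintype Y] {R S : Resource n κ} {D : Distinguisher n κ}
    {Rel : (Y → R.State) → (Y → Mat n D.anc) → (Y → S.State) → (Y → Mat n D.anc) →
      Finset (Name n) → Prop}
    {Exit : R.State → Mat n D.anc → S.State → Mat n D.anc → Finset (Name n) → Prop}
    (hb : IsBisim D.anc R S Rel Exit)
    (hexit : ∀ s ρ t ρ' h, Exit s ρ t ρ' h → ∀ box mem,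
      value R D s box mem h ρ = value S D t box mem h ρ')
    {s ρ t ρ' h} (hrel : Rel s ρ t ρ' h) (box : Batch n (Party n) κ) (mem : D.Mem) :
    ∑ y, value R D (s y) box mem h (ρ y) = ∑ y, value S D (t y) box mem h (ρ' y) :=
  le_antisymm (hb.sum_value_le (fun s ρ t ρ' h he box mem => (hexit s ρ t ρ' h he box mem).le)
      hrel box mem)
    (hb.symm.sum_value_le (fun s ρ t ρ' h he box mem => (hexit t ρ' s ρ h he box mem).ge)
      hrel box mem)

end Accept

end

end GraphVerif

/-! ### Operators on the register, Pauli operators and the stabilizers of the graph state. -/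

namespace GraphVerif

noncomputable section

open Matrix
open scoped ComplexOrder

/-! ### Operators on the register -/

section Embed

variable {n : ℕ} {W : Finset (Name n)}

/-- The part of a basis state of the register `W` that lives on `E`. -/
def restrictTo (W E : Finset (Name n)) (s : W → ZMod 2) (q : E) : ZMod 2 :=
  if h : q.1 ∈ W then s ⟨q.1, h⟩ else 0

lemma embed_apply (g : Gate n) (s t : W → ZMod 2) :
    g.embed W s t = if ∀ q : W, q.1 ∉ g.supp → s q = t q then
      g.mat (restrictTo W g.supp s) (restrictTo W g.supp t) else 0 := rfl

/-- The intermediate basis state is forced: it agrees with `s` outside the support of `g` and with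
`t` outside that of `g'`, and the supports being disjoint one of these applies to every qubit. The
matrix product thus has a single term, and the result is symmetric in the two operators. -/
lemma embed_mul_apply_of_disjoint (g g' : Gate n) (hd : Disjoint g.supp g'.supp)
    (s t : W → ZMod 2) :
    (g.embed W * g'.embed W) s t =
      if ∀ q : W, q.1 ∉ g.supp → q.1 ∉ g'.supp → s q = t q then
        g.mat (restrictTo W g.supp s) (restrictTo W g.supp t) *
          g'.mat (restrictTo W g'.supp s) (restrictTo W g'.supp t) else 0 := by
  rw [Matrix.mul_apply]
  have hdis : ∀ q, q ∈ g.supp → q ∉ g'.supp := fun q hq hq' =>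
    Finset.disjoint_left.1 hd hq hq'
  rw [Finset.sum_eq_single (fun q : W => if q.1 ∈ g.supp then t q else s q)]
  · rw [embed_apply, embed_apply, if_pos (fun q hq => by simp [hq])]
    have h1 : restrictTo W g.supp (fun q : W => if q.1 ∈ g.supp then t q else s q) =
        restrictTo W g.supp t := by
      funext q; simp [restrictTo]
    have h2 : restrictTo W g'.supp (fun q : W => if q.1 ∈ g.supp then t q else s q) =
        restrictTo W g'.supp s := by
      funext q
      have : q.1 ∉ g.supp := fun h => hdis _ h q.2
      simp [restrictTo, this]
    rw [h1, h2]
    by_cases hc : ∀ q : W, q.1 ∉ g.supp → q.1 ∉ g'.supp → s q = t q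
    · rw [if_pos hc, if_pos]
      intro q hq
      by_cases hq' : q.1 ∈ g.supp
      · simp [hq']
      · simpa [hq'] using hc q hq' hq
    · rw [if_neg hc, if_neg, mul_zero]
      intro h
      exact hc fun q hq hq' => by simpa [hq] using h q hq'
  · intro u _ hu
    rw [embed_apply, embed_apply]
    by_cases h1 : ∀ q : W, q.1 ∉ g.supp → s q = u q
    · by_cases h2 : ∀ q : W, q.1 ∉ g'.supp → u q = t q
      · exfalso
        apply hu
        funext q
        by_cases hq : q.1 ∈ g.supp
        · simp [hq, h2 q (hdis _ hq)]
        · simp [hq, h1 q hq]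
      · rw [if_neg h2, mul_zero]
    · rw [if_neg h1, zero_mul]
  · simp

lemma embed_commute_of_disjoint (g g' : Gate n) (hd : Disjoint g.supp g'.supp) :
    g.embed W * g'.embed W = g'.embed W * g.embed W := by
  ext s t
  rw [embed_mul_apply_of_disjoint _ _ hd, embed_mul_apply_of_disjoint _ _ hd.symm]
  have : (∀ q : W, q.1 ∉ g.supp → q.1 ∉ g'.supp → s q = t q) ↔
      ∀ q : W, q.1 ∉ g'.supp → q.1 ∉ g.supp → s q = t q :=
    ⟨fun h q a b => h q b a, fun h q a b => h q b a⟩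
  simp only [this, mul_comm]

/-- The intermediate basis states that contribute are those that agree with `s` outside `E`; they
are parametrized by the basis states of `E`. -/
lemma embed_mul {E : Finset (Name n)} (hE : E ⊆ W) (A B : Matrix (E → ZMod 2) (E → ZMod 2) ℂ) :
    Gate.embed ⟨E, A⟩ W * Gate.embed ⟨E, B⟩ W = Gate.embed ⟨E, A * B⟩ W := by
  ext s t
  rw [Matrix.mul_apply, embed_apply]
  simp only
  let e : (E → ZMod 2) → (W → ZMod 2) := fun w q => if h : q.1 ∈ E then w ⟨q.1, h⟩ else s q
  have hre : ∀ w, restrictTo W E (e w) = w := by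
    intro w; funext q; simp [restrictTo, e, hE q.2]
  have he : Function.Injective e := fun w w' h => by rw [← hre w, ← hre w', h]
  by_cases hst : ∀ q : W, q.1 ∉ E → s q = t q
  · rw [if_pos hst, Matrix.mul_apply]
    symm
    apply Fintype.sum_of_injective e he
    · intro u hu
      rw [embed_apply, if_neg, zero_mul]
      intro h
      apply hu
      refine ⟨restrictTo W E u, ?_⟩
      funext q
      by_cases hq : q.1 ∈ E
      · simp [e, hq, restrictTo]
      · simp [e, hq, h q hq]
    · intro w
      rw [embed_apply, embed_apply, if_pos, if_pos, hre]
      · intro q hq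
        change q.1 ∉ E at hq
        simp [e, hq, hst q hq]
      · intro q hq
        change q.1 ∉ E at hq
        simp [e, hq]
  · rw [if_neg hst]
    refine Finset.sum_eq_zero fun u _ => ?_
    rw [embed_apply, embed_apply]
    by_cases h1 : ∀ q : W, q.1 ∉ E → s q = u q
    · rw [if_neg (c := ∀ q : W, q.1 ∉ E → u q = t q), mul_zero]
      exact fun h2 => hst fun q hq => (h1 q hq).trans (h2 q hq)
    · rw [if_neg h1, zero_mul]

lemma embed_one (E : Finset (Name n)) :
    Gate.embed ⟨E, (1 : Matrix (E → ZMod 2) (E → ZMod 2) ℂ)⟩ W = 1 := by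
  ext s t
  rw [embed_apply, Matrix.one_apply]
  simp only [Matrix.one_apply]
  by_cases hst : s = t
  · subst hst; simp
  · rw [if_neg hst]
    split_ifs with h1 h2
    · exfalso
      apply hst
      funext q
      by_cases hq : q.1 ∈ E
      · have := congrFun h2 ⟨q.1, hq⟩
        simpa [restrictTo] using this
      · exact h1 q hq
    · rfl
    · rfl

lemma embed_smul (E : Finset (Name n)) (c : ℂ) (A : Matrix (E → ZMod 2) (E → ZMod 2) ℂ) :
    Gate.embed ⟨E, c • A⟩ W = c • Gate.embed ⟨E, A⟩ W := by
  ext s t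
  rw [Matrix.smul_apply, embed_apply, embed_apply]
  simp only [Matrix.smul_apply, smul_eq_mul]
  split_ifs <;> simp

lemma embed_conjTranspose (E : Finset (Name n)) (A : Matrix (E → ZMod 2) (E → ZMod 2) ℂ) :
    (Gate.embed ⟨E, A⟩ W)ᴴ = Gate.embed ⟨E, Aᴴ⟩ W := by
  ext s t
  rw [Matrix.conjTranspose_apply, embed_apply, embed_apply]
  simp only [Matrix.conjTranspose_apply, eq_comm (a := t _)]
  split_ifs <;> simp

lemma embed_isometry {E : Finset (Name n)} (hE : E ⊆ W)
    {A : Matrix (E → ZMod 2) (E → ZMod 2) ℂ} (hA : Aᴴ * A = 1) :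
    (Gate.embed ⟨E, A⟩ W)ᴴ * Gate.embed ⟨E, A⟩ W = 1 := by
  rw [embed_conjTranspose, embed_mul hE, hA, embed_one E]

/-- Conjugation of a density matrix by an operator. -/
def conj {ι : Type*} [Fintype ι] (U ρ : Matrix ι ι ℂ) : Matrix ι ι ℂ := U * ρ * Uᴴ

lemma conj_conj {ι : Type*} [Fintype ι] (U V ρ : Matrix ι ι ℂ) :
    conj U (conj V ρ) = conj (U * V) ρ := by
  simp [conj, Matrix.mul_assoc]

lemma conj_one {ι : Type*} [Fintype ι] [DecidableEq ι] (ρ : Matrix ι ι ℂ) : conj 1 ρ = ρ := by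
  simp [conj]

/-- Phases cancel under conjugation. All signs from commuting Pauli operators, and the eigenvalues
of stabilizers, are disposed of by this lemma. -/
lemma conj_smul_of_norm {ι : Type*} [Fintype ι] (c : ℂ) (hc : c * star c = 1)
    (U ρ : Matrix ι ι ℂ) : conj (c • U) ρ = conj U ρ := by
  rw [conj, Matrix.conjTranspose_smul, Matrix.smul_mul, Matrix.smul_mul, Matrix.mul_smul, smul_smul,
    hc, one_smul, conj]

lemma trace_conj {ι : Type*} [Fintype ι] [DecidableEq ι] {U : Matrix ι ι ℂ} (hU : Uᴴ * U = 1)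
    (ρ : Matrix ι ι ℂ) : (conj U ρ).trace = ρ.trace := by
  rw [conj, Matrix.trace_mul_comm, ← Matrix.mul_assoc, hU, Matrix.one_mul]

lemma conj_posSemidef {ι : Type*} [Fintype ι] (U : Matrix ι ι ℂ) {ρ : Matrix ι ι ℂ}
    (hρ : ρ.PosSemidef) : (conj U ρ).PosSemidef := hρ.mul_mul_conjTranspose_same _

lemma applyGates_singleton (W : Finset (Name n)) (g : Gate n)
    (ρ : Matrix (W → ZMod 2) (W → ZMod 2) ℂ) : applyGates W [g] ρ = conj (g.embed W) ρ := rfl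

/-- The operator `U` on the register is unitary and acts on the qubits in `Z` only. -/
structure ActsOn (W Z : Finset (Name n)) (U : Matrix (W → ZMod 2) (W → ZMod 2) ℂ) : Prop where
  isometry : Uᴴ * U = 1
  commute : ∀ g : Gate n, Disjoint g.supp Z → U * g.embed W = g.embed W * U

lemma ActsOn.one (W Z : Finset (Name n)) : ActsOn W Z 1 :=
  ⟨by simp, fun g _ => by simp⟩

lemma ActsOn.mul {Z : Finset (Name n)} {U V : Matrix (W → ZMod 2) (W → ZMod 2) ℂ}
    (hU : ActsOn W Z U) (hV : ActsOn W Z V) : ActsOn W Z (U * V) where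
  isometry := by
    rw [Matrix.conjTranspose_mul, Matrix.mul_assoc, ← Matrix.mul_assoc Uᴴ, hU.isometry,
      Matrix.one_mul, hV.isometry]
  commute g hg := by
    rw [Matrix.mul_assoc, hV.commute g hg, ← Matrix.mul_assoc, hU.commute g hg, Matrix.mul_assoc]

lemma ActsOn.mono {Z Z' : Finset (Name n)} {U : Matrix (W → ZMod 2) (W → ZMod 2) ℂ}
    (hU : ActsOn W Z U) (h : Z ⊆ Z') : ActsOn W Z' U :=
  ⟨hU.isometry, fun g hg => hU.commute g (hg.mono_right h)⟩

lemma ActsOn.embed {Z : Finset (Name n)} {A : Matrix (Z → ZMod 2) (Z → ZMod 2) ℂ} (hZ : Z ⊆ W)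
    (hA : Aᴴ * A = 1) : ActsOn W Z (Gate.embed ⟨Z, A⟩ W) :=
  ⟨embed_isometry hZ hA, fun _ hg => embed_commute_of_disjoint _ _ hg.symm⟩

/-- An operator on qubits out of reach can be moved past everything that is done elsewhere; this
keeps real and ideal density matrices related while the distinguisher acts. -/
lemma ActsOn.conj_embed {Z : Finset (Name n)} {U : Matrix (W → ZMod 2) (W → ZMod 2) ℂ}
    (hU : ActsOn W Z U) (g : Gate n) (hg : Disjoint g.supp Z)
    (ρ : Matrix (W → ZMod 2) (W → ZMod 2) ℂ) :
    conj (g.embed W) (conj U ρ) = conj U (conj (g.embed W) ρ) := by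
  rw [conj_conj, conj_conj, hU.commute g hg]

end Embed

/-! ### Pauli operators -/

section Pauli

variable {n : ℕ} {W : Finset (Name n)}

/-- The sign `(-1)^x`. -/
def sign (x : ZMod 2) : ℂ := if x = 1 then -1 else 1

lemma sign_zero : sign 0 = 1 := by simp [sign]

lemma sign_add (x y : ZMod 2) : sign (x + y) = sign x * sign y := by
  have h : ∀ z : ZMod 2, z = 0 ∨ z = 1 := by decide
  rcases h x with rfl | rfl <;> rcases h y with rfl | rfl <;>
    simp [sign, show (1 : ZMod 2) + 1 = 0 from by decide]

lemma sign_sum {ι : Type*} (s : Finset ι) (f : ι → ZMod 2) :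
    sign (∑ i ∈ s, f i) = ∏ i ∈ s, sign (f i) := by
  classical
  induction s using Finset.induction_on with
  | empty => simp [sign_zero]
  | insert a s ha ih => rw [Finset.sum_insert ha, Finset.prod_insert ha, sign_add, ih]

lemma sign_mul_star (x : ZMod 2) : sign x * star (sign x) = 1 := by
  unfold sign; split_ifs <;> simp

lemma star_sign (x : ZMod 2) : star (sign x) = sign x := by
  unfold sign; split_ifs <;> simp

lemma ite_and_eq_sign (x y : ZMod 2) : (if x = 1 ∧ y = 1 then (-1 : ℂ) else 1) = sign (x * y) := by
  have h : ∀ z : ZMod 2, z = 0 ∨ z = 1 := by decide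
  rcases h x with rfl | rfl <;> rcases h y with rfl | rfl <;> simp [sign]

/-- The operator `X^a Z^b` on the register. -/
def pauliOn (W : Finset (Name n)) (a b : Name n → ZMod 2) :
    Matrix (W → ZMod 2) (W → ZMod 2) ℂ :=
  fun s t => if ∀ q : W, s q = t q + a q then sign (∑ q : W, b q * t q) else 0

/-- The restriction of a function to `E`, extended by zero. -/
def cutoff (E : Finset (Name n)) (a : Name n → ZMod 2) (q : Name n) : ZMod 2 :=
  if q ∈ E then a q else 0

/-- With exponent vectors extended by zero, Pauli operators on different sets of qubits live in one
group, and composing them becomes addition of vectors. -/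
lemma pauli_embed (E : Finset (Name n)) (hE : E ⊆ W) (a b : Name n → ZMod 2) :
    (pauli E a b).embed W = pauliOn W (cutoff E a) (cutoff E b) := by
  ext s t
  rw [embed_apply]
  simp only [pauli, pauliOn, ite_and_eq_sign]
  have hcond : (∀ q : W, s q = t q + cutoff E a q) ↔
      (∀ q : W, q.1 ∉ E → s q = t q) ∧
        ∀ q : E, restrictTo W E s q = restrictTo W E t q + a q := by
    constructor
    · intro h
      refine ⟨fun q hq => by simpa [cutoff, hq] using h q, fun q => ?_⟩
      have := h ⟨q.1, hE q.2⟩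
      simpa [restrictTo, cutoff, hE q.2] using this
    · rintro ⟨h1, h2⟩ q
      by_cases hq : q.1 ∈ E
      · have := h2 ⟨q.1, hq⟩
        simp only [restrictTo, q.2, dif_pos] at this
        rwa [cutoff, if_pos hq]
      · simpa [cutoff, hq] using h1 q hq
  have hsum : ∑ q : W, cutoff E b q * t q = ∑ q : E, b q * restrictTo W E t q := by
    symm
    apply Fintype.sum_of_injective (fun q : E => (⟨q.1, hE q.2⟩ : W))
    · intro q q' h
      exact Subtype.ext (congrArg (fun z : W => z.1) h)
    · intro q hq
      have : q.1 ∉ E := fun h => hq ⟨⟨q.1, h⟩, rfl⟩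
      simp [cutoff, this]
    · intro q
      rw [cutoff, if_pos q.2, restrictTo, dif_pos (hE q.2)]
  simp only [hcond, hsum, sign_sum]
  split_ifs <;> first | rfl | tauto

/-- The sign arises from moving Z^b past X^{a'}. -/
lemma pauliOn_mul (a b a' b' : Name n → ZMod 2) :
    pauliOn W a b * pauliOn W a' b' =
      sign (∑ q : W, b q * a' q) • pauliOn W (a + a') (b + b') := by
  ext s t
  rw [Matrix.mul_apply, Finset.sum_eq_single (fun q => t q + a' q)]
  · simp only [pauliOn, Matrix.smul_apply, smul_eq_mul, implies_true, if_true, Pi.add_apply]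
    have : ∀ q : W, t q + a' q + a q = t q + (a q + a' q) := fun q => by ring
    simp only [this]
    split_ifs
    · rw [← sign_add, ← sign_add, ← Finset.sum_add_distrib, ← Finset.sum_add_distrib]
      congr 1
      exact Finset.sum_congr rfl fun q _ => by ring
    · simp
  · intro u _ hu
    simp only [pauliOn]
    rw [if_neg (c := ∀ q : W, u q = t q + a' q), mul_zero]
    exact fun h => hu (funext h)
  · simp

lemma pauliOn_zero : pauliOn W 0 0 = 1 := by
  ext s t
  have : (∀ q : W, s q = t q + 0) ↔ s = t := by simp [funext_iff]
  simp only [pauliOn, Matrix.one_apply, Pi.zero_apply, zero_mul, Finset.sum_const_zero, sign_zero,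
    this]

lemma zmod_two_add_self (x : ZMod 2) : x + x = 0 := CharTwo.add_self_eq_zero x

lemma add_self_fun {ι : Type*} (x : ι → ZMod 2) : x + x = 0 := by
  funext i; exact zmod_two_add_self _

lemma pauliOn_conjTranspose (a b : Name n → ZMod 2) :
    (pauliOn W a b)ᴴ = sign (∑ q : W, b q * a q) • pauliOn W a b := by
  ext s t
  rw [Matrix.conjTranspose_apply]
  simp only [pauliOn, Matrix.smul_apply, smul_eq_mul]
  have hiff : (∀ q : W, t q = s q + a q) ↔ ∀ q : W, s q = t q + a q := by
    constructor <;> intro h q <;> rw [h q, add_assoc, zmod_two_add_self, add_zero]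
  simp only [hiff]
  split_ifs with h
  · rw [star_sign, ← sign_add, ← Finset.sum_add_distrib]
    congr 1
    exact Finset.sum_congr rfl fun q _ => by rw [h q]; ring
  · simp

lemma pauliOn_isometry (a b : Name n → ZMod 2) : (pauliOn W a b)ᴴ * pauliOn W a b = 1 := by
  rw [pauliOn_conjTranspose, Matrix.smul_mul, pauliOn_mul, add_self_fun, add_self_fun, pauliOn_zero,
    smul_smul, ← sign_add, zmod_two_add_self, sign_zero, one_smul]

lemma conj_pauliOn_conj (a b a' b' : Name n → ZMod 2) (ρ : Matrix (W → ZMod 2) (W → ZMod 2) ℂ) :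
    conj (pauliOn W a b) (conj (pauliOn W a' b') ρ) = conj (pauliOn W (a + a') (b + b')) ρ := by
  rw [conj_conj, pauliOn_mul, conj_smul_of_norm _ (sign_mul_star _)]

lemma cutoff_self {E : Finset (Name n)} {a : Name n → ZMod 2} (h : ∀ q, q ∉ E → a q = 0) :
    cutoff E a = a := by
  funext q
  by_cases hq : q ∈ E
  · simp [cutoff, hq]
  · simp [cutoff, hq, h q hq]

lemma ActsOn.pauliOn {Z : Finset (Name n)} (hZ : Z ⊆ W) {a b : Name n → ZMod 2}
    (ha : ∀ q, q ∉ Z → a q = 0) (hb : ∀ q, q ∉ Z → b q = 0) : ActsOn W Z (pauliOn W a b) := by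
  refine ⟨pauliOn_isometry a b, fun g hg => ?_⟩
  rw [← cutoff_self ha, ← cutoff_self hb, ← pauli_embed Z hZ]
  exact embed_commute_of_disjoint _ _ hg.symm

lemma applyGates_pauli {E : Finset (Name n)} (hE : E ⊆ W) (a b : Name n → ZMod 2)
    (ρ : Matrix (W → ZMod 2) (W → ZMod 2) ℂ) :
    applyGates W [pauli E a b] ρ = conj (pauliOn W (cutoff E a) (cutoff E b)) ρ := by
  rw [applyGates_singleton, pauli_embed E hE]

lemma pauli_isometry (E : Finset (Name n)) (a b : Name n → ZMod 2) :
    (pauli E a b).matᴴ * (pauli E a b).mat = 1 := by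
  have hmat : (pauli E a b).mat = pauliOn E a b := by
    ext s t
    simp only [pauli, ite_and_eq_sign, GraphVerif.pauliOn, sign_sum]
  rw [hmat]
  exact pauliOn_isometry a b

end Pauli

/-! ### The graph state -/

section Graph

variable {n : ℕ} (G : SimpleGraph (Fin n)) [DecidableRel G.Adj]

/-- The names of the graph qubits of the parties in `A`. -/
def names (A : Finset (Fin n)) : Finset (Name n) := A.map Function.Embedding.inl

lemma mem_names {A : Finset (Fin n)} {i : Fin n} : (Sum.inl i : Name n) ∈ names A ↔ i ∈ A := by
  simp [names]

lemma inr_notMem_names {A : Finset (Fin n)} {k : ℕ} : (Sum.inr k : Name n) ∉ names A := by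
  simp [names]

lemma names_subset_register {m : ℕ} (A : Finset (Fin n)) : names A ⊆ register n m :=
  (Finset.map_subset_map.2 (Finset.subset_univ A)).trans Finset.subset_union_left

/-- The vector with the entries of `x` at the graph qubits of the parties in `A`. -/
def onNames (A : Finset (Fin n)) (x : Fin n → ZMod 2) : Name n → ZMod 2 :=
  Sum.elim (fun i => if i ∈ A then x i else 0) 0

lemma onNames_eq_zero {A : Finset (Fin n)} {x : Fin n → ZMod 2} {q : Name n} (hq : q ∉ names A) :
    onNames A x q = 0 := by
  rcases q with i | k
  · have : i ∉ A := fun h => hq (mem_names.2 h)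
    simp [onNames, this]
  · rfl

lemma cutoff_names (A : Finset (Fin n)) (x : Fin n → ZMod 2) :
    cutoff (names A) (Sum.elim x 0) = onNames A x := by
  funext q
  rcases q with i | k
  · simp [cutoff, onNames, mem_names]
  · simp [cutoff, onNames]

lemma onNames_union {A B : Finset (Fin n)} (h : Disjoint A B) (x : Fin n → ZMod 2) :
    onNames (A ∪ B) x = onNames A x + onNames B x := by
  funext q
  rcases q with i | k
  · have : i ∈ A → i ∉ B := fun hA hB => Finset.disjoint_left.1 h hA hB
    by_cases hA : i ∈ A <;> by_cases hB : i ∈ B <;> simp_all [onNames]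
  · simp [onNames]

/-- The vector `G x`. -/
def nbr (x : Fin n → ZMod 2) : Fin n → ZMod 2 := (G.adjMatrix (ZMod 2)).mulVec x

lemma nbr_add (x y : Fin n → ZMod 2) : nbr G (x + y) = nbr G x + nbr G y :=
  Matrix.mulVec_add _ _ _

/-- The operator `X^x Z^{Gx}` restricted to the graph qubits of the parties in `A`. -/
def stab (W : Finset (Name n)) (A : Finset (Fin n)) (x : Fin n → ZMod 2) :
    Matrix (W → ZMod 2) (W → ZMod 2) ℂ :=
  pauliOn W (onNames A x) (onNames A (nbr G x))

lemma ActsOn.stab {W : Finset (Name n)} (A : Finset (Fin n)) (hA : names A ⊆ W)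
    (x : Fin n → ZMod 2) : ActsOn W (names A) (stab G W A x) :=
  ActsOn.pauliOn hA (fun _ => onNames_eq_zero) (fun _ => onNames_eq_zero)

/-- The exponent of the sign of the graph state. -/
def quad (x : Fin n → ZMod 2) : ZMod 2 :=
  ∑ e ∈ (Finset.univ : Finset (Fin n × Fin n)).filter (fun e => e.1 < e.2 ∧ G.Adj e.1 e.2),
    x e.1 * x e.2

/-- Polarization of the quadratic form of the graph: an edge {i, j} contributes the cross terms x_i
y_j and y_i x_j, and these are the terms of ⟨Gy, x⟩ for its two orientations. This identity is the
reason why X^x Z^{Gx} stabilizes the graph state. -/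
lemma quad_add (x y : Fin n → ZMod 2) :
    quad G (x + y) = quad G x + quad G y + ∑ i, nbr G y i * x i := by
  have hcross : ∑ i, nbr G y i * x i =
      ∑ e ∈ (Finset.univ : Finset (Fin n × Fin n)).filter (fun e => e.1 < e.2 ∧ G.Adj e.1 e.2),
        (x e.1 * y e.2 + y e.1 * x e.2) := by
    have h1 : ∑ i, nbr G y i * x i =
        ∑ e ∈ (Finset.univ : Finset (Fin n × Fin n)).filter (fun e => G.Adj e.1 e.2),
          x e.1 * y e.2 := by
      rw [Finset.sum_filter, Fintype.sum_prod_type]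
      refine Finset.sum_congr rfl fun i _ => ?_
      simp only [nbr, Matrix.mulVec, dotProduct, SimpleGraph.adjMatrix_apply, Finset.sum_mul]
      refine Finset.sum_congr rfl fun j _ => ?_
      split_ifs <;> ring
    rw [h1, Finset.sum_add_distrib]
    have h2 : ∑ e ∈ (Finset.univ : Finset (Fin n × Fin n)).filter
        (fun e => e.1 < e.2 ∧ G.Adj e.1 e.2), y e.1 * x e.2 =
        ∑ e ∈ (Finset.univ : Finset (Fin n × Fin n)).filter
        (fun e => e.2 < e.1 ∧ G.Adj e.1 e.2), x e.1 * y e.2 := by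
      refine Finset.sum_nbij' (fun e => (e.2, e.1)) (fun e => (e.2, e.1)) ?_ ?_ ?_ ?_ ?_
      · intro e he; simp only [Finset.mem_filter, Finset.mem_univ, true_and] at he ⊢
        exact ⟨he.1, he.2.symm⟩
      · intro e he; simp only [Finset.mem_filter, Finset.mem_univ, true_and] at he ⊢
        exact ⟨he.1, he.2.symm⟩
      · intro e _; rfl
      · intro e _; rfl
      · intro e _; ring
    rw [h2, ← Finset.sum_union]
    · refine Finset.sum_congr ?_ fun _ _ => rfl
      ext e
      simp only [Finset.mem_filter, Finset.mem_univ, true_and, Finset.mem_union]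
      constructor
      · intro h
        rcases lt_or_gt_of_ne h.ne with hlt | hlt
        · exact .inl ⟨hlt, h⟩
        · exact .inr ⟨hlt, h⟩
      · rintro (h | h) <;> exact h.2
    · rw [Finset.disjoint_left]
      intro e he he'
      simp only [Finset.mem_filter, Finset.mem_univ, true_and] at he he'
      exact lt_asymm he.1 he'.1
  rw [hcross]
  simp only [quad, ← Finset.sum_add_distrib, Pi.add_apply]
  exact Finset.sum_congr rfl fun e _ => by ring

/-- The bits of the graph qubits in a basis state. -/
def graphBits (s : graphQubits n → ZMod 2) (i : Fin n) : ZMod 2 :=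
  s ⟨Sum.inl i, by simp [graphQubits]⟩

lemma graphBits_injective : Function.Injective (graphBits (n := n)) := by
  intro s t h
  funext q
  obtain ⟨q, hq⟩ := q
  obtain ⟨i, -, rfl⟩ := Finset.mem_map.1 hq
  exact congrFun h i

/-- The matrix of `createGraph`. -/
def graphMat : Matrix (graphQubits n → ZMod 2) (graphQubits n → ZMod 2) ℂ :=
      Matrix.diagonal (fun s => sign (quad G (graphBits s))) *
        Matrix.of (fun s t => ((Real.sqrt 2 : ℂ)⁻¹) ^ n *
          sign (∑ i, graphBits s i * graphBits t i))

lemma createGraph_eq : createGraph G = ⟨graphQubits n, graphMat G⟩ := by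
  simp only [createGraph, graphMat, ite_and_eq_sign, quad, sign_sum, Finset.prod_mul_distrib,
    Finset.prod_const, Finset.card_univ, Fintype.card_fin]
  rfl

lemma sqrt_two_inv_mul_self : ((Real.sqrt 2 : ℂ)⁻¹) * (Real.sqrt 2 : ℂ)⁻¹ = 2⁻¹ := by
  rw [← mul_inv, ← Complex.ofReal_mul, Real.mul_self_sqrt (by norm_num)]
  norm_num

/-- Orthogonality of the characters of Z_2^n: the sum factors over the coordinates, and a coordinate
in which `t` and `t'` differ contributes 1 - 1 = 0. -/
lemma sum_sign_mul (t t' : Fin n → ZMod 2) :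
    ∑ s : Fin n → ZMod 2, sign (∑ i, s i * t i) * sign (∑ i, s i * t' i) =
      if t = t' then 2 ^ n else 0 := by
  have h : ∀ s : Fin n → ZMod 2, sign (∑ i, s i * t i) * sign (∑ i, s i * t' i) =
      ∏ i, sign (s i * (t i + t' i)) := by
    intro s
    rw [← sign_add, ← Finset.sum_add_distrib, sign_sum]
    exact Finset.prod_congr rfl fun i _ => by rw [mul_add]
  simp only [h]
  rw [← Fintype.piFinset_univ, ← Finset.prod_univ_sum (fun _ => Finset.univ)
    (fun i x => sign (x * (t i + t' i)))]
  have hi : ∀ i, ∑ x : ZMod 2, sign (x * (t i + t' i)) = if t i = t' i then 2 else 0 := by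
    intro i
    have hz : ∀ z : ZMod 2, z = 0 ∨ z = 1 := by decide
    have huniv : (Finset.univ : Finset (ZMod 2)) = {0, 1} := by decide
    rw [huniv, Finset.sum_pair (by decide)]
    rcases hz (t i) with h1 | h1 <;> rcases hz (t' i) with h2 | h2 <;> rw [h1, h2] <;>
      simp [sign, show (1 : ZMod 2) + 1 = 0 from by decide] <;> norm_num
  simp only [hi]
  by_cases htt : t = t'
  · subst htt; simp
  · rw [if_neg htt]
    obtain ⟨i, hi⟩ := Function.ne_iff.1 htt
    exact Finset.prod_eq_zero (Finset.mem_univ i) (if_neg hi)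

/-- Basis states of the graph qubits, as vectors. -/
def graphBitsEquiv (n : ℕ) : (graphQubits n → ZMod 2) ≃ (Fin n → ZMod 2) :=
  Equiv.ofBijective graphBits ⟨graphBits_injective, fun x =>
    ⟨fun q => Sum.elim x 0 q.1, by funext i; rfl⟩⟩

/-- The diagonal signs square to one, and what is left is the Hadamard transform, whose columns are
orthonormal by orthogonality of characters. -/
lemma graphMat_isometry : (graphMat G)ᴴ * graphMat G = 1 := by
  rw [graphMat, Matrix.conjTranspose_mul, Matrix.mul_assoc, ← Matrix.mul_assoc _ _ (of _),
    Matrix.diagonal_conjTranspose, Matrix.diagonal_mul_diagonal]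
  have h1 : (fun s : graphQubits n → ZMod 2 => star (fun s => sign (quad G (graphBits s))) s *
      sign (quad G (graphBits s))) = fun _ => 1 := by
    funext s
    rw [Pi.star_apply, star_sign, ← sign_add, zmod_two_add_self, sign_zero]
  rw [h1, Matrix.diagonal_one, Matrix.one_mul]
  ext t t'
  rw [Matrix.mul_apply, Matrix.one_apply]
  simp only [Matrix.conjTranspose_apply, Matrix.of_apply, star_mul', star_sign]
  have h2 : star (((Real.sqrt 2 : ℂ)⁻¹) ^ n) = ((Real.sqrt 2 : ℂ)⁻¹) ^ n := by
    rw [star_pow, star_inv₀]; simp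
  rw [h2]
  have h3 : ∀ s : graphQubits n → ZMod 2,
      ((Real.sqrt 2 : ℂ)⁻¹) ^ n * sign (∑ i, graphBits s i * graphBits t i) *
        (((Real.sqrt 2 : ℂ)⁻¹) ^ n * sign (∑ i, graphBits s i * graphBits t' i)) =
      (2⁻¹) ^ n * (sign (∑ i, graphBits s i * graphBits t i) *
        sign (∑ i, graphBits s i * graphBits t' i)) := by
    intro s
    rw [← sqrt_two_inv_mul_self, mul_pow]; ring
  simp only [h3]
  rw [← Finset.mul_sum]
  have h4 := (graphBitsEquiv n).sum_comp fun s : Fin n → ZMod 2 =>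
    sign (∑ i, s i * graphBits t i) * sign (∑ i, s i * graphBits t' i)
  rw [sum_sign_mul] at h4
  erw [h4]
  by_cases htt : t = t'
  · subst htt
    simp
  · rw [if_neg htt, if_neg fun h => htt (graphBits_injective h), mul_zero]

/-- The operator that creates the graph state, on the register. -/
def createOn (W : Finset (Name n)) : Matrix (W → ZMod 2) (W → ZMod 2) ℂ := (createGraph G).embed W

lemma ActsOn.createOn {W : Finset (Name n)} (hW : graphQubits n ⊆ W) :
    ActsOn W (graphQubits n) (createOn G W) := by
  rw [GraphVerif.createOn, createGraph_eq]
  exact ActsOn.embed hW (graphMat_isometry G)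

/-- The graph state has amplitudes proportional to (-1)^{q(s)} with q the quadratic form `quad`. The
operator X^x Z^{Gx} replaces s by s + x and adds the sign (-1)^{⟨Gx, s + x⟩}, and by polarization
the terms that depend on s and x jointly cancel. -/
lemma conj_stab_univ_create {W : Finset (Name n)} (hW : graphQubits n ⊆ W) (x : Fin n → ZMod 2) :
    conj (stab G W Finset.univ x) (conj (createOn G W) (Matrix.single 0 0 1)) =
      conj (createOn G W) (Matrix.single 0 0 1) := by
  rw [conj_conj]
  -- Applied to the projector on the all-zero basis state, conjugation only sees the column at 0,
  -- and that only up to a phase.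
  have key : ∀ A B : Matrix (W → ZMod 2) (W → ZMod 2) ℂ, (∃ c : ℂ, c * star c = 1 ∧
      ∀ s, A s 0 = c * B s 0) → conj A (Matrix.single 0 0 1) = conj B (Matrix.single 0 0 1) := by
    rintro A B ⟨c, hc, h⟩
    have hs : (Matrix.single 0 0 1 : Matrix (W → ZMod 2) (W → ZMod 2) ℂ) =
      Matrix.vecMulVec (Pi.single 0 1) (Pi.single 0 1) := by
      ext s t
      by_cases h1 : s = 0 <;> by_cases h2 : t = 0 <;>
        simp [Matrix.vecMulVec_apply, h1, h2, eq_comm (a := (0 : W → ZMod 2))]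
    have hconj : ∀ A : Matrix (W → ZMod 2) (W → ZMod 2) ℂ, ∀ s t,
        conj A (Matrix.single 0 0 1) s t = A s 0 * star (A t 0) := by
      intro A s t
      simp [conj, Matrix.mul_apply, Matrix.single_apply, ite_and, Finset.sum_ite_eq]
    ext s t
    rw [hconj, hconj, h s, h t, star_mul']
    linear_combination (B s 0 * star (B t 0)) * hc
  apply key
  -- The eigenvalue: q(s + x) + ⟨Gx, s + x⟩ = q(s) + q(x) + ⟨Gx, x⟩, since ⟨Gx, s⟩ occurs twice. The
  -- single contributing intermediate state is s + x.
  refine ⟨sign (quad G x + ∑ i, nbr G x i * x i), sign_mul_star _, fun s => ?_⟩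
  rw [Matrix.mul_apply, Finset.sum_eq_single (fun q : W => s q + onNames Finset.univ x q)]
  · have hc : ∀ s : W → ZMod 2, createOn G W s 0 = if ∀ q : W, q.1 ∉ graphQubits n → s q = 0 then
        sign (quad G fun i => s ⟨Sum.inl i, hW (by simp [graphQubits])⟩) *
          ((Real.sqrt 2 : ℂ)⁻¹) ^ n else 0 := by
      intro s
      have hbits : graphBits (restrictTo W (graphQubits n) s) =
          fun i => s ⟨Sum.inl i, hW (by simp [graphQubits])⟩ := by
        funext i
        have : (Sum.inl i : Name n) ∈ W := hW (by simp [graphQubits])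
        simp [graphBits, restrictTo, this]
      have hbits0 : ∀ i, graphBits (restrictTo W (graphQubits n) 0) i = 0 := by
        intro i; simp [graphBits, restrictTo]
      rw [createOn, createGraph_eq, embed_apply]
      simp only
      rw [graphMat, Matrix.diagonal_mul]
      change (if ∀ q : W, q.1 ∉ graphQubits n → s q = 0 then
        sign (quad G (graphBits (restrictTo W (graphQubits n) s))) *
          (((Real.sqrt 2 : ℂ)⁻¹) ^ n * sign (∑ i, graphBits (restrictTo W (graphQubits n) s) i *
            graphBits (restrictTo W (graphQubits n) 0) i)) else 0) = _
      simp only [hbits, hbits0, mul_zero, Finset.sum_const_zero, sign_zero, mul_one]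
    rw [hc, hc]
    have hcond : (∀ q : W, q.1 ∉ graphQubits n → s q + onNames Finset.univ x q = 0) ↔
        ∀ q : W, q.1 ∉ graphQubits n → s q = 0 := by
      refine forall₂_congr fun q hq => ?_
      rw [onNames_eq_zero hq, add_zero]
    simp only [hcond]
    split_ifs with h
    · have hx : (fun i => s ⟨Sum.inl i, hW (by simp [graphQubits])⟩ +
          onNames Finset.univ x (Sum.inl i)) =
          (fun i => s ⟨Sum.inl i, hW (by simp [graphQubits])⟩) + x := by
        funext i; simp [onNames]
      simp only [hx, quad_add]
      rw [stab, pauliOn, if_pos]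
      · have hsum : ∑ q : W, onNames Finset.univ (nbr G x) q * (s q + onNames Finset.univ x q) =
            ∑ i, nbr G x i * (s ⟨Sum.inl i, hW (by simp [graphQubits])⟩ + x i) := by
          symm
          apply Fintype.sum_of_injective
            (fun i : Fin n => (⟨Sum.inl i, hW (by simp [graphQubits])⟩ : W))
          · intro i j hij
            simpa using hij
          · rintro ⟨q, hq⟩ hq'
            rcases q with i | k
            · exact absurd ⟨i, rfl⟩ hq'
            · simp [onNames]
          · intro i; simp [onNames]
        rw [hsum, ← mul_assoc, ← mul_assoc, ← sign_add, ← sign_add]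
        congr 2
        simp only [mul_add, Finset.sum_add_distrib]
        linear_combination zmod_two_add_self
          (∑ i, nbr G x i * s ⟨Sum.inl i, hW (by simp [graphQubits])⟩)
      · intro q
        rw [add_assoc, zmod_two_add_self, add_zero]
    · simp
  · intro u _ hu
    rw [stab, pauliOn, if_neg, zero_mul]
    intro h
    apply hu
    funext q
    rw [h q, add_assoc, zmod_two_add_self, add_zero]
  · simp

/-- On the graph state, a stabilizer restricted to a set of parties acts like its restriction to the
complement. -/
lemma conj_stab_compl_create {W : Finset (Name n)} (hW : graphQubits n ⊆ W) (A : Finset (Fin n))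
    (x : Fin n → ZMod 2) :
    conj (stab G W Aᶜ x) (conj (createOn G W) (Matrix.single 0 0 1)) =
      conj (stab G W A x) (conj (createOn G W) (Matrix.single 0 0 1)) := by
  -- The full stabilizer is inserted for free. Modulo two its exponents cancel those on `Aᶜ` and
  -- leave exactly those on `A`.
  conv_lhs => rw [← conj_stab_univ_create G hW x]
  have h : ∀ z : Fin n → ZMod 2, onNames Aᶜ z + onNames Finset.univ z = onNames A z := by
    intro z
    rw [← Finset.union_compl A, onNames_union disjoint_compl_right, add_comm, add_assoc,
      add_self_fun, add_zero]
  rw [stab, stab, conj_pauliOn_conj, h, h, stab]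

end Graph

end

end GraphVerif

/-! ### Steps and message rounds of the real system. -/

namespace GraphVerif

noncomputable section

open Matrix
open scoped ComplexOrder

/-- The left component is deterministic here, so the branches are those of the right one. In the
real system only the coin flip ever branches. -/
lemma System.par_step {n : ℕ} {κ₁ κ₂ : Type} {R : Resource n κ₁} {s : R.State}
    {inp₁ : Batch n (Party n) κ₁} {r : List (Gate n) × R.State × Batch n (Party n) κ₁}
    (h : R.step s inp₁ = [r]) (S : Resource n κ₂) (t : S.State)
    (inp : Batch n (Party n) (κ₁ ⊕ κ₂)) (hinp : inp₁ = fun i k => inp i (.inl k)) :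
    (R.par S).step (s, t) inp = (S.step t fun i k => inp i (.inr k)).map fun b =>
      (r.1 ++ b.1, (r.2.1, b.2.1), fun i k => Sum.elim (r.2.2 i) (b.2.2 i) k) := by
  subst hinp
  simp only [System.par, Branches.andThen, h, List.flatMap_cons, List.flatMap_nil, List.append_nil,
    List.map_flatMap, List.map_cons, List.map_nil]
  rw [List.map_eq_flatMap]

lemma System.attach_step {n : ℕ} {κ κ' : Type} (R : Resource n κ)
    {C : Converter n (Party n) κ κ'} {s : R.State} {t : C.State} {a b : Batch n (Party n) κ}
    {inp : Batch n (Party n) κ'}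
    {c : List (Gate n) × C.State × Batch n (Party n) κ × Batch n (Party n) κ'}
    (h : C.step t (b, inp) = [c]) :
    (R.attach C).step (s, t, a, b) inp = (R.step s a).map fun r =>
      (r.1 ++ c.1, (r.2.1, c.2.1, c.2.2.1, r.2.2), c.2.2.2) := by
  simp only [System.attach, Branches.andThen, h, List.flatMap_cons, List.flatMap_nil,
    List.append_nil, List.map_cons, List.map_nil]
  rw [List.map_eq_flatMap]

/-! ### The real system -/

section Real

variable {n : ℕ} (G : SimpleGraph (Fin n)) [DecidableRel G.Adj] (f : CorrTest n)
  (H : Finset (Party n))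

/-- The batch without messages on the ports `κ`. -/
abbrev none' (n : ℕ) (κ : Type) : Batch n (Party n) κ := Batch.empty n (Party n) κ

/-- The messages on the main port. -/
def mainOf (a : Batch n (Party n) RealPort) : Batch n (Party n) Unit := fun i k => a i (.inl (.inl k))

/-- The messages on the channel port. -/
def chanOf (a : Batch n (Party n) RealPort) : Batch n (Party n) Unit := fun i k => a i (.inl (.inr k))

/-- The messages on the port of the coin flip. -/
def coinOf (a : Batch n (Party n) RealPort) : Batch n (Party n) Unit := fun i k => a i (.inr k)

/-- The batch with the given messages on the three ports. -/
def pack (o ch p : Batch n (Party n) Unit) : Batch n (Party n) RealPort :=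
  fun i k => Sum.elim (Sum.elim (o i) (ch i)) (p i) k

open Classical in
/-- The reaction of the resource with corrections. -/
def vRun (v : VState n) (b : Batch n (Party n) Unit) :
    List (Gate n) × VState n × Batch n (Party n) Unit :=
  if (v.record b).ready then (v.record b).advance G f else ([], v.record b, none' n Unit)

lemma verifCorrCore_step (v : VState n) (b : Batch n (Party n) Unit) :
    (verifCorrCore G f).step v b = [vRun G f v b] := by
  simp only [verifCorrCore, vRun]
  split_ifs <;> rfl

open Classical in
/-- The next phase of the coin flip, after the string has been sampled. -/
def cAdvance (c : CoinState n) : CoinState n × Batch n (Party n) Unit :=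
  match c.phase with
  | .waitParties =>
    if c.A = ∅ then
      ({ c with phase := .done }, sendTo Finset.univ fun _ => .bits c.x)
    else
      ({ c with phase := .waitConfirm }, sendTo c.A fun _ => .bits c.x)
  | .waitConfirm =>
    if ∃ i ∈ c.A, c.c' i = some false then
      ({ c with phase := .done }, sendTo Finset.univ fun _ => .bot)
    else
      ({ c with phase := .done }, sendTo Finset.univ fun _ => .bits c.x)
  | _ => (c, none' n Unit)

open Classical in
/-- The reaction of the coin flip after the string has been sampled. -/
def cRun (c : CoinState n) (b : Batch n (Party n) Unit) : CoinState n × Batch n (Party n) Unit :=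
  if (c.record b).ready then cAdvance (c.record b) else (c.record b, none' n Unit)

/-- All the randomness lies in the first step; afterwards the string is part of the classical state,
and the coin flip can be treated as a function. -/
lemma advance_eq_cAdvance {c : CoinState n} (hc : c.phase ≠ .create) :
    c.advance = [([], cAdvance c)] := by
  obtain ⟨ph, x, cc, cc'⟩ := c
  cases ph
  · exact absurd rfl hc
  all_goals
    simp only [cAdvance, CoinState.advance]
    try split_ifs
    all_goals rfl

lemma coinFlip_step (c : CoinState n) (hc : c.phase ≠ .create) (b : Batch n (Party n) Unit) :
    (coinFlip n).step c b = [([], cRun c b)] := by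
  have hc' : (c.record b).phase ≠ .create := hc
  simp only [coinFlip, cRun, advance_eq_cAdvance hc']
  split_ifs <;> rfl

lemma cAdvance_phase {c : CoinState n} (hc : c.phase ≠ .create) :
    (cAdvance c).1.phase ≠ .create := by
  obtain ⟨ph, x, cc, cc'⟩ := c
  cases ph
  · exact absurd rfl hc
  all_goals
    simp only [cAdvance]
    try split_ifs
    all_goals simp

lemma cRun_phase {c : CoinState n} (hc : c.phase ≠ .create) (b : Batch n (Party n) Unit) :
    (cRun c b).1.phase ≠ .create := by
  have hc' : (c.record b).phase ≠ .create := hc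
  rw [cRun]
  split_ifs
  · exact cAdvance_phase hc'
  · exact hc'

/-- The reaction of the channel. -/
def chanRun (b : Batch n (Party n) Unit) : Batch n (Party n) Unit :=
  fun j _ => (parties n).flatMap fun i => (b i ()).filterMap fun m =>
    match m with
    | .chan k w qs => if k = j then some (.chan i w qs) else none
    | _ => none

lemma channel_step (b : Batch n (Party n) Unit) :
    (channel n).step () b = [([], ((), chanRun b))] := rfl

lemma firstOf_nil {α : Type} (parse : Msg n → Option α) (old : Option α) :
    firstOf parse old [] = old := by
  cases old <;> rfl

lemma VState.record_empty (v : VState n) : v.record (none' n Unit) = v := by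
  obtain ⟨ph, s, c, r⟩ := v
  simp [VState.record, Batch.empty, firstOf_nil]

lemma CoinState.record_empty (c : CoinState n) : c.record (none' n Unit) = c := by
  obtain ⟨ph, x, c, r⟩ := c
  simp [CoinState.record, Batch.empty, firstOf_nil]

lemma vRun_idle {v : VState n} (hv : ¬ v.ready) : vRun G f v (none' n Unit) = ([], v, none' n Unit) := by
  rw [vRun, VState.record_empty, if_neg hv]

lemma cRun_idle {c : CoinState n} (hc : ¬ c.ready) : cRun c (none' n Unit) = (c, none' n Unit) := by
  rw [cRun, CoinState.record_empty, if_neg hc]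

lemma chanRun_empty : chanRun (none' n Unit) = none' n Unit := by
  funext i k
  simp [chanRun, Batch.empty]

lemma pack_empty : pack (none' n Unit) (none' n Unit) (none' n Unit) = none' n RealPort := by
  funext i k
  rcases k with (k | k) | k <;> rfl

/-- The states of the filters after they have been started. -/
def started : ∀ p, (filterReal n p).State
  | none => decide ((none : Party n) ∈ H)
  | some i => decide ((some i : Party n) ∈ H)

/-- The states of the protocol at all interfaces, from those at the parties. -/
def tauSt (θ : Fin n → TauState n) : ∀ p, (tau G p).State
  | none => ()
  | some i => θ i

/-- The messages of the filters to the resource. -/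
def filtIn (b : Batch n (Party n) RealPort) : Batch n (Party n) RealPort := fun p k =>
  if p ∈ H then
    match p, k with
    | some _, .inl (.inl _) => b p (.inl (.inl ()))
    | some _, .inr _ => (b p (.inr ())).filterMap fun m =>
        match m with
        | .ask => some .top
        | _ => none
    | _, _ => []
  else b p k

/-- The messages of the filters to the outside. -/
def filtOut (b : Batch n (Party n) RealPort) : Batch n (Party n) RealPort := fun p k =>
  if p ∈ H then
    match p, k with
    | some _, .inl (.inl _) => b p k
    | some _, .inr _ => b p k
    | _, _ => []
  else b p k

/-- The step of the protocol at party `i`. -/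
def tauStep (θ : Fin n → TauState n) (b : Batch n (Party n) RealPort) (i : Fin n) :
    TauState n × List (Gate n) × (RealPort → List (Msg n)) × (RealPort → List (Msg n)) :=
  (tauParty G i).step (θ i) (b (some i)) fun _ => []

/-- The states of the protocol after a step. -/
def tauNext (θ : Fin n → TauState n) (b : Batch n (Party n) RealPort) (i : Fin n) : TauState n :=
  if some i ∈ H then (tauStep G θ b i).1 else θ i

/-- The operators applied by the protocol. -/
def tauGates (θ : Fin n → TauState n) (b : Batch n (Party n) RealPort) : List (Gate n) :=
  ((parties n).filter (· ∈ H)).flatMap fun p =>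
    match p with
    | none => []
    | some i => (tauStep G θ b i).2.1

/-- The messages of the protocol to the filters. -/
def tauIn (θ : Fin n → TauState n) (b inp : Batch n (Party n) RealPort) :
    Batch n (Party n) RealPort := fun p k =>
  if p ∈ H then
    match p with
    | none => inp none k
    | some i => (tauStep G θ b i).2.2.1 k
  else inp p k

/-- The messages of the protocol to the outside. -/
def tauOut (θ : Fin n → TauState n) (b : Batch n (Party n) RealPort) :
    Batch n (Party n) RealPort := fun p k =>
  if p ∈ H then
    match p with
    | none => b none k
    | some i => (tauStep G θ b i).2.2.2 k
  else b p k

/-- The real system. -/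
abbrev realSystem : Resource n RealPort :=
  (((verifCorr G f).par (coinFlip n)).attach
    (joint H (filterReal n) (forward n _ RealPort))).attach (joint H (tau G) (forward n _ RealPort))

/-- The state of the real system, after the filters have been started. -/
def realState (v : VState n) (c : CoinState n) (θ : Fin n → TauState n)
    (a b a' b' : Batch n (Party n) RealPort) : (realSystem G f H).State :=
  ((((v, ()), c), (started H, ()), a, b), (tauSt G θ, ()), a', b')

lemma par_step {v : VState n} {c : CoinState n} (hc : c.phase ≠ .create)
    (a : Batch n (Party n) RealPort) :
    ((verifCorr G f).par (coinFlip n)).step ((v, ()), c) a =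
      [((vRun G f v (mainOf a)).1, (((vRun G f v (mainOf a)).2.1, ()), (cRun c (coinOf a)).1),
        pack (vRun G f v (mainOf a)).2.2 (chanRun (chanOf a)) (cRun c (coinOf a)).2)] := by
  have h1 := coinFlip_step c hc (coinOf a)
  have h2 := System.par_step (verifCorrCore_step G f v (mainOf a)) (channel n) ()
    (fun i k => a i (.inl k)) rfl
  rw [channel_step] at h2
  have h3 := System.par_step h2 (coinFlip n) c a rfl
  refine (h3.trans (congrArg (List.map _) h1)).trans ?_
  change [(((vRun G f v (mainOf a)).1 ++ []) ++ [], _, _)] = _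
  rw [List.append_nil, List.append_nil]
  rfl

lemma joint_filter_step (fromIn fromOut : Batch n (Party n) RealPort) :
    (joint H (filterReal n) (forward n _ RealPort)).step (started H, ()) (fromIn, fromOut) =
      [([], ((started H, ()), filtIn H fromOut, filtOut H fromIn))] := by
  simp only [joint, forward, List.map_cons, List.map_nil]
  refine congrArg (fun x => [x]) (Prod.ext ?_ (Prod.ext (Prod.ext ?_ rfl) (Prod.ext ?_ ?_)))
  · simp only [List.append_nil, List.flatMap_eq_nil_iff]
    rintro (_ | i) _ <;> rfl
  · funext p
    by_cases hp : p ∈ H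
    · rcases p with _ | i <;> simp [hp, started, filterReal]
    · simp [hp]
  · funext p k
    by_cases hp : p ∈ H
    · rcases p with _ | i <;> rcases k with (k | k) | k <;> simp [hp, started, filterReal, filtIn, onMain] <;>
        rfl
    · simp [hp, filtIn]
  · funext p k
    by_cases hp : p ∈ H
    · rcases p with _ | i <;> rcases k with (k | k) | k <;> simp [hp, started, filterReal, filtOut]
    · simp [hp, filtOut]

lemma joint_tau_step (θ : Fin n → TauState n) (fromIn fromOut : Batch n (Party n) RealPort) :
    (joint H (tau G) (forward n _ RealPort)).step (tauSt G θ, ()) (fromIn, fromOut) =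
      [(tauGates G H θ fromIn, ((tauSt G (tauNext G H θ fromIn), ()), tauIn G H θ fromIn fromOut,
        tauOut G H θ fromIn))] := by
  simp only [joint, forward, List.map_cons, List.map_nil]
  refine congrArg (fun x => [x]) (Prod.ext ?_ (Prod.ext (Prod.ext ?_ rfl) (Prod.ext ?_ ?_)))
  · simp only [List.append_nil, tauGates]
    congr 1
    funext p
    rcases p with _ | i <;> rfl
  · funext p
    by_cases hp : p ∈ H
    · rcases p with _ | i
      · simp [hp]; rfl
      · simp only [hp, if_true, tauSt, tauNext]; rfl
    · rcases p with _ | i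
      · exact if_neg hp
      · exact (if_neg hp).trans (if_neg hp).symm
  · funext p k
    by_cases hp : p ∈ H
    · rcases p with _ | i <;> simp only [hp, dif_pos, tauIn, if_true] <;> rfl
    · simp [hp, tauIn]
  · funext p k
    by_cases hp : p ∈ H
    · rcases p with _ | i <;> simp only [hp, dif_pos, tauOut, if_true] <;> rfl
    · simp [hp, tauOut]

/-- Every message moves by one hop per step. The batches `a` and `b` are under way between resources
and filters, towards the resources and away from them; `a'` and `b'` are their counterparts between
filters and protocol. -/
lemma realSystem_step {v : VState n} {c : CoinState n} (hc : c.phase ≠ .create)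
    (θ : Fin n → TauState n) (a b a' b' inp : Batch n (Party n) RealPort) :
    (realSystem G f H).step (realState G f H v c θ a b a' b') inp =
      [((vRun G f v (mainOf a)).1 ++ tauGates G H θ b',
        realState G f H (vRun G f v (mainOf a)).2.1 (cRun c (coinOf a)).1 (tauNext G H θ b')
          (filtIn H a')
          (pack (vRun G f v (mainOf a)).2.2 (chanRun (chanOf a)) (cRun c (coinOf a)).2)
          (tauIn G H θ b' inp) (filtOut H b),
        tauOut G H θ b')] := by
  have h1 := par_step G f (v := v) hc a
  have h2 := joint_filter_step H b a'
  have h3 := joint_tau_step G H θ b' inp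
  have h4 := System.attach_step ((verifCorr G f).par (coinFlip n)) (s := ((v, ()), c)) (a := a) h2
  rw [h1] at h4
  have h5 := System.attach_step (((verifCorr G f).par (coinFlip n)).attach
    (joint H (filterReal n) (forward n _ RealPort)))
    (s := (((v, ()), c), (started H, ()), a, b)) (a := a') h3
  rw [h4] at h5
  refine h5.trans ?_
  change [(((vRun G f v (mainOf a)).1 ++ []) ++ tauGates G H θ b', _, _)] = _
  rw [List.append_nil]
  rfl

lemma filtIn_empty : filtIn H (none' n RealPort) = none' n RealPort := by
  funext p k
  rcases p with _ | i <;> rcases k with (k | k) | k <;> simp [filtIn, Batch.empty]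

lemma filtOut_empty : filtOut H (none' n RealPort) = none' n RealPort := by
  funext p k
  rcases p with _ | i <;> rcases k with (k | k) | k <;> simp [filtOut, Batch.empty]

lemma tauStep_idle {θ : Fin n → TauState n} {b : Batch n (Party n) RealPort} {i : Fin n}
    (hb : ∀ k, b (some i) k = []) :
    tauStep G θ b i = (θ i, [], fun _ => [], fun _ => []) := by
  unfold tauStep tauParty
  cases h : θ i <;> simp [hb]

lemma tauStep_empty (θ : Fin n → TauState n) (i : Fin n) :
    tauStep G θ (none' n RealPort) i = (θ i, [], fun _ => [], fun _ => []) :=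
  tauStep_idle G fun _ => rfl

lemma tauNext_empty (θ : Fin n → TauState n) : tauNext G H θ (none' n RealPort) = θ := by
  funext i
  simp [tauNext, tauStep_empty]

lemma tauGates_empty (θ : Fin n → TauState n) : tauGates G H θ (none' n RealPort) = [] := by
  simp only [tauGates, List.flatMap_eq_nil_iff]
  rintro (_ | i) _
  · rfl
  · simp [tauStep_empty]

lemma tauOut_empty (θ : Fin n → TauState n) :
    tauOut G H θ (none' n RealPort) = none' n RealPort := by
  funext p k
  rcases p with _ | i <;> simp [tauOut, tauStep_empty, Batch.empty]

lemma tauIn_empty (θ : Fin n → TauState n) :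
    tauIn G H θ (none' n RealPort) (none' n RealPort) = none' n RealPort := by
  funext p k
  rcases p with _ | i <;> simp [tauIn, tauStep_empty, Batch.empty]

lemma mainOf_empty : mainOf (none' n RealPort) = none' n Unit := rfl

lemma chanOf_empty : chanOf (none' n RealPort) = none' n Unit := rfl

lemma coinOf_empty : coinOf (none' n RealPort) = none' n Unit := rfl

lemma realState_active {v : VState n} {c : CoinState n} {θ : Fin n → TauState n}
    {a b a' b' : Batch n (Party n) RealPort} :
    (realSystem G f H).active (realState G f H v c θ a b a' b') ↔
      v.ready ∨ c.ready ∨ a ≠ none' n RealPort ∨ b ≠ none' n RealPort ∨ a' ≠ none' n RealPort ∨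
        b' ≠ none' n RealPort := by
  have h1 : ¬ ∃ p ∈ H, (filterReal n p).active (started H p) := by
    rintro ⟨(_ | i), hp, h⟩ <;> simp [filterReal, started, hp] at h
  have h2 : ¬ ∃ p ∈ H, (tau G p).active (tauSt G θ p) := by
    rintro ⟨(_ | i), hp, h⟩ <;> exact h
  change (((((verifCorrCore G f).active v ∨ False) ∨ (coinFlip n).active c) ∨
    ((∃ p ∈ H, (filterReal n p).active (started H p)) ∨ False) ∨ _ ∨ _) ∨
    ((∃ p ∈ H, (tau G p).active (tauSt G θ p)) ∨ False) ∨ _ ∨ _) ↔ _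
  rw [or_false, or_false, or_false, iff_false_intro h1, iff_false_intro h2]
  simp only [false_or]
  change (((v.ready ∨ c.ready) ∨ a ≠ none' n RealPort ∨ b ≠ none' n RealPort) ∨
    a' ≠ none' n RealPort ∨ b' ≠ none' n RealPort) ↔ _
  tauto

lemma realSystem_runs_step (m : ℕ) {v : VState n} {c : CoinState n} (hc : c.phase ≠ .create)
    (θ : Fin n → TauState n) (a b a' b' : Batch n (Party n) RealPort) :
    Runs m (realSystem G f H) (realState G f H v c θ a b a' b')
      ((vRun G f v (mainOf a)).1 ++ tauGates G H θ b') (tauOut G H θ b')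
      (realState G f H (vRun G f v (mainOf a)).2.1 (cRun c (coinOf a)).1 (tauNext G H θ b')
          (filtIn H a')
          (pack (vRun G f v (mainOf a)).2.2 (chanRun (chanOf a)) (cRun c (coinOf a)).2)
          (tauIn G H θ b' (none' n RealPort)) (filtOut H b)) := by
  rw [← List.append_nil (_ ++ _), ← Batch.append_empty (tauOut G H θ b')]
  refine Runs.cons (realSystem_step G f H hc θ a b a' b' (none' n RealPort)) ?_ (.refl _)
  · intro hna
    rw [realState_active] at hna
    simp only [not_or, not_not] at hna
    obtain ⟨hv, hcr, rfl, rfl, rfl, rfl⟩ := hna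
    rw [mainOf_empty, coinOf_empty, chanOf_empty, vRun_idle G f hv, cRun_idle hcr, chanRun_empty,
      pack_empty, filtIn_empty, filtOut_empty, tauNext_empty, tauIn_empty, tauGates_empty,
      tauOut_empty]
    exact ⟨rfl, rfl, fun ρ => rfl⟩

/-- A round trip of messages between the resources and the protocol. -/
lemma realSystem_runs_round (m : ℕ) {v v₁ : VState n} {c c₁ : CoinState n}
    (hc : c.phase ≠ .create) (θ : Fin n → TauState n) (a : Batch n (Party n) RealPort)
    {g : List (Gate n)} {o p : Batch n (Party n) Unit}
    (hv : vRun G f v (mainOf a) = (g, v₁, o)) (hcr : cRun c (coinOf a) = (c₁, p))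
    (hv₁ : ¬ v₁.ready) (hc₁ : ¬ c₁.ready) {b : Batch n (Party n) RealPort}
    (hb : filtOut H (pack o (chanRun (chanOf a)) p) = b) :
    Runs m (realSystem G f H)
      (realState G f H v c θ a (none' n _) (none' n _) (none' n _))
      (g ++ tauGates G H θ b) (tauOut G H θ b)
      (realState G f H v₁ c₁ (tauNext G H θ b) (filtIn H (tauIn G H θ b (none' n _)))
        (none' n _) (none' n _) (none' n _)) := by
  have hcp : c₁.phase ≠ .create := by have := cRun_phase hc (coinOf a); rwa [hcr] at this
  -- Four hops: the resources react, the filters pass the messages outwards, the protocol reacts,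
  -- the filters pass its answers inwards. Meanwhile the resources stay idle, as they are not ready.
  have e1 := realSystem_runs_step G f H m hc (v := v) θ a (none' n _) (none' n _) (none' n _)
  rw [hv, hcr] at e1
  simp only [tauGates_empty, tauNext_empty, tauOut_empty, tauIn_empty, filtIn_empty,
    filtOut_empty] at e1
  have e2 := realSystem_runs_step G f H m hcp (v := v₁) θ (none' n _)
    (pack o (chanRun (chanOf a)) p) (none' n _) (none' n _)
  simp only [tauGates_empty, tauNext_empty, tauOut_empty, tauIn_empty, filtIn_empty, mainOf_empty,
    coinOf_empty, chanOf_empty, vRun_idle G f hv₁, cRun_idle hc₁, chanRun_empty, pack_empty, hb]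
    at e2
  have e3 := realSystem_runs_step G f H m hcp (v := v₁) θ (none' n _) (none' n _) (none' n _) b
  simp only [filtIn_empty, filtOut_empty, mainOf_empty,
    coinOf_empty, chanOf_empty, vRun_idle G f hv₁, cRun_idle hc₁, chanRun_empty, pack_empty]
    at e3
  have e4 := realSystem_runs_step G f H m hcp (v := v₁) (tauNext G H θ b) (none' n _) (none' n _)
    (tauIn G H θ b (none' n _)) (none' n _)
  simp only [tauGates_empty, tauNext_empty, tauOut_empty, tauIn_empty, filtOut_empty, mainOf_empty,
    coinOf_empty, chanOf_empty, vRun_idle G f hv₁, cRun_idle hc₁, chanRun_empty, pack_empty]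
    at e4
  simpa [Batch.empty_append, Batch.append_empty] using ((e1.trans e2).trans e3).trans e4

/-- The messages at the dishonest interfaces. -/
def dishonestPart (b : Batch n (Party n) RealPort) : Batch n (Party n) RealPort :=
  fun p k => if p ∈ H then [] else b p k

/-- The injection of messages of the distinguisher. -/
lemma realSystem_reacts_inject (m : ℕ) {v : VState n} {c : CoinState n} (hc : c.phase ≠ .create)
    (hv : ¬ v.ready) (hcr : ¬ c.ready) (θ : Fin n → TauState n)
    (inp : Batch n (Party n) RealPort) :
    Reacts m (realSystem G f H)
      (realState G f H v c θ (none' n _) (none' n _) (none' n _) (none' n _)) inp [] (none' n _)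
      (realState G f H v c θ (dishonestPart H inp) (none' n _) (none' n _) (none' n _)) := by
  have e1 := realSystem_step G f H hc (v := v) θ (none' n _) (none' n _) (none' n _) (none' n _) inp
  simp only [filtIn_empty, filtOut_empty, mainOf_empty, tauGates_empty, tauNext_empty,
    tauOut_empty, List.append_nil,
    coinOf_empty, chanOf_empty, vRun_idle G f hv, cRun_idle hcr, chanRun_empty, pack_empty] at e1
  have e2 := realSystem_runs_step G f H m hc (v := v) θ (none' n _) (none' n _)
    (tauIn G H θ (none' n _) inp) (none' n _)
  -- At honest interfaces nothing gets through: the protocol of a party ignores what comes from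
  -- outside, and the filter of the source blocks it.
  have hd : filtIn H (tauIn G H θ (none' n _) inp) = dishonestPart H inp := by
    funext p k
    by_cases hp : p ∈ H
    · rcases p with _ | i <;> rcases k with (k | k) | k <;>
        simp [filtIn, dishonestPart, tauIn, hp, tauStep_empty]
    · simp [filtIn, dishonestPart, tauIn, hp]
  simp only [filtOut_empty, mainOf_empty, tauGates_empty, tauNext_empty, tauIn_empty,
    tauOut_empty, List.append_nil, hd,
    coinOf_empty, chanOf_empty, vRun_idle G f hv, cRun_idle hcr, chanRun_empty, pack_empty] at e2
  exact ⟨_, _, _, _, _, e1, e2, by simp, by rw [Batch.append_empty]⟩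

/-! ### The start of the real system -/

/-- The messages that the filters send at the start. -/
def hello : Batch n (Party n) RealPort := fun p =>
  if p ∈ H then
    match p with
    | none => onMain [.top]
    | some _ => onMain [.zero]
  else fun _ => []

/-- The initial state of the resource with corrections. -/
def vInit (n : ℕ) : VState n := ⟨.waitSource, none, fun _ => none, fun _ => none⟩

/-- The state of the coin flip after the string `x` has been sampled. -/
def cInit (x : Fin n → ZMod 2) : CoinState n := ⟨.waitParties, x, fun _ => none, fun _ => none⟩

/-- The operator of the choice of a string of `n` bits. -/
def sampleGate (n : ℕ) : Gate n := ⟨∅, (Real.sqrt ((2 : ℝ) ^ n) : ℂ)⁻¹ • 1⟩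

lemma vInit_not_ready : ¬ (vInit n).ready := by simp [vInit, VState.ready]

lemma joint_filter_step_init :
    (joint H (filterReal n) (forward n _ RealPort)).step
      (joint H (filterReal n) (forward n _ RealPort)).init (none' n _, none' n _) =
      [([], ((started H, ()), hello H, none' n _))] := by
  simp only [joint, forward, List.map_cons, List.map_nil]
  refine congrArg (fun x => [x]) (Prod.ext ?_ (Prod.ext (Prod.ext ?_ rfl) (Prod.ext ?_ ?_)))
  · simp only [List.append_nil, List.flatMap_eq_nil_iff]
    rintro (_ | i) _ <;> rfl
  · funext p
    by_cases hp : p ∈ H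
    · rcases p with _ | i <;> simp [hp, started, filterReal]
    · rcases p with _ | i <;> simp [hp, started, filterReal]
  · funext p k
    by_cases hp : p ∈ H
    · rcases p with _ | i <;> rcases k with (k | k) | k <;>
        simp [hp, filterReal, hello, onMain, Batch.empty]
    · simp [hp, hello, Batch.empty]
  · funext p k
    by_cases hp : p ∈ H
    · rcases p with _ | i <;> rcases k with (k | k) | k <;> simp [hp, filterReal, Batch.empty]
    · simp [hp, Batch.empty]

/-- The one branching step of the real system. The string is drawn in the same step in which the
filters send their announcements, before anything else has happened, so an execution is a sum over
strings from here on. -/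
lemma realSystem_step_init :
    (realSystem G f H).step (realSystem G f H).init (none' n _) =
      (Finset.univ : Finset (Fin n → ZMod 2)).toList.map fun x =>
        ([sampleGate n], realState G f H (vInit n) (cInit x) (fun _ => .waitQubit) (hello H)
          (none' n _) (none' n _) (none' n _), none' n _) := by
  have h0 : (realSystem G f H).init =
      (((((vInit n, ()), (coinFlip n).init),
        (joint H (filterReal n) (forward n _ RealPort)).init, none' n _, none' n _)),
        (tauSt G (fun _ => .waitQubit), ()), none' n _, none' n _) := by
    refine Prod.ext rfl (Prod.ext (Prod.ext ?_ rfl) rfl)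
    funext p
    rcases p with _ | i <;> rfl
  rw [h0]
  have h1 := vRun_idle G f (vInit_not_ready (n := n))
  have h2 := joint_filter_step_init H
  have h3 := joint_tau_step G H (fun _ => .waitQubit) (none' n _) (none' n _)
  simp only [tauGates_empty, tauOut_empty, tauIn_empty, tauNext_empty] at h3
  have h4 : (coinFlip n).step (coinFlip n).init (none' n _) =
      (Finset.univ : Finset (Fin n → ZMod 2)).toList.map fun x =>
        ([sampleGate n], cInit x, none' n _) := by
    have hr : ((⟨.create, 0, fun _ => none, fun _ => none⟩ : CoinState n).record (none' n Unit)) =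
      ⟨.create, 0, fun _ => none, fun _ => none⟩ := CoinState.record_empty _
    have hready : CoinState.ready (n := n) ⟨.create, 0, fun _ => none, fun _ => none⟩ := trivial
    rw [← hr] at hready
    simp only [coinFlip]
    rw [if_pos hready, hr]
    rfl
  have h5 := verifCorrCore_step G f (vInit n) (none' n _)
  rw [h1] at h5
  have h6 := System.par_step h5 (channel n) () (none' n _) rfl
  have h7 := System.par_step (h6.trans (by rw [show (fun i k => none' n (Unit ⊕ Unit) i (.inr k)) =
    none' n Unit from rfl, channel_step, chanRun_empty]; rfl)) (coinFlip n) (coinFlip n).init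
    (none' n RealPort) rfl
  rw [show (fun i k => none' n RealPort i (.inr k)) = none' n Unit from rfl, h4] at h7
  have h8 := System.attach_step ((verifCorr G f).par (coinFlip n))
    (s := ((vInit n, ()), (coinFlip n).init)) (a := none' n _) h2
  have h9 := System.attach_step (((verifCorr G f).par (coinFlip n)).attach
    (joint H (filterReal n) (forward n _ RealPort)))
    (s := (((vInit n, ()), (coinFlip n).init),
      (joint H (filterReal n) (forward n _ RealPort)).init, none' n _, none' n _))
    (a := none' n _) h3
  refine h9.trans ?_
  rw [h8]
  erw [h7]
  erw [List.map_map, List.map_map, List.map_map]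
  refine List.map_congr_left fun x _ => ?_
  change ([sampleGate n] ++ [] ++ [], _, _) = _
  rw [List.append_nil, List.append_nil]
  refine Prod.ext rfl (Prod.ext (Prod.ext (Prod.ext rfl (Prod.ext rfl (Prod.ext rfl ?_))) rfl) rfl)
  exact pack_empty

end Real

end

end GraphVerif

/-! ### The simulator, its physicality, and steps of the ideal system. -/

namespace GraphVerif

noncomputable section

open Matrix
open scoped ComplexOrder

/-! ### Physical converters -/

section Guard

variable {n : ℕ} {I κ κ' : Type} [Fintype I] [Fintype κ] [Fintype κ']

/-- An instrument on the qubits in `E`, together with what a converter does for each outcome. -/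
abbrev Move (n : ℕ) (I κ κ' S : Type) :=
  Σ E : Finset (Name n), List (Matrix (E → ZMod 2) (E → ZMod 2) ℂ × S × Batch n I κ × Batch n I κ')

/-- The qubits that are sent. -/
def sent (b : Batch n I κ × Batch n I κ') : Finset (Name n) := (b.1.names + b.2.names).toFinset

/-- A converter that holds the qubits `avail` can make the move. -/
structure Move.Feasible {S : Type} (avail : Finset (Name n)) (r : Move n I κ κ' S) : Prop where
  subset : r.1 ⊆ avail
  complete : (r.2.map fun b => b.1.conjTranspose * b.1).sum = 1
  nodup : ∀ b ∈ r.2, (b.2.2.1.names + b.2.2.2.names).Nodup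
  sent_subset : ∀ b ∈ r.2, sent b.2.2 ⊆ avail

/-- The qubits at hand after new messages have arrived. -/
def avail (held : Finset (Name n)) (inp : Batch n I κ × Batch n I κ') : Finset (Name n) :=
  held ∪ inp.1.names.toFinset ∪ inp.2.names.toFinset

open Classical in
/-- The converter that makes the given moves, as long as they are feasible, and keeps track of the
qubits that it holds. -/
def guarded {S : Type} (init : S) (move : S → Batch n I κ × Batch n I κ' → Move n I κ κ' S)
    (active : S → Prop) : Converter n I κ κ' where
  State := S × Finset (Name n)
  init := (init, ∅)
  step s inp :=
    if (move s.1 inp).Feasible (avail s.2 inp) then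
      (move s.1 inp).2.map fun b =>
        ([⟨(move s.1 inp).1, b.1⟩], ((b.2.1, avail s.2 inp \ sent b.2.2), b.2.2))
    else [([⟨∅, 1⟩], ((s.1, avail s.2 inp), (Batch.empty n I κ, Batch.empty n I κ')))]
  active s := active s.1

/-- Physicality is demanded in all states, reachable or not. Since the guard replaces infeasible
moves by the identity, it holds by construction, and feasibility need only be checked for the moves
that occur in executions. -/
lemma guarded_isPhysical {S : Type} (init : S)
    (move : S → Batch n I κ × Batch n I κ' → Move n I κ κ' S) (active : S → Prop) :
    (guarded init move active).IsPhysical := by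
  refine ⟨Prod.snd, rfl, fun s inp _ => ⟨avail s.2 inp, rfl, ?_⟩⟩
  by_cases h : (move s.1 inp).Feasible (avail s.2 inp)
  · refine ⟨(move s.1 inp).1, h.subset, (move s.1 inp).2.map fun b =>
      (b.1, ((b.2.1, avail s.2 inp \ sent b.2.2), b.2.2)), ?_, ?_, ?_⟩
    · simp only [guarded, if_pos h, List.map_map]
      rfl
    · rw [List.map_map]
      exact h.complete
    · intro b hb
      obtain ⟨b', hb', rfl⟩ := List.mem_map.1 hb
      exact ⟨h.nodup b' hb', h.sent_subset b' hb', subset_rfl⟩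
  · refine ⟨∅, Finset.empty_subset _, [(1, ((s.1, avail s.2 inp),
      (Batch.empty n I κ, Batch.empty n I κ')))], ?_, ?_, ?_⟩
    · simp only [guarded, if_neg h]
      rfl
    · simp
    · intro b hb
      rw [List.mem_singleton] at hb
      subst hb
      simp [Batch.names_empty]

lemma guarded_step {S : Type} {init : S}
    {move : S → Batch n I κ × Batch n I κ' → Move n I κ κ' S} {active : S → Prop} {s : S}
    {held : Finset (Name n)} {inp : Batch n I κ × Batch n I κ'} {r : Move n I κ κ' S}
    (hr : move s inp = r) (h : r.Feasible (avail held inp)) :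
    (guarded init move active).step (s, held) inp = r.2.map fun b =>
      ([⟨r.1, b.1⟩], ((b.2.1, avail held inp \ sent b.2.2), b.2.2)) := by
  subst hr
  exact if_pos h

end Guard

/-! ### The simulator -/

section Simulator

variable {n : ℕ} (G : SimpleGraph (Fin n)) [DecidableRel G.Adj] (f : CorrTest n)
  (H : Finset (Party n))

/-- The honest parties. -/
def honest : Finset (Fin n) := Finset.univ.filter fun i => some i ∈ H

/-- The dishonest parties. -/
def dishonest : Finset (Fin n) := (honest H)ᶜ

lemma mem_honest {i : Fin n} : i ∈ honest H ↔ some i ∈ H := by simp [honest]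

lemma mem_dishonest {i : Fin n} : i ∈ dishonest H ↔ some i ∉ H := by simp [dishonest, honest]

/-- The part of a batch at the dishonest interfaces. -/
def restr {κ : Type} (b : Batch n (Party n) κ) : Batch n {i // i ∉ H} κ := fun i => b i

/-- A batch at the dishonest interfaces, without messages at the other ones. -/
def extend {κ : Type} (b : Batch n {i // i ∉ H} κ) : Batch n (Party n) κ :=
  fun p k => if h : p ∈ H then [] else b ⟨p, h⟩ k

/-- The reaction of the resource with corrections, including the one after the creation of the graph
state: new state and messages. -/
def mainRun (v : VState n) (b : Batch n (Party n) Unit) : VState n × Batch n (Party n) Unit :=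
  ((vRun G f (vRun G f v b).2.1 (none' n Unit)).2.1,
    (vRun G f v b).2.2.append (vRun G f (vRun G f v b).2.1 (none' n Unit)).2.2)

/-- The honest parties get their qubits. -/
def Granted (o : Batch n (Party n) Unit) : Prop :=
  ∃ i ∈ honest H, Msg.qubit (Sum.inl i) ∈ o (some i) ()

/-- Up to a sign, the operator `X^a Z^{Ga}` restricted to the parties outside `M` equals
`X^x Z^z`. -/
def IsShift (M : Finset (Fin n)) (x z a : Fin n → ZMod 2) : Prop :=
  ∀ i ∉ M, a i = x i ∧ nbr G a i = z i

open Classical in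
/-- The shift of the string of the coin flip that makes up for the corrections. -/
def shift (v v' : VState n) : Fin n → ZMod 2 :=
  -- Without honest parties the string may have been disclosed long before the corrections arrive,
  -- and there is no qubit out of the reach of the simulator. The shift then has to vanish, and it
  -- can.
  if h : (v.phase = .waitCorrections ∧ (honest H).Nonempty) ∧ ∃ a, IsShift G v'.M v'.x v'.z a then
    h.2.choose else 0

/-- What the simulator does with the messages of the dishonest interfaces. -/
structure Control (n : ℕ) where
  v : VState n
  c : CoinState n
  main : Batch n (Party n) Unit
  coin : Batch n (Party n) Unit
  flag : Option Bool
  gate : Gate n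

open Classical in
/-- The coin flip, as run by the simulator. -/
def coinRun (c : CoinState n) (b : Batch n (Party n) Unit) (granted : Prop)
    (a : Fin n → ZMod 2) : CoinState n × Batch n (Party n) Unit :=
  -- Honest parties ask for the coin as soon as they have their qubits. This is the last moment at
  -- which the string can be shifted, since their `⊤` may make the coin flip disclose it.
  if granted then
    ((cRun { (cRun c b).1 with x := (cRun c b).1.x + a } (sendTo (honest H) fun _ => .top)).1,
      (cRun c b).2.append
        (cRun { (cRun c b).1 with x := (cRun c b).1.x + a } (sendTo (honest H) fun _ => .top)).2)
  else cRun c b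

open Classical in
/-- What the simulator tells the resource, depending on the messages `o` of the resource with
corrections and `p` of the coin flip to the honest parties. -/
def flagOf (o p : Batch n (Party n) Unit) : Option Bool :=
  if ∃ i ∈ honest H, Msg.bot ∈ o (some i) () ∨ Msg.bot ∈ p (some i) () then some false
  else if ∃ i ∈ honest H, ∃ x, Msg.bits x ∈ p (some i) () then some true
  else none

open Classical in
/-- The operator that the simulator applies to the qubits that it holds. -/
def fixGate (v v' : VState n) : Gate n :=
  if v.phase = .waitCorrections ∧ v'.phase = .done ∧ f v'.M (fun i => v'.x i) (fun i => v'.z i) then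
    pauli (names (dishonest H \ v'.M)) (Sum.elim v'.x 0) (Sum.elim v'.z 0)
  else ⟨∅, 1⟩

/-- The reaction of the simulator to messages of the dishonest interfaces. -/
def control (v : VState n) (c : CoinState n) (a : Batch n (Party n) RealPort) : Control n where
  v := (mainRun G f v (mainOf a)).1
  c := (coinRun H c (coinOf a) (Granted H (mainRun G f v (mainOf a)).2)
    (shift G H v (mainRun G f v (mainOf a)).1)).1
  main := (mainRun G f v (mainOf a)).2
  coin := (coinRun H c (coinOf a) (Granted H (mainRun G f v (mainOf a)).2)
    (shift G H v (mainRun G f v (mainOf a)).1)).2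
  flag := flagOf H (mainRun G f v (mainOf a)).2 (coinRun H c (coinOf a)
    (Granted H (mainRun G f v (mainOf a)).2) (shift G H v (mainRun G f v (mainOf a)).1)).2
  gate := fixGate f H v (mainRun G f v (mainOf a)).1

/-- The stages of the simulator. -/
inductive Stage where
  | start
  | wait
  | sample
  | run

/-- The states of the simulator. -/
structure SimState (n : ℕ) where
  stage : Stage
  v : VState n
  c : CoinState n

/-- The messages `⊤` and `⊥` of the simulator to the resource. -/
def flagBatch (n : ℕ) (I : Type) : Option Bool → Batch n I (Unit ⊕ Unit)
  | some true => fun _ k => Sum.elim (fun _ => [.top]) (fun _ => []) k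
  | some false => fun _ k => Sum.elim (fun _ => [.bot]) (fun _ => []) k
  | none => fun _ _ => []

/-- The resource with corrections, after it has received the messages of the honest interfaces. -/
def vStart : VState n := (vRun G f (vInit n) (mainOf (hello H))).2.1

/-- The coin flip with the string `y`, after the start. -/
def cStart (y : Fin n → ZMod 2) : CoinState n := (cRun (cInit y) (none' n Unit)).1

open Classical in
/-- The moves of the simulator. -/
def simMove (s : SimState n) (inp : Batch n {i // i ∉ H} (Unit ⊕ Unit) × Batch n {i // i ∉ H} RealPort) :
    Move n {i // i ∉ H} (Unit ⊕ Unit) RealPort (SimState n) :=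
  match s.stage with
  | .start => ⟨∅, [(1, { s with stage := .wait }, flagBatch n _ (some false), Batch.empty n _ _)]⟩
  -- A request reaches the resource one step after it has been sent, and the qubits arrive another
  -- step later.
  | .wait => ⟨∅, [(1, { s with stage := .sample }, Batch.empty n _ _, Batch.empty n _ _)]⟩
  -- The operator acts on the dishonest qubits, which the simulator holds at this stage; on the
  -- graph state it is equivalent to the operator of the honest parties for the string `y`.
  | .sample => ⟨names (dishonest H), (Finset.univ : Finset (Fin n → ZMod 2)).toList.map fun y =>
      ((Real.sqrt ((2 : ℝ) ^ n) : ℂ)⁻¹ •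
        (pauli (names (dishonest H)) (Sum.elim y 0) (Sum.elim (nbr G y) 0)).mat,
        ⟨.run, vStart G f H, cStart y⟩, Batch.empty n _ _, Batch.empty n _ _)⟩
  | .run =>
    if inp.2 = Batch.empty n _ _ then
      ⟨∅, [(1, s, Batch.empty n _ _, Batch.empty n _ _)]⟩
    else
      ⟨(control G f H s.v s.c (extend H inp.2)).gate.supp,
        [((control G f H s.v s.c (extend H inp.2)).gate.mat,
          ⟨.run, (control G f H s.v s.c (extend H inp.2)).v,
            (control G f H s.v s.c (extend H inp.2)).c⟩,
          flagBatch n _ (control G f H s.v s.c (extend H inp.2)).flag,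
          restr H (pack (control G f H s.v s.c (extend H inp.2)).main
            (chanRun (chanOf (extend H inp.2)))
            (control G f H s.v s.c (extend H inp.2)).coin))]⟩

/-- The simulator. -/
def simulator : Converter n {i // i ∉ H} (Unit ⊕ Unit) RealPort :=
  guarded ⟨.start, vInit n, cInit 0⟩ (simMove G f H) fun s => s.stage ≠ .run

/-! ### The ideal system -/

/-- The ideal system. -/
abbrev idealSystem : Resource n RealPort :=
  (verif G).attach (joint H (filterIdeal n) (simulator G f H))

open Classical in
/-- The reaction of the resource without corrections. -/
def wRun (w : WState n) (b : Batch n (Party n) Unit) :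
    List (Gate n) × WState n × Batch n (Party n) Unit :=
  if (w.record b).ready then (w.record b).advance G else ([], w.record b, none' n Unit)

lemma verifCore_step (w : WState n) (b : Batch n (Party n) Unit) :
    (verifCore G).step w b = [wRun G w b] := by
  simp only [verifCore, wRun]
  split_ifs <;> rfl

lemma WState.record_empty (w : WState n) : w.record (none' n Unit) = w := by
  obtain ⟨ph, c, r⟩ := w
  simp [WState.record, Batch.empty, firstOf_nil]

lemma wRun_idle {w : WState n} (hw : ¬ w.ready) : wRun G w (none' n Unit) = ([], w, none' n Unit) := by
  rw [wRun, WState.record_empty, if_neg hw]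

/-- The batch with the given messages on the main port and on the channel. -/
def packW (o ch : Batch n (Party n) Unit) : Batch n (Party n) (Unit ⊕ Unit) :=
  fun i k => Sum.elim (o i) (ch i) k

lemma packW_empty : packW (none' n Unit) (none' n Unit) = none' n (Unit ⊕ Unit) := by
  funext i k
  rcases k with k | k <;> rfl

lemma verif_step (w : WState n) (a : Batch n (Party n) (Unit ⊕ Unit)) :
    (verif G).step (w, ()) a =
      [((wRun G w fun i k => a i (.inl k)).1, ((wRun G w fun i k => a i (.inl k)).2.1, ()),
        packW (wRun G w fun i k => a i (.inl k)).2.2 (chanRun fun i k => a i (.inr k)))] := by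
  have h1 := System.par_step (verifCore_step G w fun i k => a i (.inl k)) (channel n) () a rfl
  rw [channel_step] at h1
  refine h1.trans ?_
  change [((_ ++ [] : List (Gate n)), _, _)] = _
  rw [List.append_nil]
  rfl

/-- The states of the filters after they have been started. -/
def startedIdeal : ∀ p, (filterIdeal n p).State := fun p => decide (p ∈ H)

/-- The messages of the filters and the simulator to the outside. -/
def glueOut (b : Batch n (Party n) (Unit ⊕ Unit)) (t : Batch n {i // i ∉ H} RealPort) :
    Batch n (Party n) RealPort := fun p k =>
  if h : p ∈ H then onMain (if p = none then [] else b p (.inl ())) k else t ⟨p, h⟩ k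

lemma joint_ideal_step (s : SimState n × Finset (Name n))
    (b : Batch n (Party n) (Unit ⊕ Unit)) (inp : Batch n (Party n) RealPort) :
    (joint H (filterIdeal n) (simulator G f H)).step (startedIdeal H, s) (b, inp) =
      ((simulator G f H).step s (restr H b, restr H inp)).map fun r =>
        (r.1, ((startedIdeal H, r.2.1), extend H r.2.2.1, glueOut H b r.2.2.2)) := by
  simp only [joint]
  refine List.map_congr_left fun r _ => ?_
  refine Prod.ext ?_ (Prod.ext (Prod.ext ?_ rfl) (Prod.ext ?_ ?_))
  · have : ((parties n).filter (· ∈ H)).flatMap (fun i =>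
        ((filterIdeal n i).step (startedIdeal H i) (b i) (inp i)).2.1) = [] := by
      rw [List.flatMap_eq_nil_iff]
      intro p _
      rfl
    change _ ++ r.1 = r.1
    rw [this, List.nil_append]
  · funext p
    by_cases hp : p ∈ H
    · refine (if_pos hp).trans ?_
      simp [startedIdeal, filterIdeal, hp]
    · exact if_neg hp
  · funext p k
    by_cases hp : p ∈ H
    · rcases k with k | k <;> simp [hp, startedIdeal, filterIdeal, extend]
    · simp [hp, extend]
  · funext p k
    by_cases hp : p ∈ H
    · simp [hp, startedIdeal, filterIdeal, glueOut]
    · simp [hp, glueOut]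

/-- The counterpart of `System.attach_step` for a deterministic resource and a branching converter:
in the ideal system it is the simulator that draws the string. -/
lemma System.attach_step' {κ κ' : Type} {R : Resource n κ}
    (C : Converter n (Party n) κ κ') {s : R.State} (t : C.State) {a : Batch n (Party n) κ}
    (b : Batch n (Party n) κ) (inp : Batch n (Party n) κ')
    {r : List (Gate n) × R.State × Batch n (Party n) κ} (h : R.step s a = [r]) :
    (R.attach C).step (s, t, a, b) inp = (C.step t (b, inp)).map fun c =>
      (r.1 ++ c.1, (r.2.1, c.2.1, c.2.2.1, r.2.2), c.2.2.2) := by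
  simp only [System.attach, Branches.andThen, h, List.flatMap_cons, List.flatMap_nil,
    List.append_nil, List.map_flatMap, List.map_cons, List.map_nil]
  rw [List.map_eq_flatMap]

/-- The state of the ideal system, after the filters have been started. -/
def idealState (w : WState n) (s : SimState n) (held : Finset (Name n))
    (a b : Batch n (Party n) (Unit ⊕ Unit)) : (idealSystem G f H).State :=
  ((w, ()), (startedIdeal H, (s, held)), a, b)

lemma idealSystem_step (w : WState n) (s : SimState n) (held : Finset (Name n))
    (a b : Batch n (Party n) (Unit ⊕ Unit)) (inp : Batch n (Party n) RealPort)
    {r : Move n {i // i ∉ H} (Unit ⊕ Unit) RealPort (SimState n)}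
    (hr : simMove G f H s (restr H b, restr H inp) = r)
    (hfeas : r.Feasible (avail held (restr H b, restr H inp))) :
    (idealSystem G f H).step (idealState G f H w s held a b) inp =
      r.2.map fun t => ((wRun G w fun i k => a i (.inl k)).1 ++ [⟨r.1, t.1⟩],
        idealState G f H (wRun G w fun i k => a i (.inl k)).2.1 t.2.1
          (avail held (restr H b, restr H inp) \ sent t.2.2) (extend H t.2.2.1)
          (packW (wRun G w fun i k => a i (.inl k)).2.2 (chanRun fun i k => a i (.inr k))),
        glueOut H b t.2.2.2) := by
  have h1 := joint_ideal_step G f H (s, held) b inp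
  have h2 : (simulator G f H).step (s, held) (restr H b, restr H inp) = _ :=
    guarded_step hr hfeas
  rw [h2] at h1
  have h3 := System.attach_step' (joint H (filterIdeal n) (simulator G f H))
    (startedIdeal H, (s, held)) b inp (verif_step G w a)
  rw [h1] at h3
  refine h3.trans ?_
  erw [List.map_map, List.map_map]
  rfl

lemma restr_empty {κ : Type} : restr H (none' n κ) = Batch.empty n _ κ := rfl

lemma extend_empty {κ : Type} : extend H (Batch.empty n {i // i ∉ H} κ) = none' n κ := by
  funext p k
  simp [extend, Batch.empty]

lemma glueOut_empty : glueOut H (none' n _) (Batch.empty n _ _) = none' n RealPort := by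
  funext p k
  by_cases hp : p ∈ H
  · rcases k with (k | k) | k <;> simp [glueOut, hp, onMain, Batch.empty]
  · simp [glueOut, hp, Batch.empty]

lemma avail_empty {I κ κ' : Type} [Fintype I] [Fintype κ] [Fintype κ'] (held : Finset (Name n)) :
    avail held (Batch.empty n I κ, Batch.empty n I κ') = held := by
  simp [avail, Batch.names_empty]

lemma sent_empty {I κ κ' : Type} [Fintype I] [Fintype κ] [Fintype κ'] :
    sent (Batch.empty n I κ, Batch.empty n I κ') = ∅ := by
  simp [sent, Batch.names_empty]

lemma simMove_idle {s : SimState n} (hs : s.stage = .run)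
    (b : Batch n {i // i ∉ H} (Unit ⊕ Unit)) :
    simMove G f H s (b, Batch.empty n _ _) =
      ⟨∅, [(1, s, Batch.empty n _ _, Batch.empty n _ _)]⟩ := by
  simp only [simMove, hs, if_true]

lemma feasible_trivial {S I κ κ' : Type} [Fintype I] [Fintype κ] [Fintype κ']
    (av : Finset (Name n)) (s : S) :
    Move.Feasible (n := n) (I := I) (κ := κ) (κ' := κ') av
      ⟨∅, [(1, s, Batch.empty n _ _, Batch.empty n _ _)]⟩ where
  subset := Finset.empty_subset _
  complete := by simp
  nodup b hb := by
    rw [List.mem_singleton] at hb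
    subst hb
    simp [Batch.names_empty]
  sent_subset b hb := by
    rw [List.mem_singleton] at hb
    subst hb
    simp [sent_empty]

lemma idealState_active {w : WState n} {s : SimState n} {held : Finset (Name n)}
    {a b : Batch n (Party n) (Unit ⊕ Unit)} :
    (idealSystem G f H).active (idealState G f H w s held a b) ↔
      w.ready ∨ s.stage ≠ .run ∨ a ≠ none' n _ ∨ b ≠ none' n _ := by
  have h1 : ¬ ∃ p ∈ H, (filterIdeal n p).active (startedIdeal H p) := by
    rintro ⟨p, hp, h⟩
    simp [filterIdeal, startedIdeal, hp] at h
  change ((w.ready ∨ False) ∨ ((∃ p ∈ H, (filterIdeal n p).active (startedIdeal H p)) ∨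
    s.stage ≠ .run) ∨ a ≠ none' n _ ∨ b ≠ none' n _) ↔ _
  rw [or_false, iff_false_intro h1, false_or]

lemma applyGates_one (W : Finset (Name n)) (E : Finset (Name n))
    (ρ : Matrix (W → ZMod 2) (W → ZMod 2) ℂ) : applyGates W [⟨E, 1⟩] ρ = ρ := by
  rw [applyGates_singleton, embed_one, conj_one]

/-- A step of the ideal system in which the simulator only receives messages of the resource. -/
lemma idealSystem_runs_step (m : ℕ) (w : WState n) {s : SimState n} (hs : s.stage = .run)
    (held : Finset (Name n)) (a b : Batch n (Party n) (Unit ⊕ Unit)) :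
    Runs m (idealSystem G f H) (idealState G f H w s held a b)
      ((wRun G w fun i k => a i (.inl k)).1 ++ [⟨∅, 1⟩])
      (glueOut H b (Batch.empty n _ _))
      (idealState G f H (wRun G w fun i k => a i (.inl k)).2.1 s
        (held ∪ (restr H b).names.toFinset) (none' n _)
        (packW (wRun G w fun i k => a i (.inl k)).2.2 (chanRun fun i k => a i (.inr k)))) := by
  have h1 := idealSystem_step G f H w s held a b (none' n _)
    (simMove_idle G f H hs (restr H b)) (feasible_trivial _ _)
  simp only [List.map_cons, List.map_nil, sent_empty, extend_empty, restr_empty,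
    Finset.sdiff_empty] at h1
  have h2 : avail held (restr H b, Batch.empty n {i // i ∉ H} RealPort) =
      held ∪ (restr H b).names.toFinset := by
    simp [avail, Batch.names_empty]
  rw [h2] at h1
  rw [← List.append_nil (_ ++ _), ← Batch.append_empty (glueOut H b (Batch.empty n _ _))]
  refine Runs.cons h1 ?_ (.refl _)
  intro hna
  rw [idealState_active] at hna
  simp only [not_or, not_not] at hna
  obtain ⟨hw, -, rfl, rfl⟩ := hna
  have h3 : wRun G w (fun i k => none' n (Unit ⊕ Unit) i (.inl k)) = ([], w, none' n Unit) :=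
    wRun_idle G hw
  have h4 : chanRun (fun i k => none' n (Unit ⊕ Unit) i (.inr k)) = none' n Unit := chanRun_empty
  rw [h3, h4, packW_empty]
  refine ⟨?_, glueOut_empty H, fun ρ => applyGates_one _ _ ρ⟩
  rw [restr_empty, Batch.names_empty]
  simp

end Simulator

end

end GraphVerif

/-! ### Bookkeeping of qubit names, and reactions of the ideal system. -/

namespace GraphVerif

noncomputable section

open Matrix
open scoped ComplexOrder

/-! ### Qubits in messages -/

section Names

variable {n : ℕ} {I κ : Type} [Fintype I] [Fintype κ]

lemma mem_batch_names {b : Batch n I κ} {q : Name n} :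
    q ∈ b.names ↔ ∃ i k, ∃ m ∈ b i k, q ∈ m.qubits := by
  simp only [Batch.names, Multiset.mem_sum, Finset.mem_univ, true_and]
  refine exists_congr fun i => exists_congr fun k => ?_
  induction b i k with
  | nil => simp
  | cons m l ih => simp [ih]

lemma names_eq_zero {b : Batch n I κ} (h : ∀ i k, ∀ m ∈ b i k, m.qubits = ∅) : b.names = 0 := by
  refine Multiset.eq_zero_of_forall_notMem fun q hq => ?_
  obtain ⟨i, k, m, hm, hq⟩ := mem_batch_names.1 hq
  rw [h i k m hm] at hq
  simp at hq

lemma names_toFinset_subset {b : Batch n I κ} {S : Finset (Name n)}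
    (h : ∀ i k, ∀ m ∈ b i k, m.qubits ⊆ S) : b.names.toFinset ⊆ S := by
  intro q hq
  obtain ⟨i, k, m, hm, hq⟩ := mem_batch_names.1 (Multiset.mem_toFinset.1 hq)
  exact h i k m hm hq

/-- A batch has no repeated qubits if every list has at most one message and different messages
have disjoint qubits. -/
lemma names_nodup {b : Batch n I Unit} (h1 : ∀ i, b i () = [] ∨ ∃ m, b i () = [m])
    (h2 : ∀ i j q, (∃ m ∈ b i (), q ∈ m.qubits) → (∃ m ∈ b j (), q ∈ m.qubits) → i = j) :
    b.names.Nodup := by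
  classical
  rw [Multiset.nodup_iff_count_le_one]
  intro q
  have hone : ∀ i, Multiset.count q (∑ k, ((b i k).map fun m => m.qubits.val).sum) ≤ 1 := by
    intro i
    rw [Fintype.sum_unique]
    change Multiset.count q ((b i ()).map fun m => m.qubits.val).sum ≤ 1
    rcases h1 i with h | ⟨m, h⟩
    · simp [h]
    · rw [h]
      simpa using Multiset.nodup_iff_count_le_one.1 m.qubits.nodup q
  have hpos : ∀ i, Multiset.count q (∑ k, ((b i k).map fun m => m.qubits.val).sum) ≠ 0 →
      ∃ m ∈ b i (), q ∈ m.qubits := by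
    intro i hi
    rw [Fintype.sum_unique] at hi
    change Multiset.count q ((b i ()).map fun m => m.qubits.val).sum ≠ 0 at hi
    rcases h1 i with h | ⟨m, h⟩
    · simp [h] at hi
    · refine ⟨m, by simp [h], ?_⟩
      rw [h] at hi
      simpa [Multiset.count_eq_zero] using hi
  rw [Batch.names, Multiset.count_sum']
  by_cases hex : ∃ i, Multiset.count q (∑ k, ((b i k).map fun m => m.qubits.val).sum) ≠ 0
  · obtain ⟨i, hi⟩ := hex
    rw [Finset.sum_eq_single i]
    · exact hone i
    · intro j _ hj
      by_contra hne
      exact hj (h2 j i q (hpos j hne) (hpos i hi))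
    · simp
  · push Not at hex
    rw [Finset.sum_eq_zero fun i _ => hex i]
    exact Nat.zero_le _

variable (H : Finset (Party n))

lemma names_restr_pack (o ch p : Batch n (Party n) Unit) :
    (restr H (pack o ch p)).names = (restr H o).names + (restr H ch).names + (restr H p).names := by
  simp only [Batch.names, restr, pack, Fintype.sum_sum_type, Sum.elim_inl, Sum.elim_inr,
    Finset.sum_add_distrib]

lemma names_flagBatch (o : Option Bool) : (flagBatch n I o).names = 0 := by
  apply names_eq_zero
  intro i k m hm
  rcases o with _ | (_ | _) <;> rcases k with k | k <;> simp [flagBatch] at hm <;> subst hm <;> rfl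

lemma single_of_notMem {κ : Type} [DecidableEq κ] {p : Party n} (hp : p ∉ H) (k : κ) (m : Msg n) :
    extend H (restr H (single p k m)) = single p k m := by
  funext p' k'
  by_cases hp' : p' ∈ H
  · have : p' ≠ p := fun h => hp (h ▸ hp')
    simp [extend, hp', single, this]
  · simp [extend, hp', restr]

lemma restr_single_ne {κ : Type} [DecidableEq κ] {p : Party n} (hp : p ∉ H) (k : κ) (m : Msg n) :
    restr H (single p k m) ≠ Batch.empty n _ κ := by
  intro h
  have := congrFun (congrFun h ⟨p, hp⟩) k
  simp [restr, single, Batch.empty] at this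

lemma restr_single_of_mem {κ : Type} [DecidableEq κ] {p : Party n} (hp : p ∈ H) (k : κ)
    (m : Msg n) : restr H (single p k m) = Batch.empty n _ κ := by
  funext i k'
  have : i.1 ≠ p := fun h => i.2 (h ▸ hp)
  simp [restr, single, Batch.empty, this]

lemma names_restr_single [DecidableEq κ] {p : Party n} (hp : p ∉ H) (k : κ) (m : Msg n) :
    (restr H (single p k m)).names.toFinset = m.qubits := by
  ext q
  rw [Multiset.mem_toFinset, mem_batch_names]
  constructor
  · rintro ⟨i, k', m', hm', hq⟩
    by_cases h : i.1 = p ∧ k' = k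
    · simp only [restr, single, if_pos h, List.mem_singleton] at hm'
      exact hm' ▸ hq
    · simp [restr, single, h] at hm'
  · intro hq
    exact ⟨⟨p, hp⟩, k, m, by simp [restr, single], hq⟩

end Names

/-! ### The ideal resource -/

section Ideal

variable {n : ℕ} (G : SimpleGraph (Fin n)) [DecidableRel G.Adj] (f : CorrTest n)
  (H : Finset (Party n))

/-- The state of the ideal resource in which it waits for the dishonest interfaces to confirm. -/
def wOpen : WState n := ⟨.waitConfirm, fun p => some (decide (p ∈ H)), fun _ => none⟩

/-- The messages of the dishonest interfaces to the main port of the ideal resource. -/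
def flagMain (o : Option Bool) : Batch n (Party n) Unit := fun p k =>
  extend H (flagBatch n _ o) p (.inl k)

/-- What the ideal resource sends when it is told to go on or to stop. -/
def wReply : Option Bool → Batch n (Party n) Unit
  | some true => sendTo (honest H) fun i => .qubit (.inl i)
  | some false => fun _ _ => [.bot]
  | none => none' n Unit

lemma WState.not_ready_of_done {w : WState n} (h : w.phase = .done) : ¬ w.ready := by
  simp [WState.ready, h]

lemma wRun_done {w : WState n} (h : w.phase = .done) (b : Batch n (Party n) Unit) :
    ∃ w', wRun G w b = ([], w', none' n Unit) ∧ w'.phase = .done := by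
  refine ⟨w.record b, ?_, h⟩
  have : ¬ (w.record b).ready := WState.not_ready_of_done (w := w.record b) h
  rw [wRun, if_neg this]

lemma wOpen_A : (wOpen H).A = Hᶜ := by
  ext p
  simp [wOpen, WState.A]

lemma wOpen_not_ready {p : Party n} (hp : p ∉ H) : ¬ (wOpen H).ready := by
  intro h
  have := h p (by rw [wOpen_A]; simpa using hp)
  simp [wOpen] at this

/-- The simulator speaks at all dishonest interfaces at once, so the resource gets either all
confirmations or none. A dishonest interface is needed: without one, the confirmation phase would be
vacuously complete. -/
lemma wRun_wOpen {p : Party n} (hp : p ∉ H) (o : Option Bool) :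
    ∃ w', wRun G (wOpen H) (flagMain H o) = ([], w', wReply H o) ∧ ¬ w'.ready ∧
      (o = none → w' = wOpen H) ∧ (o ≠ none → w'.phase = .done) := by
  rcases o with _ | o
  · refine ⟨wOpen H, ?_, wOpen_not_ready H hp, fun _ => rfl, fun h => absurd rfl h⟩
    have : flagMain H none = none' n Unit := by
      funext p k
      simp [flagMain, extend, flagBatch, Batch.empty]
    rw [this, wRun_idle G (wOpen_not_ready H hp), wReply]
  · have hrec : (wOpen H).record (flagMain H (some o)) =
        ⟨.waitConfirm, fun p => some (decide (p ∈ H)),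
          fun p => if p ∈ H then none else some o⟩ := by
      simp only [WState.record, wOpen_A, Finset.mem_compl]
      congr 1
      · funext p
        by_cases hp : p ∈ H
        · cases o <;> simp [wOpen, flagMain, extend, flagBatch, hp, firstOf, readFlag]
        · cases o <;> simp [wOpen, flagMain, extend, flagBatch, hp, firstOf, readFlag]
    have hA : WState.A (⟨.waitConfirm, fun p => some (decide (p ∈ H)),
          fun p => if p ∈ H then none else some o⟩ : WState n) = Hᶜ := by
      ext p; simp [WState.A]
    have hready : WState.ready (⟨.waitConfirm, fun p => some (decide (p ∈ H)),
          fun p => if p ∈ H then none else some o⟩ : WState n) := by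
      intro p hp
      rw [hA, Finset.mem_compl] at hp
      simp [hp]
    refine ⟨{ (wOpen H).record (flagMain H (some o)) with phase := .done }, ?_,
      WState.not_ready_of_done rfl, by simp, fun _ => rfl⟩
    rw [wRun, hrec, if_pos hready, WState.advance]
    simp only [hA]
    cases o
    · rw [if_pos ⟨p, by simpa using hp, by simp [hp]⟩]
      rfl
    · rw [if_neg]
      · simp only [wReply]
        congr 3
        ext i
        simp [honest]
      · rintro ⟨q, -, hq⟩
        by_cases hqH : q ∈ H <;> simp [hqH] at hq

lemma wReply_notMem {o : Option Bool} {p : Party n} (hp : p ∉ H) :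
    ∀ m ∈ wReply H o p (), m.qubits = ∅ := by
  intro m hm
  rcases o with _ | (_ | _)
  · simp [wReply, Batch.empty] at hm
  · simp [wReply] at hm; subst hm; rfl
  · rcases p with _ | i
    · simp [wReply, sendTo] at hm
    · have : i ∉ honest H := by rwa [mem_honest]
      simp [wReply, sendTo, this] at hm

/-- The output of an execution, from the messages `w` for the honest parties on the main port and
the messages `t` for the dishonest interfaces. -/
def honestOut (w : Batch n (Party n) Unit) (t : Batch n (Party n) RealPort) :
    Batch n (Party n) RealPort := fun p k =>
  if p ∈ H then onMain (if p = none then [] else w p ()) k else t p k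

lemma honestOut_empty : honestOut H (none' n _) (none' n _) = none' n RealPort := by
  funext p k
  by_cases hp : p ∈ H
  · rcases k with (k | k) | k <;> simp [honestOut, hp, onMain, Batch.empty]
  · simp [honestOut, hp, Batch.empty]

lemma honestOut_append (w w' : Batch n (Party n) Unit) (t t' : Batch n (Party n) RealPort) :
    (honestOut H w t).append (honestOut H w' t') = honestOut H (w.append w') (t.append t') := by
  funext p k
  by_cases hp : p ∈ H
  · rcases k with (k | k) | k <;> rcases p with _ | i <;> simp [honestOut, hp, onMain, Batch.append]
  · simp [honestOut, hp, Batch.append]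

lemma pack_append (o o' ch ch' p p' : Batch n (Party n) Unit) :
    (pack o ch p).append (pack o' ch' p') = pack (o.append o') (ch.append ch') (p.append p') := by
  funext i k
  rcases k with (k | k) | k <;> rfl

/-- Filters ignore messages from outside, and the simulator sees an empty batch, so only a trivial
operator on no qubits is applied. -/
lemma idealSystem_reacts_honest (m : ℕ) {w : WState n} {s : SimState n} {held : Finset (Name n)}
    (hw : ¬ w.ready) (hs : s.stage = .run) {p : Party n} (hp : p ∈ H) (k : RealPort) (msg : Msg n) :
    Reacts m (idealSystem G f H) (idealState G f H w s held (none' n _) (none' n _))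
      (single p k msg) [⟨∅, 1⟩] (none' n _)
      (idealState G f H w s held (none' n _) (none' n _)) := by
  have h1 := idealSystem_step G f H w s held (none' n _) (none' n _) (single p k msg)
    (by rw [restr_single_of_mem H hp]; exact simMove_idle G f H hs _) (feasible_trivial _ _)
  have h3 : wRun G w (fun i k => none' n (Unit ⊕ Unit) i (.inl k)) = ([], w, none' n Unit) :=
    wRun_idle G hw
  have h4 : chanRun (fun i k => none' n (Unit ⊕ Unit) i (.inr k)) = none' n Unit := chanRun_empty
  rw [h3, h4, packW_empty, restr_single_of_mem H hp, restr_empty, avail_empty] at h1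
  simp only [List.map_cons, List.map_nil, sent_empty, extend_empty, Finset.sdiff_empty,
    glueOut_empty] at h1
  exact ⟨_, _, _, _, _, h1, .refl _, rfl, by rw [Batch.append_empty]⟩

/-- The simulator holds and sends what it should. -/
structure ControlOK (av : Finset (Name n)) (k : Control n) (ch : Batch n (Party n) Unit) :
    Prop where
  supp : k.gate.supp ⊆ av
  isometry : k.gate.mat.conjTranspose * k.gate.mat = 1
  nodup : ((restr H k.main).names + (restr H ch).names).Nodup
  subset : ((restr H k.main).names + (restr H ch).names).toFinset ⊆ av
  coin : (restr H k.coin).names = 0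

/-- Three steps: the simulator answers the dishonest interfaces and sends its flag, the resource
reacts to the flag, and the filters deliver that reaction to the honest parties. The distinguisher
is not activated in between and sees the messages of all three steps together. By `hwo` the reply of
the resource brings no qubits to the simulator. -/
lemma idealSystem_reacts_dishonest (m : ℕ) {w w₁ : WState n} {s : SimState n}
    {held : Finset (Name n)} (hw : ¬ w.ready) (hs : s.stage = .run) {p : Party n} (hp : p ∉ H)
    (k : RealPort) (msg : Msg n) {c : Control n}
    (hc : control G f H s.v s.c (single p k msg) = c) {ch : Batch n (Party n) Unit}
    (hch : chanRun (chanOf (single p k msg)) = ch)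
    (hok : ControlOK H (held ∪ msg.qubits) c ch)
    {wo : Batch n (Party n) Unit} (hrun : wRun G w (flagMain H c.flag) = ([], w₁, wo))
    (hw₁ : ¬ w₁.ready) (hwo : ∀ p ∉ H, ∀ m ∈ wo p (), m.qubits = ∅) :
    ∃ gs, Reacts m (idealSystem G f H) (idealState G f H w s held (none' n _) (none' n _))
      (single p k msg) gs (honestOut H wo (pack c.main ch c.coin))
      (idealState G f H w₁ ⟨.run, c.v, c.c⟩
        ((held ∪ msg.qubits) \ ((restr H c.main).names + (restr H ch).names).toFinset)
        (none' n _) (none' n _)) ∧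
      ∀ ρ : Mat n m, applyGates _ gs ρ = applyGates _ [c.gate] ρ := by
  have hnames : (restr H (pack c.main ch c.coin)).names =
      (restr H c.main).names + (restr H ch).names := by
    rw [names_restr_pack, hok.coin, add_zero]
  have hmove : simMove G f H s (restr H (none' n (Unit ⊕ Unit)), restr H (single p k msg)) =
      ⟨c.gate.supp, [(c.gate.mat, ⟨.run, c.v, c.c⟩, flagBatch n _ c.flag,
        restr H (pack c.main ch c.coin))]⟩ := by
    simp only [simMove, hs]
    rw [if_neg (restr_single_ne H hp k msg), single_of_notMem H hp, hc, hch]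
  have hav : avail held (restr H (none' n (Unit ⊕ Unit)), restr H (single p k msg)) =
      held ∪ msg.qubits := by
    rw [avail, restr_empty]
    simp only [Batch.names_empty, names_restr_single H hp]
    simp
  have h1 := idealSystem_step G f H w s held (none' n _) (none' n _) (single p k msg) hmove (by
    rw [hav]
    refine ⟨hok.supp, by simpa using hok.isometry, ?_, ?_⟩
    · intro b hb
      rw [List.mem_singleton] at hb
      subst hb
      simp only [names_flagBatch, zero_add, hnames]
      exact hok.nodup
    · intro b hb
      rw [List.mem_singleton] at hb
      subst hb
      simp only [sent, names_flagBatch, zero_add, hnames]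
      exact hok.subset)
  have h3 : wRun G w (fun i k => none' n (Unit ⊕ Unit) i (.inl k)) = ([], w, none' n Unit) :=
    wRun_idle G hw
  have h4 : chanRun (fun i k => none' n (Unit ⊕ Unit) i (.inr k)) = none' n Unit := chanRun_empty
  rw [h3, h4, packW_empty, hav] at h1
  simp only [List.map_cons, List.map_nil, sent, names_flagBatch, hnames, zero_add] at h1
  have h5 := idealSystem_runs_step G f H m w (s := ⟨.run, c.v, c.c⟩) rfl
    ((held ∪ msg.qubits) \ ((restr H c.main).names + (restr H ch).names).toFinset)
    (extend H (flagBatch n _ c.flag)) (none' n _)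
  have h6 : chanRun (fun i k => extend H (flagBatch n {i // i ∉ H} c.flag) i (.inr k)) =
      none' n Unit := by
    have : (fun i k => extend H (flagBatch n {i // i ∉ H} c.flag) i (.inr k)) = none' n Unit := by
      funext i k
      rcases c.flag with _ | (_ | _) <;> simp [extend, flagBatch, Batch.empty]
    rw [this, chanRun_empty]
  have h7 : wRun G w (fun i k => extend H (flagBatch n {i // i ∉ H} c.flag) i (.inl k)) =
    ([], w₁, wo) := hrun
  rw [h6, h7, restr_empty, Batch.names_empty, glueOut_empty] at h5
  simp only [Multiset.toFinset_zero, Finset.union_empty] at h5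
  have h8 := idealSystem_runs_step G f H m w₁ (s := ⟨.run, c.v, c.c⟩) rfl
    ((held ∪ msg.qubits) \ ((restr H c.main).names + (restr H ch).names).toFinset)
    (none' n _) (packW wo (none' n Unit))
  have h9 : wRun G w₁ (fun i k => none' n (Unit ⊕ Unit) i (.inl k)) = ([], w₁, none' n Unit) :=
    wRun_idle G hw₁
  have h10 : (restr H (packW wo (none' n Unit))).names = 0 := by
    apply names_eq_zero
    intro i k m hm
    rcases k with k | k
    · exact hwo i.1 i.2 m hm
    · simp [restr, packW, Batch.empty] at hm
  rw [h9, h4, packW_empty, h10] at h8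
  simp only [Multiset.toFinset_zero, Finset.union_empty] at h8
  refine ⟨_, ⟨_, _, _, _, _, h1, h5.trans h8, rfl, ?_⟩, fun ρ => ?_⟩
  · rw [Batch.empty_append]
    funext p k
    by_cases hp : p ∈ H
    · rcases p with _ | i <;> rcases k with (k | k) | k <;>
        simp [honestOut, glueOut, Batch.append, hp, onMain, packW, Batch.empty]
    · simp [honestOut, glueOut, Batch.append, hp, Batch.empty, restr]
  · simp only [List.nil_append]
    rw [applyGates_append, applyGates_append, applyGates_one, applyGates_one]

end Ideal

end

end GraphVerif

/-! ### The resource with corrections: invariants and possible outcomes of a message. -/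

namespace GraphVerif

noncomputable section

open Matrix
open scoped ComplexOrder

/-! ### The phases of the resource with corrections -/

section Phases

variable {n : ℕ} (G : SimpleGraph (Fin n)) [DecidableRel G.Adj] (f : CorrTest n)
  (H : Finset (Party n))

/-- The parties whose qubits have not been sent, before the last phase. -/
def VState.left (v : VState n) : Finset (Fin n) :=
  if v.phase = .waitCorrections then v.Mᶜ else Finset.univ

/-- The properties of the states of the resource with corrections that are reached before the last
phase. -/
structure VGood (v : VState n) : Prop where
  zero : ∀ i ∈ honest H, v.c i = some .zero
  corr : v.phase ≠ .waitCorrections → ∀ i, v.corr i = none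
  isSome : v.phase = .waitCorrections → ∀ i, (v.c i).isSome

lemma firstOf_some {α : Type} (parse : Msg n → Option α) (a : α) (l : List (Msg n)) :
    firstOf parse (some a) l = some a := rfl

lemma firstOf_isSome {α : Type} (parse : Msg n → Option α) {o : Option α} (ho : o.isSome)
    (l : List (Msg n)) : firstOf parse o l = o := by
  obtain ⟨a, rfl⟩ := Option.isSome_iff_exists.1 ho
  rfl

variable {H}

lemma VGood.record {v : VState n} (h : VGood H v) (b : Batch n (Party n) Unit) :
    VGood H (v.record b) where
  zero i hi := by simp only [VState.record, h.zero i hi, firstOf_some]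
  corr hp i := by
    have hp' : v.phase ≠ .waitCorrections := hp
    simp [VState.record, hp', h.corr hp' i]
  isSome hp i := by
    have hp' : v.phase = .waitCorrections := hp
    simp only [VState.record, firstOf_isSome _ (h.isSome hp' i)]
    exact h.isSome hp' i

/-- Values once received are never overwritten. In the correction phase all announcements are known,
so the set of parties that announced `1` is frozen. -/
lemma VGood.record_left {v : VState n} (h : VGood H v) (b : Batch n (Party n) Unit) :
    (v.record b).left = v.left := by
  by_cases hp : v.phase = .waitCorrections
  · have : (v.record b).c = v.c := funext fun i => firstOf_isSome _ (h.isSome hp i) _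
    have hM : (v.record b).M = v.M := by simp only [VState.M, this]
    have hp' : (v.record b).phase = .waitCorrections := hp
    simp only [VState.left, if_pos hp, if_pos hp', hM]
  · have hp' : (v.record b).phase ≠ .waitCorrections := hp
    simp only [VState.left, if_neg hp, if_neg hp']

lemma VGood.honest_subset {v : VState n} (h : VGood H v) : honest H ⊆ v.left := by
  intro i hi
  rw [VState.left]
  split_ifs
  · simp [VState.M, h.zero i hi]
  · exact Finset.mem_univ i

lemma sendTo_empty (m : Fin n → Msg n) : sendTo ∅ m = none' n Unit := by
  funext p k
  rcases p with _ | i <;> simp [sendTo, Batch.empty]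

/-- The message that hands over the qubit of a party. -/
abbrev qubitOf (i : Fin n) : Msg n := .qubit (.inl i)

variable (H)

/-- What the resource with corrections does in response to the messages of the dishonest
interfaces, before the last phase: operators applied, new state and messages. -/
inductive Outcome (v : VState n) : List (Gate n) → VState n → Batch n (Party n) Unit → Prop
  | stay (g : List (Gate n)) (v' : VState n) (phase : v'.phase ≠ .done) (good : VGood H v')
      (left : v'.left ⊆ v.left)
      (gates : (v.phase = .waitSource ∧ v'.phase ≠ .waitSource ∧ g = [createGraph G]) ∨
        ((v.phase = .waitSource ↔ v'.phase = .waitSource) ∧ g = [])) :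
      Outcome v g v' (sendTo (v.left \ v'.left) qubitOf)
  | abort (g : List (Gate n)) (v' : VState n) (phase : v'.phase = .done)
      (gates : g = [] ∨ (v.phase = .waitSource ∧ g = [createGraph G]))
      (fix : fixGate f H v v' = ⟨∅, 1⟩) :
      Outcome v g v' (sendTo Finset.univ fun _ => .bot)
  | grant (g : List (Gate n)) (v' : VState n) (phase : v'.phase = .done)
      (gates : (v.phase = .waitSource ∧ g = [createGraph G]) ∨ (v.phase = .waitParties ∧ g = [])) :
      Outcome v g v' (sendTo v.left qubitOf)
  | correct (v' : VState n) (phase : v'.phase = .done) (phase' : v.phase = .waitCorrections)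
      (M : v'.M = v.M) (test : f v'.M (fun i => v'.x i) (fun i => v'.z i)) :
      Outcome v [pauli (names v'.Mᶜ) (Sum.elim v'.x 0) (Sum.elim v'.z 0)] v'
        (sendTo v.left qubitOf)

/-- The operators applied by the resource with corrections. -/
def mainGates (v : VState n) (b : Batch n (Party n) Unit) : List (Gate n) :=
  (vRun G f v b).1 ++ (vRun G f (vRun G f v b).2.1 (none' n Unit)).1

lemma VState.not_ready_of_done {v : VState n} (h : v.phase = .done) : ¬ v.ready := by
  simp [VState.ready, h]

variable {H}

/-- The correction phase is entered with a nonempty set of parties to wait for and with no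
correction recorded yet, so the resource cannot be ready for a further reaction. -/
lemma VGood.advance_waitParties {v : VState n} (h : VGood H v) (hp : v.phase = .waitParties)
    (hr : v.ready) : (v.advance G f).1 = [] ∧ ¬ (v.advance G f).2.1.ready ∧
      (((v.advance G f).2.1.phase = .done ∧
          (v.advance G f).2.2 = sendTo Finset.univ fun _ => .bot) ∨
        ((v.advance G f).2.1.phase = .done ∧ (v.advance G f).2.2 = sendTo Finset.univ qubitOf) ∨
        ((v.advance G f).2.1.phase = .waitCorrections ∧ VGood H (v.advance G f).2.1 ∧
          (v.advance G f).2.2 = sendTo (Finset.univ \ (v.advance G f).2.1.left) qubitOf)) := by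
  have hc : ∀ i, (v.c i).isSome := by simpa [VState.ready, hp] using hr
  simp only [VState.advance, hp]
  split_ifs with h1 h2
  · exact ⟨rfl, VState.not_ready_of_done rfl, .inl ⟨rfl, rfl⟩⟩
  · exact ⟨rfl, VState.not_ready_of_done rfl, .inr (.inl ⟨rfl, rfl⟩)⟩
  · refine ⟨rfl, ?_, .inr (.inr ⟨rfl, ⟨h.zero, fun hn => absurd rfl hn, fun _ => hc⟩, ?_⟩)⟩
    · intro hr'
      obtain ⟨i, hi⟩ := Finset.nonempty_iff_ne_empty.2 h2
      have h3 := hr' i hi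
      simp [h.corr (by simp [hp]) i] at h3
    · have hM : (Finset.univ : Finset (Fin n)) \
          VState.left (⟨.waitCorrections, v.source, v.c, v.corr⟩ : VState n) = v.M := by
        simp only [VState.left, if_true]
        rw [← Finset.compl_eq_univ_sdiff, compl_compl]
        rfl
      rw [hM]

lemma left_of_ne {v : VState n} (h : v.phase ≠ .waitCorrections) : v.left = Finset.univ := if_neg h

lemma fixGate_of_ne {v v' : VState n} (h : v.phase ≠ .waitCorrections) :
    fixGate f H v v' = ⟨∅, 1⟩ := if_neg fun h' => h h'.1

lemma vRun_of_not_ready {v : VState n} {b : Batch n (Party n) Unit} (h : ¬ (v.record b).ready) :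
    vRun G f v b = ([], v.record b, none' n Unit) := if_neg h

lemma vRun_of_ready {v : VState n} {b : Batch n (Party n) Unit} (h : (v.record b).ready) :
    vRun G f v b = (v.record b).advance G f := if_pos h

lemma vRun_none_of_ready {v : VState n} (h : v.ready) :
    vRun G f v (none' n Unit) = v.advance G f := by
  rw [vRun, VState.record_empty, if_pos h]

/-- Case distinction on the phase. The last part says that a second reaction can follow only a
silent first one; hence a message causes at most one delivery, and the honest parties respond to it
once. -/
lemma VGood.outcome {v : VState n} (h : VGood H v) (hnd : v.phase ≠ .done)
    (b : Batch n (Party n) Unit) :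
    Outcome G f H v (mainGates G f v b) (mainRun G f v b).1 (mainRun G f v b).2 ∧
      ¬ (mainRun G f v b).1.ready ∧
      ((vRun G f v b).2.2 = none' n Unit ∨ ¬ (vRun G f v b).2.1.ready) := by
  have hg := h.record b
  have hl := h.record_left b
  by_cases hr : (v.record b).ready
  swap
  · have e1 := vRun_of_not_ready G f hr
    simp only [mainGates, mainRun, e1, vRun_idle G f hr, Batch.empty_append]
    refine ⟨?_, hr, by simp⟩
    have := Outcome.stay (G := G) (f := f) (H := H) (v := v) [] (v.record b) hnd hg hl.le
      (.inr ⟨Iff.rfl, rfl⟩)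
    rwa [hl, Finset.sdiff_self, sendTo_empty] at this
  have e1 := vRun_of_ready G f hr
  have hph : (v.record b).phase = v.phase := rfl
  rcases hp : v.phase with _ | _ | _ | _
  · by_cases hs : (v.record b).source = some true
    · have e2 : (v.record b).advance G f = ([createGraph G],
          { v.record b with phase := .waitParties }, none' n Unit) := by
        simp only [VState.advance, hph, hp, if_pos hs]
        rfl
      have hg' : VGood H { v.record b with phase := .waitParties } :=
        ⟨hg.zero, fun _ => hg.corr (by rw [hph, hp]; simp), fun h => by simp at h⟩
      have hlv : v.left = Finset.univ := left_of_ne (by simp [hp])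
      by_cases hr' : VState.ready { v.record b with phase := .waitParties }
      · simp only [mainGates, mainRun, e1, e2, vRun_none_of_ready G f hr', Batch.empty_append]
        obtain ⟨h1, h2, h3⟩ := hg'.advance_waitParties G f rfl hr'
        refine ⟨?_, h2, by simp⟩
        rw [h1]
        rcases h3 with ⟨h3, h4⟩ | ⟨h3, h4⟩ | ⟨h3, h4, h5⟩
        · rw [h4]
          exact .abort _ _ h3 (.inr ⟨hp, rfl⟩) (fixGate_of_ne f (by simp [hp]))
        · rw [h4, ← hlv]
          exact .grant _ _ h3 (.inl ⟨hp, rfl⟩)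
        · rw [h5, ← hlv]
          exact .stay _ _ (by simp [h3]) h4 (by simp [hlv])
            (.inl ⟨hp, by simp [h3], rfl⟩)
      · simp only [mainGates, mainRun, e1, e2, vRun_idle G f hr', Batch.empty_append]
        refine ⟨?_, hr', by simp⟩
        have := Outcome.stay (G := G) (f := f) (H := H) (v := v) [createGraph G]
          { v.record b with phase := .waitParties } (by simp) hg' (by simp [hlv])
          (.inl ⟨hp, by simp, rfl⟩)
        rwa [hlv, left_of_ne (by simp), Finset.sdiff_self, sendTo_empty] at this
    · have e2 : (v.record b).advance G f = ([], { v.record b with phase := .done },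
          sendTo Finset.univ fun _ => .bot) := by
        simp only [VState.advance, hph, hp, if_neg hs]
      have hd : ¬ VState.ready { v.record b with phase := .done } := VState.not_ready_of_done rfl
      simp only [mainGates, mainRun, e1, e2, vRun_idle G f hd, Batch.append_empty]
      exact ⟨.abort _ _ rfl (.inl rfl) (fixGate_of_ne f (by simp [hp])), hd, .inr hd⟩
  · obtain ⟨h1, h2, h3⟩ := hg.advance_waitParties G f hp hr
    have hlv : v.left = Finset.univ := left_of_ne (by simp [hp])
    simp only [mainGates, mainRun, e1, vRun_idle G f h2, Batch.append_empty, h1]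
    refine ⟨?_, h2, .inr h2⟩
    rcases h3 with ⟨h3, h4⟩ | ⟨h3, h4⟩ | ⟨h3, h4, h5⟩
    · rw [h4]
      exact .abort _ _ h3 (.inl rfl) (fixGate_of_ne f (by simp [hp]))
    · rw [h4, ← hlv]
      exact .grant _ _ h3 (.inr ⟨hp, rfl⟩)
    · rw [h5, ← hlv]
      exact .stay _ _ (by simp [h3]) h4 (by simp [hlv])
        (.inr ⟨by simp [h3, hp], rfl⟩)
  · have hM : (v.record b).M = v.M := by
      have : (v.record b).c = v.c := funext fun i => firstOf_isSome _ (h.isSome hp i) _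
      simp only [VState.M, this]
    have hd : ¬ VState.ready { v.record b with phase := .done } := VState.not_ready_of_done rfl
    by_cases hf : f (v.record b).M (fun i => (v.record b).x i) (fun i => (v.record b).z i)
    · have e2 : (v.record b).advance G f = ([pauli (names (v.record b).Mᶜ)
          (Sum.elim (v.record b).x 0) (Sum.elim (v.record b).z 0)],
          { v.record b with phase := .done }, sendTo v.left qubitOf) := by
        simp only [VState.advance, hph, hp, if_pos hf, VState.left, if_true, hM]
        rfl
      simp only [mainGates, mainRun, e1, e2, vRun_idle G f hd, Batch.append_empty]
      exact ⟨.correct { v.record b with phase := .done } rfl hp hM hf, hd, .inr hd⟩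
    · have e2 : (v.record b).advance G f = ([], { v.record b with phase := .done },
          sendTo Finset.univ fun _ => .bot) := by
        simp only [VState.advance, hph, hp, if_neg hf]
      simp only [mainGates, mainRun, e1, e2, vRun_idle G f hd, Batch.append_empty]
      exact ⟨.abort _ _ rfl (.inl rfl) (if_neg fun h' => hf h'.2.2), hd, .inr hd⟩
  · exact absurd hp hnd

end Phases

end

end GraphVerif

/-! ### The coin flip, and rounds in which honest parties respond. -/

namespace GraphVerif

noncomputable section

open Matrix
open scoped ComplexOrder

/-! ### The coin flip -/

section Coin

variable {n : ℕ} (H : Finset (Party n))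

/-- The properties of the states of the coin flip that are reached after the string has been
sampled. -/
structure CGood (c : CoinState n) : Prop where
  phase : c.phase ≠ .create
  confirm : c.phase = .waitParties → ∀ i, c.c' i = none

lemma CoinState.not_ready_of_done {c : CoinState n} (h : c.phase = .done) : ¬ c.ready := by
  simp [CoinState.ready, h]

lemma CGood.record {c : CoinState n} (h : CGood c) (b : Batch n (Party n) Unit) :
    CGood (c.record b) where
  phase := h.phase
  confirm hp i := by
    have hp' : c.phase = .waitParties := hp
    simp [CoinState.record, hp', h.confirm hp' i]

/-- One reaction suffices: the confirmation phase starts with no confirmation recorded and with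
somebody to wait for. -/
lemma CGood.run {c : CoinState n} (h : CGood c) (b : Batch n (Party n) Unit) :
    CGood (cRun c b).1 ∧ ¬ (cRun c b).1.ready := by
  have hg := h.record b
  rw [cRun]
  split_ifs with hr
  swap
  · exact ⟨hg, hr⟩
  rcases hp : (c.record b).phase with _ | _ | _ | _
  · exact absurd hp hg.phase
  · simp only [cAdvance, hp]
    split_ifs with hA
    · exact ⟨⟨by simp, by simp⟩, CoinState.not_ready_of_done rfl⟩
    · refine ⟨⟨by simp, by simp⟩, fun hr' => ?_⟩
      obtain ⟨i, hi⟩ := Finset.nonempty_iff_ne_empty.2 hA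
      have h3 := hr' i hi
      simp [hg.confirm hp i] at h3
  · simp only [cAdvance, hp]
    split_ifs
    · exact ⟨⟨by simp, by simp⟩, CoinState.not_ready_of_done rfl⟩
    · exact ⟨⟨by simp, by simp⟩, CoinState.not_ready_of_done rfl⟩
  · exact absurd hr (CoinState.not_ready_of_done hp)

/-- The string is only copied into messages and never influences the course of the coin flip.
Executions with different strings therefore run in parallel until it is disclosed. -/
lemma cRun_set (c : CoinState n) (x : Fin n → ZMod 2) (b : Batch n (Party n) Unit) :
    (cRun { c with x := x } b).1 = { (cRun c b).1 with x := x } := by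
  have h1 : ({ c with x := x } : CoinState n).record b = { c.record b with x := x } := rfl
  have h2 : CoinState.ready { c.record b with x := x } ↔ (c.record b).ready := Iff.rfl
  rw [cRun, cRun, h1]
  by_cases hr : (c.record b).ready
  · rw [if_pos hr, if_pos (h2.2 hr)]
    rcases hp : (c.record b).phase with _ | _ | _ | _ <;> simp only [cAdvance, hp]
    · by_cases hA : (c.record b).A = ∅
      · rw [if_pos hA]
        exact congrArg Prod.fst (if_pos hA)
      · rw [if_neg hA]
        exact congrArg Prod.fst (if_neg hA)
    · split_ifs <;> simp only
  · rw [if_neg hr, if_neg (h2.not.2 hr)]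

lemma cRun_x (c : CoinState n) (b : Batch n (Party n) Unit) : (cRun c b).1.x = c.x := by
  have := cRun_set c c.x b
  rw [this]

lemma cRun_c (c : CoinState n) (b : Batch n (Party n) Unit) : (cRun c b).1.c = (c.record b).c := by
  rw [cRun]
  split_ifs
  · rcases hp : (c.record b).phase with _ | _ | _ | _ <;> simp only [cAdvance, hp]
    all_goals split_ifs <;> simp only
  · rfl

lemma sendTo_qubits {A : Finset (Fin n)} {m : Fin n → Msg n} (h : ∀ i, (m i).qubits = ∅)
    (p : Party n) : ∀ μ ∈ sendTo A m p (), μ.qubits = ∅ := by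
  intro μ hμ
  rcases p with _ | i
  · simp [sendTo] at hμ
  · simp only [sendTo] at hμ
    split_ifs at hμ
    · rw [List.mem_singleton] at hμ
      rw [hμ, h]
    · simp at hμ

lemma cRun_qubits (c : CoinState n) (b : Batch n (Party n) Unit) (p : Party n) :
    ∀ m ∈ (cRun c b).2 p (), m.qubits = ∅ := by
  rw [cRun]
  split_ifs
  · rcases hp : (c.record b).phase with _ | _ | _ | _ <;> simp only [cAdvance, hp]
    · simp [Batch.empty]
    · split_ifs <;> exact sendTo_qubits (fun _ => rfl) p
    · split_ifs <;> exact sendTo_qubits (fun _ => rfl) p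
    · simp [Batch.empty]
  · simp [Batch.empty]

/-- Parties that have sent `⊤` are not among those that see the string in advance, and at the end
all of them are told the same. -/
lemma coin_outcome (c : CoinState n) (b : Batch n (Party n) Unit)
    (ht : ∀ i ∈ honest H, (c.record b).c i = some true) :
    (∀ i ∈ honest H, (cRun c b).2 (some i) () = []) ∨
      (∀ i ∈ honest H, (cRun c b).2 (some i) () = [.bits c.x]) ∨
      ∀ i ∈ honest H, (cRun c b).2 (some i) () = [.bot] := by
  have hx : (c.record b).x = c.x := rfl
  rw [cRun]
  split_ifs
  · rcases hp : (c.record b).phase with _ | _ | _ | _ <;> simp only [cAdvance, hp]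
    · exact .inl fun _ _ => rfl
    · split_ifs
      · exact .inr (.inl fun i _ => by simp [sendTo, hx])
      · refine .inl fun i hi => ?_
        simp [sendTo, CoinState.A, ht i hi]
    · split_ifs
      · exact .inr (.inr fun i _ => by simp [sendTo])
      · exact .inr (.inl fun i _ => by simp [sendTo, hx])
    · exact .inl fun _ _ => rfl
  · exact .inl fun _ _ => rfl

/-- A single party that has not asked yet keeps the coin flip from disclosing anything. This is why
the string remains exchangeable until an honest party has received its qubit. -/
lemma cRun_silent {c : CoinState n} {b : Batch n (Party n) Unit} {i : Fin n}
    (hp : c.phase = .waitParties) (hi : (c.record b).c i = none) :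
    cRun c b = (c.record b, none' n Unit) := by
  rw [cRun, if_neg]
  intro hr
  have hp' : (c.record b).phase = .waitParties := hp
  have : ∀ i, ((c.record b).c i).isSome := by simpa [CoinState.ready, hp'] using hr
  simpa [hi] using this i

end Coin

/-! ### Rounds of the real system -/

section Rounds

variable {n : ℕ} (G : SimpleGraph (Fin n)) [DecidableRel G.Adj] (f : CorrTest n)
  (H : Finset (Party n))

/-- A request for a coin flip, or nothing. -/
def askIf (q : Bool) : RealPort → List (Msg n)
  | .inl _ => []
  | .inr _ => if q then [.ask] else []

/-- The step of the protocol in response to the messages `o` of the resource with corrections and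
`p` of the coin flip. -/
abbrev tauResp (θ : Fin n → TauState n) (o ch p : Batch n (Party n) Unit) (i : Fin n) :=
  tauStep G θ (filtOut H (pack o ch p)) i

lemma filtOut_pack {i : Fin n} (hi : i ∈ honest H) (o ch p : Batch n (Party n) Unit) :
    filtOut H (pack o ch p) (some i) (.inl (.inl ())) = o (some i) () ∧
      filtOut H (pack o ch p) (some i) (.inr ()) = p (some i) () := by
  simp [filtOut, (mem_honest H).1 hi, pack]

variable {H}

lemma tauResp_done {θ : Fin n → TauState n} {i : Fin n} (hi : θ i = .done)
    (o ch p : Batch n (Party n) Unit) :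
    tauResp G H θ o ch p i = (.done, [], askIf false, onMain []) := by
  rw [tauResp, tauStep, hi]
  refine Prod.ext rfl (Prod.ext rfl (Prod.ext ?_ ?_)) <;> funext k <;>
    rcases k with (k | k) | k <;> rfl

section Respond

variable {θ : Fin n → TauState n} {i : Fin n} {o p : Batch n (Party n) Unit}

lemma tauResp_waitQubit_nil (hh : i ∈ honest H) (hi : θ i = .waitQubit) (ho : o (some i) () = [])
    (ch p : Batch n (Party n) Unit) :
    tauResp G H θ o ch p i = (.waitQubit, [], askIf false, onMain []) := by
  have h1 := (filtOut_pack H hh o ch p).1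
  rw [ho] at h1
  simp only [tauResp, tauStep, tauParty, hi, h1, List.findSome?_nil]
  refine Prod.ext rfl (Prod.ext rfl (Prod.ext ?_ ?_)) <;> funext k <;>
    rcases k with (k | k) | k <;> rfl

lemma tauResp_waitQubit_bot (hh : i ∈ honest H) (hi : θ i = .waitQubit)
    (ho : o (some i) () = [.bot]) (ch p : Batch n (Party n) Unit) :
    tauResp G H θ o ch p i = (.done, [], askIf false, onMain [.bot]) := by
  have h1 := (filtOut_pack H hh o ch p).1
  rw [ho] at h1
  simp only [tauResp, tauStep, tauParty, hi, h1, List.findSome?_cons, readQubit]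
  refine Prod.ext rfl (Prod.ext rfl (Prod.ext ?_ rfl)) <;> funext k <;>
    rcases k with (k | k) | k <;> rfl

lemma tauResp_waitQubit_qubit (hh : i ∈ honest H) (hi : θ i = .waitQubit) {q : Name n}
    (ho : o (some i) () = [.qubit q]) (ch p : Batch n (Party n) Unit) :
    tauResp G H θ o ch p i = (.waitCoin q, [], askIf true, onMain []) := by
  have h1 := (filtOut_pack H hh o ch p).1
  rw [ho] at h1
  simp only [tauResp, tauStep, tauParty, hi, h1, List.findSome?_cons, readQubit]
  refine Prod.ext rfl (Prod.ext rfl (Prod.ext ?_ ?_)) <;> funext k <;>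
    rcases k with (k | k) | k <;> rfl

lemma tauResp_waitCoin_nil (hh : i ∈ honest H) {q : Name n} (hi : θ i = .waitCoin q)
    (hp : p (some i) () = []) (o ch : Batch n (Party n) Unit) :
    tauResp G H θ o ch p i = (.waitCoin q, [], askIf false, onMain []) := by
  have h1 := (filtOut_pack H hh o ch p).2
  rw [hp] at h1
  simp only [tauResp, tauStep, tauParty, hi, h1, List.findSome?_nil]
  refine Prod.ext rfl (Prod.ext rfl (Prod.ext ?_ ?_)) <;> funext k <;>
    rcases k with (k | k) | k <;> rfl

lemma tauResp_waitCoin_bot (hh : i ∈ honest H) {q : Name n} (hi : θ i = .waitCoin q)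
    (hp : p (some i) () = [.bot]) (o ch : Batch n (Party n) Unit) :
    tauResp G H θ o ch p i = (.done, [], askIf false, onMain [.bot]) := by
  have h1 := (filtOut_pack H hh o ch p).2
  rw [hp] at h1
  simp only [tauResp, tauStep, tauParty, hi, h1, List.findSome?_cons, readBits]
  refine Prod.ext rfl (Prod.ext rfl (Prod.ext ?_ rfl)) <;> funext k <;>
    rcases k with (k | k) | k <;> rfl

lemma tauResp_waitCoin_bits (hh : i ∈ honest H) {q : Name n} (hi : θ i = .waitCoin q)
    {x : Fin n → ZMod 2} (hp : p (some i) () = [.bits x]) (o ch : Batch n (Party n) Unit) :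
    tauResp G H θ o ch p i =
      (.done, [pauli {q} (fun _ => x i) (fun _ => nbr G x i)], askIf false, onMain [.qubit q]) := by
  have h1 := (filtOut_pack H hh o ch p).2
  rw [hp] at h1
  simp only [tauResp, tauStep, tauParty, hi, h1, List.findSome?_cons, readBits]
  refine Prod.ext rfl (Prod.ext rfl (Prod.ext ?_ rfl)) <;> funext k <;>
    rcases k with (k | k) | k <;> rfl

end Respond

lemma tauGates_nil {θ : Fin n → TauState n} {b : Batch n (Party n) RealPort}
    (h : ∀ i ∈ honest H, (tauStep G θ b i).2.1 = []) : tauGates G H θ b = [] := by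
  simp only [tauGates, List.flatMap_eq_nil_iff, List.mem_filter, decide_eq_true_eq]
  rintro (_ | i) ⟨-, hi⟩
  · rfl
  · exact h i ((mem_honest H).2 hi)

lemma tauOut_eq {θ : Fin n → TauState n} {o ch p w : Batch n (Party n) Unit}
    (h : ∀ i ∈ honest H, (tauResp G H θ o ch p i).2.2.2 = onMain (w (some i) ())) :
    tauOut G H θ (filtOut H (pack o ch p)) = honestOut H w (pack o ch p) := by
  funext q k
  by_cases hq : q ∈ H
  · rcases q with _ | i
    · rcases k with (k | k) | k <;> simp [tauOut, honestOut, hq, filtOut, onMain]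
    · have := congrFun (h i ((mem_honest H).2 hq)) k
      simpa [tauOut, honestOut, hq] using this
  · simp [tauOut, honestOut, hq, filtOut]

lemma filtIn_tauIn {θ : Fin n → TauState n} {b : Batch n (Party n) RealPort} {q : Bool}
    (h : ∀ i ∈ honest H, (tauStep G θ b i).2.2.1 = askIf q) :
    filtIn H (tauIn G H θ b (none' n _)) =
      pack (none' n _) (none' n _) (if q then sendTo (honest H) fun _ => .top else none' n _) := by
  funext s k
  by_cases hs : s ∈ H
  · rcases s with _ | i
    · rcases k with (k | k) | k <;> cases q <;>
        simp [filtIn, tauIn, hs, pack, Batch.empty, sendTo]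
    · have h1 := h i ((mem_honest H).2 hs)
      rcases k with (k | k) | k <;> cases q <;>
        simp [filtIn, tauIn, hs, pack, Batch.empty, sendTo, h1, askIf, mem_honest]
  · rcases k with (k | k) | k <;> rcases s with _ | i <;> cases q <;>
      simp [filtIn, tauIn, hs, pack, Batch.empty, sendTo, mem_honest]

lemma tauNext_eq {θ θ' : Fin n → TauState n} {b : Batch n (Party n) RealPort}
    (h : ∀ i ∈ honest H, (tauStep G θ b i).1 = θ' i) (h' : ∀ i ∉ honest H, θ' i = θ i) :
    tauNext G H θ b = θ' := by
  funext i
  by_cases hi : some i ∈ H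
  · simp [tauNext, hi, h i ((mem_honest H).2 hi)]
  · simp [tauNext, hi, h' i (mt (mem_honest H).1 hi)]

/-- The states of the protocol that agree with `t` at the honest parties. -/
def updHonest (H : Finset (Party n)) (θ t : Fin n → TauState n) (i : Fin n) : TauState n :=
  if i ∈ honest H then t i else θ i

/-- A round in which the honest parties react in the same way. -/
lemma realSystem_runs_respond (m : ℕ) {v v₁ : VState n} {c c₁ : CoinState n}
    (hc : c.phase ≠ .create) (θ : Fin n → TauState n) (a : Batch n (Party n) RealPort)
    {g : List (Gate n)} {o p : Batch n (Party n) Unit}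
    (hv : vRun G f v (mainOf a) = (g, v₁, o)) (hcr : cRun c (coinOf a) = (c₁, p))
    (hv₁ : ¬ v₁.ready) (hc₁ : ¬ c₁.ready) {t : Fin n → TauState n} {q : Bool}
    {γ : Fin n → List (Gate n)} {w : Batch n (Party n) Unit}
    (h : ∀ i ∈ honest H, tauResp G H θ o (chanRun (chanOf a)) p i =
      (t i, γ i, askIf q, onMain (w (some i) ()))) :
    Runs m (realSystem G f H)
      (realState G f H v c θ a (none' n _) (none' n _) (none' n _))
      (g ++ tauGates G H θ (filtOut H (pack o (chanRun (chanOf a)) p)))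
      (honestOut H w (pack o (chanRun (chanOf a)) p))
      (realState G f H v₁ c₁ (updHonest H θ t)
        (pack (none' n _) (none' n _) (if q then sendTo (honest H) fun _ => .top else none' n _))
        (none' n _) (none' n _) (none' n _)) := by
  have h1 := realSystem_runs_round G f H m hc θ a hv hcr hv₁ hc₁ rfl
  rwa [tauOut_eq G (w := w) fun i hi => by rw [h i hi], filtIn_tauIn G (q := q) fun i hi => by
    rw [show tauStep _ _ _ _ = _ from h i hi], tauNext_eq G (θ' := updHonest H θ t)
      (fun i hi => by rw [show tauStep _ _ _ _ = _ from h i hi, updHonest, if_pos hi])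
      (fun i hi => by rw [updHonest, if_neg hi])] at h1

lemma updHonest_self {θ t : Fin n → TauState n} (h : ∀ i ∈ honest H, t i = θ i) :
    updHonest H θ t = θ := by
  funext i
  rw [updHonest]
  split_ifs with hi
  · exact h i hi
  · rfl

/-- The corrections of the honest parties. -/
lemma applyGates_tauGates {W : Finset (Name n)} (hW : graphQubits n ⊆ W) {θ : Fin n → TauState n}
    {b : Batch n (Party n) RealPort} {x : Fin n → ZMod 2}
    (h : ∀ i ∈ honest H, (tauStep G θ b i).2.1 =
      [pauli {Sum.inl i} (fun _ => x i) (fun _ => nbr G x i)])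
    (ρ : Matrix (W → ZMod 2) (W → ZMod 2) ℂ) :
    applyGates W (tauGates G H θ b) ρ = conj (stab G W (honest H) x) ρ := by
  have hA : ∀ A : Finset (Fin n), names A ⊆ W := fun A =>
    (Finset.map_subset_map.2 (Finset.subset_univ A)).trans hW
  -- Induction along the list of parties. The single-qubit operators sit on different qubits, so
  -- their exponent vectors have disjoint supports and add up to that of the restricted stabilizer.
  have key : ∀ (l : List (Party n)), l.Nodup → (∀ s ∈ l, s ∈ H) → ∀ ρ,
      applyGates W (l.flatMap fun s => match s with
        | none => []
        | some i => (tauStep G θ b i).2.1) ρ =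
      conj (stab G W (Finset.univ.filter fun i => some i ∈ l) x) ρ := by
    intro l
    induction l with
    | nil =>
      intro _ _ ρ
      have h0 : ∀ z : Fin n → ZMod 2, onNames ∅ z = 0 := by
        intro z; funext q; rcases q with i | k <;> simp [onNames]
      simp [applyGates_nil, stab, h0, pauliOn_zero, conj_one]
    | cons s l ih =>
      intro hnd hH ρ
      rw [List.nodup_cons] at hnd
      have ih' := ih hnd.2 (fun s hs => hH s (List.mem_cons_of_mem _ hs))
      rw [List.flatMap_cons, applyGates_append, ih']
      rcases s with _ | i
      · simp [applyGates_nil]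
      · have hg := h i ((mem_honest H).2 (hH _ (by simp)))
        simp only [hg]
        have hd : Disjoint ({i} : Finset (Fin n)) (Finset.univ.filter fun j => some j ∈ l) := by
          simpa using hnd.1
        have hs : (Finset.univ.filter fun j => some j ∈ some i :: l) =
            {i} ∪ (Finset.univ.filter fun j => some j ∈ l) := by
          ext j; simp
        have hn : ({Sum.inl i} : Finset (Name n)) = names {i} := by simp [names]
        have hcut : ∀ z : Fin n → ZMod 2, cutoff ({Sum.inl i} : Finset (Name n)) (fun _ => z i) =
            onNames {i} z := by
          intro z; funext q
          rcases q with j | k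
          · by_cases hj : j = i <;> simp [cutoff, onNames, hj]
          · simp [cutoff, onNames]
        rw [applyGates_pauli (hn ▸ hA {i}), hcut, hcut, stab, conj_pauliOn_conj, hs, stab,
          onNames_union hd, onNames_union hd, add_comm, add_comm (onNames _ (nbr G x))]
  have hnd : (parties n).Nodup := by
    simp only [parties, List.nodup_cons, List.mem_map, not_exists]
    exact ⟨by simp, (List.nodup_finRange n).map (Option.some_injective _)⟩
  have := key ((parties n).filter (· ∈ H)) (hnd.filter _) (by simp) ρ
  have hs : (Finset.univ.filter fun i => some i ∈ (parties n).filter (· ∈ H)) = honest H := by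
    ext i
    simp [parties, mem_honest]
  rw [hs] at this
  exact this

end Rounds

end

end GraphVerif

/-! ### Allowed corrections as restricted stabilizers, and the reaction of the simulator. -/

namespace GraphVerif

noncomputable section

open Matrix
open scoped ComplexOrder

/-! ### Corrections -/

section Corrections

variable {n : ℕ} (G : SimpleGraph (Fin n)) [DecidableRel G.Adj]

/-- Corrections that pass the test are, up to a sign, restrictions of stabilizers. -/
lemma exists_isShift {F : ∀ M : Finset (Fin n), GaussForm (biadj G M)} {M : Finset (Fin n)}
    {x z : Fin n → ZMod 2} (h : allowed G F M (fun i => x i) (fun i => z i)) :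
    ∃ a, IsShift G M x z a := by
  obtain ⟨-, b, hb⟩ := h
  set A : Matrix {i // i ∉ M} {i // i ∉ M} (ZMod 2) :=
    (G.adjMatrix (ZMod 2)).submatrix Subtype.val Subtype.val with hA
  -- Transposing the factorization gives Γᵀ = Uᵀ [1 0; Rᵀ 0] Vᵀ. With this choice Vᵀ s = (b, 0),
  -- hence Γᵀ s = Uᵀ (b, Rᵀ b), which is z + G_{H'} x by the test.
  set s : {i // i ∈ M} → ZMod 2 := (F M).Vinv.transpose.mulVec (Sum.elim b 0) with hs
  have h1 : (biadj G M).transpose.mulVec s = fun i : {i // i ∉ M} =>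
      z i + A.mulVec (fun i => x i) i := by
    have e1 : (F M).V.transpose.mulVec s = Sum.elim b 0 := by
      rw [hs, Matrix.mulVec_mulVec, ← Matrix.transpose_mul, (F M).mul_V, Matrix.transpose_one,
        Matrix.one_mulVec]
    have e2 : (F M).U.transpose.mulVec ((F M).Uinv.transpose.mulVec
        ((fun i : {i // i ∉ M} => z i) + A.mulVec fun i => x i)) =
        (fun i : {i // i ∉ M} => z i) + A.mulVec fun i => x i := by
      rw [Matrix.mulVec_mulVec, ← Matrix.transpose_mul, (F M).mul_U, Matrix.transpose_one,
        Matrix.one_mulVec]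
    rw [hb] at e2
    rw [(F M).eq, Matrix.transpose_mul, Matrix.transpose_mul, ← Matrix.mulVec_mulVec,
      ← Matrix.mulVec_mulVec, e1, Matrix.fromBlocks_transpose, Matrix.fromBlocks_mulVec]
    simp only [Matrix.transpose_one, Matrix.transpose_zero, Matrix.one_mulVec, Matrix.zero_mulVec,
      add_zero, Sum.elim_comp_inl]
    exact e2
  -- At a party outside M, the entries of `a` on M contribute z + G_{H'} x to Ga and those outside M
  -- contribute G_{H'} x. The two copies of G_{H'} x cancel, leaving z.
  refine ⟨fun i => if h : i ∈ M then s ⟨i, h⟩ else x i, fun i hi => ⟨by simp [hi], ?_⟩⟩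
  have h2 := congrFun h1 ⟨i, hi⟩
  simp only [nbr, Matrix.mulVec, dotProduct, biadj, Matrix.transpose_apply,
    Matrix.submatrix_apply, hA] at h2 ⊢
  have h3 : ∀ j, G.adjMatrix (ZMod 2) j i = G.adjMatrix (ZMod 2) i j := fun j => by
    simp [SimpleGraph.adjMatrix_apply, G.adj_comm]
  rw [← Fintype.sum_subtype_add_sum_subtype (fun j => j ∈ M)]
  have h4 : ∑ j : {j // j ∈ M}, G.adjMatrix (ZMod 2) i j *
      (if h : j.1 ∈ M then s ⟨j.1, h⟩ else x j) = ∑ j : {j // j ∈ M},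
        G.adjMatrix (ZMod 2) j i * s j := by
    refine Finset.sum_congr rfl fun j _ => ?_
    rw [dif_pos j.2, h3]
  have h5 : ∑ j : {j // j ∉ M}, G.adjMatrix (ZMod 2) i j *
      (if h : j.1 ∈ M then s ⟨j.1, h⟩ else x j) = ∑ j : {j // j ∉ M},
        G.adjMatrix (ZMod 2) i j * x j := by
    refine Finset.sum_congr rfl fun j _ => ?_
    rw [dif_neg j.2]
  have h6 := congrArg₂ (· + ·) h4 h5
  simp only [h2, add_assoc, zmod_two_add_self, add_zero] at h6
  convert h6

/-- The corrections of the resource amount to those of the simulator and a shift of the string of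
the coin flip. -/
lemma conj_pauliOn_stab {W : Finset (Name n)} {A B : Finset (Fin n)} (hAB : A ⊆ B)
    {x z a : Fin n → ZMod 2} (ha : ∀ i ∈ A, a i = x i ∧ nbr G a i = z i) (y : Fin n → ZMod 2)
    (ρ : Matrix (W → ZMod 2) (W → ZMod 2) ℂ) :
    conj (pauliOn W (onNames (B \ A) x) (onNames (B \ A) z)) (conj (stab G W A y) ρ) =
      conj (stab G W A (y + a)) (conj (pauliOn W (onNames B x) (onNames B z)) ρ) := by
  -- On `A` the correction `u` and the shift `u'` coincide and cancel modulo two; on `B \ A` only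
  -- the correction is present. This is used for the exponents of X and for those of Z.
  have key : ∀ u w u' : Fin n → ZMod 2, (∀ i ∈ A, u' i = u i) →
      onNames (B \ A) u + onNames A w = onNames A (w + u') + onNames B u := by
    intro u w u' hu
    funext q
    rcases q with i | k
    · by_cases hA : i ∈ A
      · have h2 := zmod_two_add_self (u i)
        simp only [onNames, Pi.add_apply, Sum.elim_inl, Finset.mem_sdiff, hA, hAB hA, hu i hA,
          not_true, and_false, if_true, if_false, zero_add, add_assoc, h2, add_zero]
      · by_cases hB : i ∈ B <;> simp [onNames, hA, hB]
    · simp [onNames]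
  rw [stab, stab, conj_pauliOn_conj, conj_pauliOn_conj, nbr_add, key x y a fun i hi => (ha i hi).1,
    key z _ (nbr G a) fun i hi => (ha i hi).2]

end Corrections

/-! ### Reactions of the simulator -/

section React

variable {n : ℕ} (G : SimpleGraph (Fin n)) [DecidableRel G.Adj] (f : CorrTest n)
  (H : Finset (Party n))

/-- The main port. -/
abbrev mainPort : RealPort := .inl (.inl ())

/-- The channel port. -/
abbrev chanPort : RealPort := .inl (.inr ())

/-- The port of the coin flip. -/
abbrev coinPort : RealPort := .inr ()

variable (p : Party n) (msg : Msg n)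

lemma mainOf_main : mainOf (single p mainPort msg) = single p () msg := by
  funext i k; simp [mainOf, single]

lemma chanOf_main : chanOf (single p mainPort msg) = none' n Unit := by
  funext i k; simp [chanOf, single, Batch.empty]

lemma coinOf_main : coinOf (single p mainPort msg) = none' n Unit := by
  funext i k; simp [coinOf, single, Batch.empty]

lemma mainOf_chan : mainOf (single p chanPort msg) = none' n Unit := by
  funext i k; simp [mainOf, single, Batch.empty]

lemma chanOf_chan : chanOf (single p chanPort msg) = single p () msg := by
  funext i k; simp [chanOf, single]

lemma coinOf_chan : coinOf (single p chanPort msg) = none' n Unit := by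
  funext i k; simp [coinOf, single, Batch.empty]

lemma mainOf_coin : mainOf (single p coinPort msg) = none' n Unit := by
  funext i k; simp [mainOf, single, Batch.empty]

lemma chanOf_coin : chanOf (single p coinPort msg) = none' n Unit := by
  funext i k; simp [chanOf, single, Batch.empty]

lemma coinOf_coin : coinOf (single p coinPort msg) = single p () msg := by
  funext i k; simp [coinOf, single]

lemma mainRun_idle {v : VState n} (hv : ¬ v.ready) :
    mainRun G f v (none' n Unit) = (v, none' n Unit) := by
  simp [mainRun, vRun_idle G f hv, Batch.append_empty]

lemma mainRun_done {v : VState n} (hv : v.phase = .done) (b : Batch n (Party n) Unit) :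
    mainRun G f v b = (v.record b, none' n Unit) := by
  have h : ¬ (v.record b).ready := VState.not_ready_of_done (v := v.record b) hv
  have h1 : vRun G f v b = ([], v.record b, none' n Unit) := vRun_of_not_ready G f h
  simp [mainRun, h1, vRun_idle G f h, Batch.append_empty]

lemma fixGate_self (v : VState n) : fixGate f H v v = ⟨∅, 1⟩ :=
  if_neg fun h => by simpa [h.1] using h.2.1

lemma not_granted_empty : ¬ Granted H (none' n Unit) := by
  rintro ⟨i, -, h⟩
  simp [Batch.empty] at h

lemma flagOf_empty (o : Batch n (Party n) Unit) (ho : ∀ i ∈ honest H, Msg.bot ∉ o (some i) ()) :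
    flagOf H o (none' n Unit) = none := by
  rw [flagOf, if_neg, if_neg]
  · rintro ⟨i, -, x, h⟩
    simp [Batch.empty] at h
  · rintro ⟨i, hi, h | h⟩
    · exact ho i hi h
    · simp [Batch.empty] at h

lemma coinRun_of_not {c : CoinState n} {b : Batch n (Party n) Unit} {g : Prop} (hg : ¬ g)
    (a : Fin n → ZMod 2) : coinRun H c b g a = cRun c b := if_neg hg

/-- Qubits are released by a message on the main port, so the coin flip receives nothing from the
dishonest interfaces in the same round, and only the requests of the honest parties count. -/
lemma coinRun_of_granted {c : CoinState n} (hc : ¬ c.ready) {g : Prop} (hg : g)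
    (a : Fin n → ZMod 2) : coinRun H c (none' n Unit) g a =
      cRun { c with x := c.x + a } (sendTo (honest H) fun _ => .top) := by
  rw [coinRun, if_pos hg]
  simp [cRun_idle hc, Batch.empty_append]

lemma control_chan {v : VState n} {c : CoinState n} (hv : ¬ v.ready) (hc : ¬ c.ready) :
    control G f H v c (single p chanPort msg) =
      ⟨v, c, none' n Unit, none' n Unit, none, ⟨∅, 1⟩⟩ := by
  simp only [control, mainOf_chan, coinOf_chan, mainRun_idle G f hv, fixGate_self,
    coinRun_of_not H (not_granted_empty H), cRun_idle hc,
    flagOf_empty H (none' n Unit) (fun i _ => by simp [Batch.empty])]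

lemma control_coin {v : VState n} (c : CoinState n) (hv : ¬ v.ready) :
    control G f H v c (single p coinPort msg) =
      ⟨v, (cRun c (single p () msg)).1, none' n Unit, (cRun c (single p () msg)).2,
        flagOf H (none' n Unit) (cRun c (single p () msg)).2, ⟨∅, 1⟩⟩ := by
  simp only [control, mainOf_coin, coinOf_coin, mainRun_idle G f hv, fixGate_self,
    coinRun_of_not H (not_granted_empty H)]

lemma control_main_of_not {v v' : VState n} {c : CoinState n} (hc : ¬ c.ready)
    {o : Batch n (Party n) Unit} (hm : mainRun G f v (single p () msg) = (v', o))
    (hg : ¬ Granted H o) :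
    control G f H v c (single p mainPort msg) =
      ⟨v', c, o, none' n Unit, flagOf H o (none' n Unit), fixGate f H v v'⟩ := by
  simp only [control, mainOf_main, coinOf_main, hm, coinRun_of_not H hg, cRun_idle hc]

lemma control_main_of_granted {v v' : VState n} {c c₁ : CoinState n} (hc : ¬ c.ready)
    {o q : Batch n (Party n) Unit} (hm : mainRun G f v (single p () msg) = (v', o))
    (hg : Granted H o)
    (hq : cRun { c with x := c.x + shift G H v v' } (sendTo (honest H) fun _ => .top) = (c₁, q)) :
    control G f H v c (single p mainPort msg) =
      ⟨v', c₁, o, q, flagOf H o q, fixGate f H v v'⟩ := by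
  simp only [control, mainOf_main, coinOf_main, hm, coinRun_of_granted H hc hg, hq]

lemma restr_empty_names {κ : Type} [Fintype κ] : (restr H (none' n κ)).names = 0 := by
  rw [restr_empty, Batch.names_empty]

lemma restr_cRun_names (c : CoinState n) (b : Batch n (Party n) Unit) :
    (restr H (cRun c b).2).names = 0 :=
  names_eq_zero fun i _ m hm => cRun_qubits c b i.1 m hm

lemma names_restr_qubits (A : Finset (Fin n)) :
    (restr H (sendTo A qubitOf)).names.Nodup ∧
      (restr H (sendTo A qubitOf)).names.toFinset = names (dishonest H ∩ A) := by
  have key : ∀ (s : {i // i ∉ H}) (q : Name n),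
      (∃ m ∈ restr H (sendTo A qubitOf) s (), q ∈ m.qubits) ↔
        ∃ i ∈ A, s.1 = some i ∧ q = Sum.inl i := by
    rintro ⟨s, hs⟩ q
    rcases s with _ | i
    · simp [restr, sendTo]
    · by_cases hi : i ∈ A <;> simp [restr, sendTo, hi, Msg.qubits]
  constructor
  · refine names_nodup (fun s => ?_) fun s t q hs ht => ?_
    · rcases s with ⟨_ | i, hs⟩
      · exact .inl rfl
      · by_cases hi : i ∈ A <;> simp [restr, sendTo, hi]
    · obtain ⟨i, -, h1, h2⟩ := (key s q).1 hs
      obtain ⟨j, -, h3, h4⟩ := (key t q).1 ht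
      rw [h2] at h4
      obtain rfl := Sum.inl_injective h4
      exact Subtype.ext (h1.trans h3.symm)
  · ext q
    rw [Multiset.mem_toFinset, mem_batch_names]
    constructor
    · rintro ⟨s, ⟨⟩, h⟩
      obtain ⟨i, hi, h1, rfl⟩ := (key s q).1 h
      have : some i ∉ H := h1 ▸ s.2
      simp [mem_names, mem_dishonest, this, hi]
    · intro hq
      rcases q with i | k
      · rw [mem_names, Finset.mem_inter, mem_dishonest] at hq
        exact ⟨⟨some i, hq.1⟩, (), (key _ _).2 ⟨i, hq.2, rfl, rfl⟩⟩
      · exact absurd hq inr_notMem_names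

lemma names_restr_bot (A : Finset (Fin n)) :
    (restr H (sendTo A fun _ => Msg.bot)).names = 0 :=
  names_eq_zero fun i _ m hm => sendTo_qubits (fun _ => rfl) i.1 m hm

lemma mem_chanRun_single {q : Party n} {m : Msg n} :
    m ∈ chanRun (single p () msg) q () ↔ ∃ w s, msg = .chan q w s ∧ m = .chan p w s := by
  simp only [chanRun, List.mem_flatMap, List.mem_filterMap, single, and_true]
  constructor
  · rintro ⟨i, -, m', hm', h⟩
    split_ifs at hm' with hi
    · rw [List.mem_singleton] at hm'
      subst hm' hi
      split at h
      · rename_i k w s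
        split_ifs at h with hk
        · subst hk
          exact ⟨w, s, rfl, (Option.some_injective _ h).symm⟩
      · exact absurd h (by simp)
    · simp at hm'
  · rintro ⟨w, s, rfl, rfl⟩
    refine ⟨p, ?_, .chan q w s, by simp, by simp⟩
    rcases p with _ | i <;> simp [parties]

lemma chanRun_single_qubits (q : Party n) :
    ∀ m ∈ chanRun (single p () msg) q (), m.qubits = msg.qubits := by
  intro m hm
  obtain ⟨w, s, rfl, rfl⟩ := (mem_chanRun_single p msg).1 hm
  rfl

lemma parties_nodup (n : ℕ) : (parties n).Nodup := by
  simp only [parties, List.nodup_cons, List.mem_map, not_exists]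
  exact ⟨by simp, (List.nodup_finRange n).map (Option.some_injective _)⟩

/-- No party is listed twice, so a single message is delivered at most once. The simulator plays the
channel between dishonest interfaces itself and, being physical, must not send a qubit twice. -/
lemma chanRun_single_length (q : Party n) :
    chanRun (single p () msg) q () = [] ∨ ∃ m, chanRun (single p () msg) q () = [m] := by
  have h : ∀ l : List (Party n), l.Nodup → ((l.flatMap fun i => (single p () msg i ()).filterMap fun m =>
    match m with
    | .chan k w qs => if k = q then some (Msg.chan i w qs) else none
    | _ => none).length ≤ if p ∈ l then 1 else 0) := by
    intro l
    induction l with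
    | nil => simp
    | cons i l ih =>
      intro hl
      rw [List.nodup_cons] at hl
      rw [List.flatMap_cons, List.length_append]
      have h1 := ih hl.2
      by_cases hi : i = p
      · subst hi
        rw [if_neg hl.1] at h1
        have h2 := List.length_filterMap_le (fun m : Msg n => match m with
          | .chan k w qs => if k = q then some (Msg.chan i w qs) else none
          | _ => none) (single i () msg i ())
        have h3 : (single i () msg i ()).length = 1 := by simp [single]
        rw [h3] at h2
        simp only [List.mem_cons_self, if_true]
        exact Nat.add_le_add h2 h1
      · have h3 : single p () msg i () = [] := by simp [single, hi]
        have h4 : p ≠ i := fun h => hi h.symm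
        simpa [h3, h4] using h1
  have h1 := h _ (parties_nodup n)
  have h2 : (chanRun (single p () msg) q ()).length ≤ 1 := h1.trans (by split_ifs <;> simp)
  rcases hl : chanRun (single p () msg) q () with _ | ⟨m, _ | ⟨m', l⟩⟩
  · exact .inl rfl
  · exact .inr ⟨m, rfl⟩
  · rw [hl] at h2
    simp at h2

lemma names_restr_chan :
    (restr H (chanRun (single p () msg))).names.Nodup ∧
      (restr H (chanRun (single p () msg))).names.toFinset ⊆ msg.qubits := by
  constructor
  · refine names_nodup (fun s => chanRun_single_length p msg s.1) fun s t q hs ht => ?_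
    obtain ⟨m, hm, -⟩ := hs
    obtain ⟨m', hm', -⟩ := ht
    obtain ⟨w, S, h1, -⟩ := (mem_chanRun_single p msg).1 hm
    obtain ⟨w', S', h2, -⟩ := (mem_chanRun_single p msg).1 hm'
    rw [h1] at h2
    injection h2 with h2
    exact Subtype.ext h2
  · exact names_toFinset_subset fun s _ m hm => (chanRun_single_qubits p msg s.1 m hm).le

lemma names_honestOut_subset {w o ch q : Batch n (Party n) Unit} {S : Finset (Name n)}
    (hw : ∀ i ∈ honest H, ∀ m ∈ w (some i) (), m.qubits ⊆ S)
    (ho : ∀ s ∉ H, ∀ m ∈ o s (), m.qubits ⊆ S) (hch : ∀ s ∉ H, ∀ m ∈ ch s (), m.qubits ⊆ S)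
    (hq : ∀ s ∉ H, ∀ m ∈ q s (), m.qubits ⊆ S) :
    (honestOut H w (pack o ch q)).names.toFinset ⊆ S := by
  refine names_toFinset_subset fun s k m hm => ?_
  by_cases hs : s ∈ H
  · rcases s with _ | i
    · rcases k with (k | k) | k <;> simp [honestOut, hs, onMain] at hm
    · rcases k with (k | k) | k
      · simp only [honestOut, if_pos hs, onMain] at hm
        rw [if_neg (by simp)] at hm
        exact hw i ((mem_honest H).2 hs) m hm
      · simp [honestOut, hs, onMain] at hm
      · simp [honestOut, hs, onMain] at hm
  · rcases k with (k | k) | k <;> simp only [honestOut, if_neg hs, pack] at hm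
    · exact ho s hs m hm
    · exact hch s hs m hm
    · exact hq s hs m hm

end React

end

end GraphVerif

/-! ### The relation between real and ideal configurations. -/

namespace GraphVerif

noncomputable section

open Matrix
open scoped ComplexOrder

/-! ### The relation between the real and the ideal system -/

section Relation

variable {n : ℕ} (G : SimpleGraph (Fin n)) [DecidableRel G.Adj] (f : CorrTest n)
  (H : Finset (Party n))

/-- The real system without messages under way. -/
abbrev realAt (v : VState n) (c : CoinState n) (θ : Fin n → TauState n) :
    (realSystem G f H).State :=
  realState G f H v c θ (none' n _) (none' n _) (none' n _) (none' n _)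

/-- The ideal system without messages under way. -/
abbrev idealAt (w : WState n) (s : SimState n) (held : Finset (Name n)) :
    (idealSystem G f H).State :=
  idealState G f H w s held (none' n _) (none' n _)

lemma names_mono {A B : Finset (Fin n)} (h : A ⊆ B) : names A ⊆ names B := Finset.map_subset_map.2 h

lemma disjoint_names {A B : Finset (Fin n)} (h : Disjoint A B) : Disjoint (names A) (names B) :=
  (Finset.disjoint_map _).2 h

/-- The operator that relates the two density matrices before the resource with corrections has
finished, if the simulator has sampled the string `y`. -/
def openU (m : ℕ) (v : VState n) (y : Fin n → ZMod 2) : Mat n m :=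
  if v.phase = .waitSource then
    stab G (register n m) (honest H) y * createOn G (register n m)
  else stab G (register n m) (honest H) y

variable {G f H} in
-- While the source is silent the operator contains the creation of the graph state and touches all
-- graph qubits, but then none of them has been sent. Later it only touches honest qubits, which
-- have not been sent either.
lemma ActsOn.openU {m : ℕ} {v : VState n} (hv : VGood H v) (y : Fin n → ZMod 2) :
    ActsOn (register n m) (names v.left) (openU G H m v y) := by
  have h1 := (ActsOn.stab G (honest H) (names_subset_register (m := m) _) y).mono
    (names_mono hv.honest_subset)
  rw [GraphVerif.openU]
  split_ifs with hp
  · refine h1.mul ?_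
    rw [left_of_ne (by simp [hp])]
    exact ActsOn.createOn G (names_subset_register Finset.univ)
  · exact h1

/-- The properties of the configurations before the resource with corrections has finished. -/
structure IsOpen {m : ℕ} (v : VState n) (c : CoinState n) (held h : Finset (Name n))
    (ρ : Mat n m) : Prop where
  phase : v.phase ≠ .done
  good : VGood H v
  ready : ¬ v.ready
  coin : CGood c
  coin_ready : ¬ c.ready
  waiting : (honest H).Nonempty → c.phase = .waitParties ∧ ∀ i ∈ honest H, c.c i = none
  fresh : Disjoint h (names v.left)
  held : names (dishonest H ∩ v.left) ⊆ held
  psd : ρ.PosSemidef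

/-- The relation between configurations of the real and the ideal system, except that before the
resource with corrections has finished honest parties are not taken into account. -/
inductive Late {m : ℕ} : (realSystem G f H).State → Mat n m → (idealSystem G f H).State → Mat n m →
    Finset (Name n) → Prop
  | opened (hH : ∃ p, p ∉ H) (hh : honest H = ∅) (v : VState n) (c : CoinState n)
      (held h : Finset (Name n)) (ρ : Mat n m) (ok : IsOpen H v c held h ρ) :
      Late (realAt G f H v c fun _ => .waitQubit) ρ (idealAt G f H (wOpen H) ⟨.run, v, c⟩ held)
        (conj (openU G H m v c.x) ρ) h
  | pending (hH : ∃ p, p ∉ H) (hh : (honest H).Nonempty) (v : VState n) (hv : v.phase = .done)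
      (c : CoinState n) (hc : CGood c) (hcr : ¬ c.ready) (ht : ∀ i ∈ honest H, c.c i = some true)
      (θ : Fin n → TauState n) (hθ : ∀ i ∈ honest H, θ i = .waitCoin (.inl i))
      (held h : Finset (Name n)) (hd : Disjoint h (names (honest H))) (ρ : Mat n m)
      (hρ : ρ.PosSemidef) :
      Late (realAt G f H v c θ) ρ (idealAt G f H (wOpen H) ⟨.run, v, c⟩ held)
        (conj (stab G (register n m) (honest H) c.x) ρ) h
  | closed (v : VState n) (hv : v.phase = .done)
      (c : CoinState n) (hc : CGood c) (hcr : ¬ c.ready)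
      (θ : Fin n → TauState n) (hθ : ∀ i ∈ honest H, θ i = .done)
      (w : WState n) (hw : ¬ w.ready) (hw' : (honest H).Nonempty → w.phase = .done)
      (s : SimState n) (hs : s.stage = .run) (hs' : (∃ p, p ∉ H) → s = ⟨.run, v, c⟩)
      (held h Z : Finset (Name n)) (hd : Disjoint h Z) (U : Mat n m)
      (hU : ActsOn (register n m) Z U) (ρ : Mat n m) (hρ : ρ.PosSemidef) :
      Late (realAt G f H v c θ) ρ (idealAt G f H w s held) (conj U ρ) h

/-- The reaction to a message of the distinguisher before the resource with corrections has
finished: either nothing has changed, or the configurations can be matched up. -/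
inductive OpenStep {m : ℕ} (v : VState n) (c : CoinState n) (held h : Finset (Name n)) (ρ : Mat n m)
    (p : Party n) (k : RealPort) (msg : Msg n) : Prop
  | stay (v' : VState n) (c' : CoinState n) (held' : Finset (Name n)) (gs : List (Gate n))
      (out : Batch n (Party n) RealPort) (x_eq : c'.x = c.x)
      (ok : IsOpen H v' c' held' ((h \ msg.qubits) ∪ out.names.toFinset) (applyGates _ gs ρ))
      -- With an honest party around, the string is undisclosed and the same reaction occurs for all
      -- strings. Without one it may be known already, and only the actual string is considered.
      (real : ∀ x, (honest H = ∅ → x = c.x) → Reacts m (realSystem G f H)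
        (realAt G f H v { c with x := x } fun _ => .waitQubit) (single p k msg) gs out
        (realAt G f H v' { c' with x := x } fun _ => .waitQubit))
      (ideal : ∀ y, (honest H = ∅ → y = c.x) → ∃ gs', Reacts m (idealSystem G f H)
        (idealAt G f H (wOpen H) ⟨.run, v, { c with x := y }⟩ held) (single p k msg) gs' out
        (idealAt G f H (wOpen H) ⟨.run, v', { c' with x := y }⟩ held') ∧
        applyGates _ gs' (conj (openU G H m v y) ρ) =
          conj (openU G H m v' y) (applyGates _ gs ρ)) : OpenStep v c held h ρ p k msg
  | leave (a : Fin n → ZMod 2) (ha : honest H = ∅ → a = 0)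
      (matched : ∀ y, (honest H = ∅ → y = c.x) → ∃ gs gs' out s' t', Reacts m (realSystem G f H)
        (realAt G f H v { c with x := y + a } fun _ => .waitQubit) (single p k msg) gs out s' ∧
        Reacts m (idealSystem G f H)
        (idealAt G f H (wOpen H) ⟨.run, v, { c with x := y }⟩ held) (single p k msg) gs' out t' ∧
        Late G f H s' (applyGates _ gs ρ) t' (applyGates _ gs' (conj (openU G H m v y) ρ))
          ((h \ msg.qubits) ∪ out.names.toFinset)) : OpenStep v c held h ρ p k msg

variable {G f H}

lemma dishonestPart_single {p : Party n} (hp : p ∉ H) (k : RealPort) (msg : Msg n) :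
    dishonestPart H (single p k msg) = single p k msg := by
  funext q k'
  by_cases hq : q ∈ H
  · have : q ≠ p := fun h => hp (h ▸ hq)
    simp [dishonestPart, hq, single, this]
  · simp [dishonestPart, hq]

lemma dishonestPart_single_mem {p : Party n} (hp : p ∈ H) (k : RealPort) (msg : Msg n) :
    dishonestPart H (single p k msg) = none' n _ := by
  funext q k'
  by_cases hq : q ∈ H
  · simp [dishonestPart, hq, Batch.empty]
  · have : q ≠ p := fun h => hq (h ▸ hp)
    simp [dishonestPart, hq, single, this, Batch.empty]

lemma realSystem_reacts {m : ℕ} {v : VState n} {c : CoinState n} (hc : c.phase ≠ .create)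
    (hv : ¬ v.ready) (hcr : ¬ c.ready) {θ : Fin n → TauState n} {p : Party n} (hp : p ∉ H)
    {k : RealPort} {msg : Msg n} {gs : List (Gate n)} {out : Batch n (Party n) RealPort}
    {s' : (realSystem G f H).State}
    (h : Runs m (realSystem G f H) (realState G f H v c θ (single p k msg) (none' n _) (none' n _)
      (none' n _)) gs out s') :
    Reacts m (realSystem G f H) (realAt G f H v c θ) (single p k msg) gs out s' := by
  have h1 := realSystem_reacts_inject G f H m hc hv hcr θ (single p k msg)
  rw [dishonestPart_single hp] at h1
  have h2 := h1.trans h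
  rwa [List.nil_append, Batch.empty_append] at h2

/-- The reaction of the real system to a message that the honest parties do not react to. -/
lemma realSystem_reacts_silent {m : ℕ} {v v₁ : VState n} {c c₁ : CoinState n}
    (hc : c.phase ≠ .create) (hv : ¬ v.ready) (hcr : ¬ c.ready) {θ : Fin n → TauState n}
    {p : Party n} (hp : p ∉ H) {k : RealPort} {msg : Msg n} {o q : Batch n (Party n) Unit}
    (h1 : vRun G f v (mainOf (single p k msg)) = ([], v₁, o))
    (h2 : cRun c (coinOf (single p k msg)) = (c₁, q)) (hv₁ : ¬ v₁.ready) (hc₁ : ¬ c₁.ready)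
    (h : ∀ i ∈ honest H, tauResp G H θ o (chanRun (chanOf (single p k msg))) q i =
      (θ i, [], askIf false, onMain [])) :
    Reacts m (realSystem G f H) (realAt G f H v c θ) (single p k msg) []
      (honestOut H (none' n _) (pack o (chanRun (chanOf (single p k msg))) q))
      (realAt G f H v₁ c₁ θ) := by
  have h3 := realSystem_runs_respond G f m hc θ (single p k msg) h1 h2 hv₁ hc₁ (t := θ) (q := false)
    (γ := fun _ => []) (w := none' n _) h
  rw [tauGates_nil G fun i hi => by rw [show tauStep _ _ _ _ = _ from h i hi],
    updHonest_self fun _ _ => rfl, if_neg (by simp), pack_empty, List.append_nil] at h3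
  exact realSystem_reacts hc hv hcr hp h3

/-- If there are two reactions of the resource, the first one sends nothing. The honest parties thus
respond in a single round, to what both reactions send together. -/
lemma realSystem_runs_main (m : ℕ) {v : VState n} {c : CoinState n} (hcp : c.phase ≠ .create)
    (hcr : ¬ c.ready) (θ : Fin n → TauState n) (p : Party n) (msg : Msg n)
    (h : (vRun G f v (single p () msg)).2.2 = none' n Unit ∨
      ¬ (vRun G f v (single p () msg)).2.1.ready)
    {v' : VState n} {o : Batch n (Party n) Unit}
    (hm : mainRun G f v (single p () msg) = (v', o)) (hr : ¬ v'.ready)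
    {t : Fin n → TauState n} {q : Bool} {w : Batch n (Party n) Unit}
    (hresp : ∀ i ∈ honest H, tauResp G H θ o (none' n _) (none' n _) i =
      (t i, [], askIf q, onMain (w (some i) ()))) :
    Runs m (realSystem G f H)
      (realState G f H v c θ (single p mainPort msg) (none' n _) (none' n _) (none' n _))
      (mainGates G f v (single p () msg)) (honestOut H w (pack o (none' n _) (none' n _)))
      (realState G f H v' c (updHonest H θ t)
        (pack (none' n _) (none' n _) (if q then sendTo (honest H) fun _ => .top else none' n _))
        (none' n _) (none' n _) (none' n _)) := by
  have hg := tauGates_nil G (H := H) (θ := θ) (b := filtOut H (pack o (none' n _) (none' n _)))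
    fun i hi => by rw [show tauStep _ _ _ _ = _ from hresp i hi]
  rcases hv : vRun G f v (single p () msg) with ⟨g₁, v₁, o₁⟩
  rw [hv] at h
  rcases hv2 : vRun G f v₁ (none' n Unit) with ⟨g₂, v₂, o₂⟩
  simp only [mainRun, mainGates, hv, hv2, Prod.mk.injEq] at hm ⊢
  obtain ⟨rfl, rfl⟩ := hm
  by_cases h1 : v₁.ready
  · have h0 : o₁ = none' n Unit := h.resolve_right (not_not.2 h1)
    subst h0
    rw [Batch.empty_append] at hresp hg ⊢
    have e1 := realSystem_runs_step G f H m hcp (v := v) θ (single p mainPort msg) (none' n _)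
      (none' n _) (none' n _)
    rw [mainOf_main, chanOf_main, coinOf_main, hv] at e1
    simp only [tauGates_empty, tauNext_empty, tauOut_empty, tauIn_empty, filtIn_empty,
      filtOut_empty, cRun_idle hcr, chanRun_empty, pack_empty, List.append_nil] at e1
    have e2 := realSystem_runs_respond G f m hcp θ (none' n _) (v := v₁) hv2 (cRun_idle hcr) hr hcr
      (t := t) (q := q) (γ := fun _ => []) (w := w)
      (by simpa only [chanOf_empty, chanRun_empty] using hresp)
    rw [chanOf_empty, chanRun_empty, hg, List.append_nil] at e2
    have e3 := e1.trans e2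
    rwa [Batch.empty_append] at e3
  · have h2 := vRun_idle G f h1
    rw [h2] at hv2
    obtain ⟨rfl, rfl, rfl⟩ : [] = g₂ ∧ v₁ = v₂ ∧ none' n Unit = o₂ := by
      simpa using hv2
    rw [Batch.append_empty] at hresp hg ⊢
    have e2 := realSystem_runs_respond G f m hcp θ (single p mainPort msg) (v := v)
      (by rw [mainOf_main]; exact hv) (by rw [coinOf_main]; exact cRun_idle hcr) hr hcr
      (t := t) (q := q) (γ := fun _ => []) (w := w)
      (by simpa only [chanOf_main, chanRun_empty] using hresp)
    rwa [chanOf_main, chanRun_empty, hg] at e2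

/-! ### The round with the coin flip -/

lemma flagOf_nil {o q : Batch n (Party n) Unit} (ho : ∀ i ∈ honest H, Msg.bot ∉ o (some i) ())
    (hq : ∀ i ∈ honest H, q (some i) () = []) : flagOf H o q = none := by
  rw [flagOf, if_neg, if_neg]
  · rintro ⟨i, hi, x, h⟩
    simp [hq i hi] at h
  · rintro ⟨i, hi, h | h⟩
    · exact ho i hi h
    · simp [hq i hi] at h

lemma flagOf_bits {o q : Batch n (Party n) Unit} (hne : (honest H).Nonempty)
    (ho : ∀ i ∈ honest H, Msg.bot ∉ o (some i) ()) {x : Fin n → ZMod 2}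
    (hq : ∀ i ∈ honest H, q (some i) () = [.bits x]) : flagOf H o q = some true := by
  obtain ⟨i, hi⟩ := hne
  rw [flagOf, if_neg, if_pos ⟨i, hi, x, by simp [hq i hi]⟩]
  rintro ⟨i, hi, h | h⟩
  · exact ho i hi h
  · simp [hq i hi] at h

lemma flagOf_bot {o q : Batch n (Party n) Unit} (hne : (honest H).Nonempty)
    (hq : ∀ i ∈ honest H, q (some i) () = [.bot]) : flagOf H o q = some false := by
  obtain ⟨i, hi⟩ := hne
  rw [flagOf, if_pos ⟨i, hi, .inr (by simp [hq i hi])⟩]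

/-- The end of the protocol, or a wait for the dishonest parties to confirm the coin flip. -/
lemma late_of_coin (m : ℕ) (hH : ∃ p, p ∉ H) (hne : (honest H).Nonempty) {v : VState n}
    (hv : v.phase = .done) {c c₁ : CoinState n} (hc : CGood c) {θ : Fin n → TauState n}
    (hθ : ∀ i ∈ honest H, θ i = .waitCoin (.inl i)) {a : Batch n (Party n) RealPort}
    (hmain : mainOf a = none' n Unit) (hchan : chanOf a = none' n Unit)
    (ht : ∀ i ∈ honest H, (c.record (coinOf a)).c i = some true) {q : Batch n (Party n) Unit}
    (hq : cRun c (coinOf a) = (c₁, q)) {o : Batch n (Party n) Unit}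
    (ho : ∀ i ∈ honest H, Msg.bot ∉ o (some i) ()) :
    ∃ gs θ', Runs m (realSystem G f H)
      (realState G f H v c θ a (none' n _) (none' n _) (none' n _)) gs
      (honestOut H (wReply H (flagOf H o q)) (pack (none' n _) (none' n _) q))
      (realAt G f H v c₁ θ') ∧
      ∀ (ρ : Mat n m), ρ.PosSemidef → ∀ (w : WState n) (held h : Finset (Name n)), ¬ w.ready →
        (flagOf H o q = none → w = wOpen H) → (flagOf H o q ≠ none → w.phase = .done) →
        (flagOf H o q ≠ some true → Disjoint h (names (honest H))) →
        Late G f H (realAt G f H v c₁ θ') (applyGates _ gs ρ)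
          (idealAt G f H w ⟨.run, v, c₁⟩ held)
          (conj (stab G (register n m) (honest H) c.x) ρ) h := by
  have hvr : ¬ v.ready := VState.not_ready_of_done hv
  obtain ⟨hc₁, hcr₁⟩ := hc.run (coinOf a)
  have hx := cRun_x c (coinOf a)
  have hcc := cRun_c c (coinOf a)
  have hcase := coin_outcome H c (coinOf a) ht
  rw [hq] at hc₁ hcr₁ hx hcc hcase
  have hrun := fun {t : Fin n → TauState n} {γ : Fin n → List (Gate n)}
      {w : Batch n (Party n) Unit} h => realSystem_runs_respond G f m hc.phase θ a (v := v)
    (by rw [hmain]; exact vRun_idle G f hvr) hq hvr hcr₁ (H := H) (t := t) (q := false)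
    (γ := γ) (w := w) h
  simp only [hchan, chanRun_empty, if_neg (Bool.false_ne_true), pack_empty, List.nil_append]
    at hrun
  rcases hcase with hcase | hcase | hcase
  -- The coin flip still waits for dishonest parties. The operator of the honest parties is
  -- outstanding in the real system, and so is the flag in the ideal one.
  · rw [flagOf_nil ho hcase]
    have hresp : ∀ i ∈ honest H, tauResp G H θ (none' n _) (none' n _) q i =
        (θ i, [], askIf false, onMain (wReply H none (some i) ())) := fun i hi => by
      rw [tauResp_waitCoin_nil G hi (hθ i hi) (hcase i hi), hθ i hi]; rfl
    have h1 := hrun hresp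
    rw [tauGates_nil G fun i hi => by rw [show tauStep _ _ _ _ = _ from hresp i hi],
      updHonest_self fun _ _ => rfl] at h1
    refine ⟨_, _, h1, fun ρ hρ w held h _ hw _ hd => ?_⟩
    rw [hw rfl, ← hx, applyGates_nil]
    exact .pending hH hne v hv c₁ hc₁ hcr₁ (by rw [hcc]; exact ht) θ hθ held h
      (hd (by simp)) ρ hρ
  · rw [flagOf_bits hne ho hcase]
    have hresp : ∀ i ∈ honest H, tauResp G H θ (none' n _) (none' n _) q i =
        (TauState.done, [pauli {Sum.inl i} (fun _ => c.x i) (fun _ => nbr G c.x i)], askIf false,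
          onMain (wReply H (some true) (some i) ())) := fun i hi => by
      rw [tauResp_waitCoin_bits G hi (hθ i hi) (hcase i hi)]
      simp [wReply, sendTo, hi]
    have h1 := hrun hresp
    refine ⟨_, _, h1, fun ρ hρ w held h hw _ hw' _ => ?_⟩
    rw [applyGates_tauGates G (x := c.x) (names_subset_register Finset.univ) fun i hi => by
      rw [show tauStep _ _ _ _ = _ from hresp i hi]]
    -- The honest parties have just applied the very operator by which the two density matrices
    -- differed, so they are now equal. This allows the honest qubits to be handed to the
    -- distinguisher, with `U = 1` acting on no qubits.
    have := Late.closed (G := G) (f := f) (H := H) (m := m) v hv c₁ hc₁ hcr₁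
      (updHonest H θ fun _ => .done) (fun i hi => by simp [updHonest, hi]) w hw
      (fun _ => hw' (by simp)) ⟨.run, v, c₁⟩ rfl (fun _ => rfl) held h ∅
      (Finset.disjoint_empty_right _) 1 (.one _ _)
      (conj (stab G (register n m) (honest H) c.x) ρ) (conj_posSemidef _ hρ)
    rwa [conj_one] at this
  -- After an abort the honest qubits never reach the distinguisher, so the operator on them may
  -- remain.
  · rw [flagOf_bot hne hcase]
    have hresp : ∀ i ∈ honest H, tauResp G H θ (none' n _) (none' n _) q i =
        (TauState.done, [], askIf false,
          onMain (wReply H (some false) (some i) ())) := fun i hi => by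
      rw [tauResp_waitCoin_bot G hi (hθ i hi) (hcase i hi)]
      simp [wReply]
    have h1 := hrun hresp
    rw [tauGates_nil G fun i hi => by rw [show tauStep _ _ _ _ = _ from hresp i hi]] at h1
    refine ⟨_, _, h1, fun ρ hρ w held h hw _ hw' hd => ?_⟩
    rw [applyGates_nil]
    exact .closed v hv c₁ hc₁ hcr₁ (updHonest H θ fun _ => .done)
      (fun i hi => by simp [updHonest, hi]) w hw
      (fun _ => hw' (by simp)) ⟨.run, v, c₁⟩ rfl (fun _ => rfl) held h (names (honest H))
      (hd (by simp)) _ (ActsOn.stab G (honest H) (names_subset_register (m := m) _) c.x) ρ hρ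

end Relation

end

end GraphVerif

/-! ### Preservation of the relation: operators of the distinguisher, the channel and the port of
the coin flip. -/

namespace GraphVerif

noncomputable section

open Matrix
open scoped ComplexOrder

section Steps

variable {n : ℕ} {G : SimpleGraph (Fin n)} [DecidableRel G.Adj] {f : CorrTest n}
  {H : Finset (Party n)} {m : ℕ}

lemma IsOpen.mono {v : VState n} {c : CoinState n} {held h h' : Finset (Name n)} {ρ : Mat n m}
    (ok : IsOpen H v c held h ρ) (hh : h' ⊆ h) : IsOpen H v c held h' ρ :=
  { ok with fresh := ok.fresh.mono_left hh }

lemma Late.mono {s : (realSystem G f H).State} {t : (idealSystem G f H).State} {ρ ρ' : Mat n m}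
    {h h' : Finset (Name n)} (hl : Late G f H s ρ t ρ' h) (hh : h' ⊆ h) :
    Late G f H s ρ t ρ' h' := by
  cases hl with
  | opened hH he v c held _ ρ ok => exact .opened hH he v c held h' ρ (ok.mono hh)
  | pending hH hne v hv c hc hcr ht θ hθ held _ hd ρ hρ =>
    exact .pending hH hne v hv c hc hcr ht θ hθ held h' (hd.mono_left hh) ρ hρ
  | closed v hv c hc hcr θ hθ w hw hw' s hs hs' held _ Z hd U hU ρ hρ =>
    exact .closed v hv c hc hcr θ hθ w hw hw' s hs hs' held h' Z (hd.mono_left hh) U hU ρ hρ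

lemma realAt_not_active {v : VState n} {c : CoinState n} {θ : Fin n → TauState n} (hv : ¬ v.ready)
    (hc : ¬ c.ready) : ¬ (realSystem G f H).active (realAt G f H v c θ) := by
  rw [realState_active]
  simp [hv, hc]

lemma idealAt_not_active {w : WState n} {s : SimState n} {held : Finset (Name n)} (hw : ¬ w.ready)
    (hs : s.stage = .run) : ¬ (idealSystem G f H).active (idealAt G f H w s held) := by
  rw [idealState_active]
  simp [hw, hs]

lemma Late.basic {s : (realSystem G f H).State} {t : (idealSystem G f H).State} {ρ ρ' : Mat n m}
    {h : Finset (Name n)} (hl : Late G f H s ρ t ρ' h) :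
    ¬ (realSystem G f H).active s ∧ ¬ (idealSystem G f H).active t ∧ ρ.PosSemidef ∧
      ρ'.PosSemidef ∧ ρ.trace = ρ'.trace := by
  cases hl with
  | opened hH he v c held _ ρ ok =>
    obtain ⟨p, hp⟩ := hH
    exact ⟨realAt_not_active ok.ready ok.coin_ready, idealAt_not_active (wOpen_not_ready H hp) rfl,
      ok.psd, conj_posSemidef _ ok.psd, (trace_conj (ActsOn.openU ok.good _).isometry _).symm⟩
  | pending hH hne v hv c hc hcr ht θ hθ held _ hd ρ hρ =>
    obtain ⟨p, hp⟩ := hH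
    exact ⟨realAt_not_active (VState.not_ready_of_done hv) hcr,
      idealAt_not_active (wOpen_not_ready H hp) rfl, hρ, conj_posSemidef _ hρ,
      (trace_conj (ActsOn.stab G _ (names_subset_register _) _).isometry _).symm⟩
  | closed v hv c hc hcr θ hθ w hw hw' s hs hs' held _ Z hd U hU ρ hρ =>
    exact ⟨realAt_not_active (VState.not_ready_of_done hv) hcr, idealAt_not_active hw hs, hρ,
      conj_posSemidef _ hρ, (trace_conj hU.isometry _).symm⟩

lemma ActsOn.applyGates_conj {Z h : Finset (Name n)} {U : Mat n m} (hU : ActsOn (register n m) Z U)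
    (hd : Disjoint h Z) (K : Matrix (h → ZMod 2) (h → ZMod 2) ℂ) (ρ : Mat n m) :
    applyGates _ [⟨h, K⟩] (conj U ρ) = conj U (applyGates _ [⟨h, K⟩] ρ) := by
  rw [applyGates_singleton, applyGates_singleton]
  exact hU.conj_embed ⟨h, K⟩ hd ρ

lemma IsOpen.after_gates {v : VState n} {c : CoinState n} {held h : Finset (Name n)} {ρ : Mat n m}
    (ok : IsOpen H v c held h ρ) (gs : List (Gate n)) : IsOpen H v c held h (applyGates _ gs ρ) :=
  { ok with psd := applyGates_posSemidef _ _ ok.psd }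

/-- In each case the two density matrices differ by an operator on qubits that the distinguisher
does not hold, so its own operator can be moved past. -/
lemma Late.after_gate {s : (realSystem G f H).State} {t : (idealSystem G f H).State}
    {ρ ρ' : Mat n m} {h : Finset (Name n)} (hl : Late G f H s ρ t ρ' h)
    (K : Matrix (h → ZMod 2) (h → ZMod 2) ℂ) :
    Late G f H s (applyGates _ [⟨h, K⟩] ρ) t (applyGates _ [⟨h, K⟩] ρ') h := by
  cases hl with
  | opened hH he v c held _ ρ ok =>
    rw [(ActsOn.openU ok.good _).applyGates_conj ok.fresh]
    exact .opened hH he v c held h _ (ok.after_gates _)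
  | pending hH hne v hv c hc hcr ht θ hθ held _ hd ρ hρ =>
    rw [(ActsOn.stab G _ (names_subset_register _) _).applyGates_conj hd]
    exact .pending hH hne v hv c hc hcr ht θ hθ held h hd _ (applyGates_posSemidef _ _ hρ)
  | closed v hv c hc hcr θ hθ w hw hw' s hs hs' held _ Z hd U hU ρ hρ =>
    rw [hU.applyGates_conj hd]
    exact .closed v hv c hc hcr θ hθ w hw hw' s hs hs' held h Z hd U hU _
      (applyGates_posSemidef _ _ hρ)

/-! ### Messages to which the honest parties do not react -/

lemma tauResp_nil {θ : Fin n → TauState n} {o ch q : Batch n (Party n) Unit} {i : Fin n}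
    (hi : i ∈ honest H) (ho : o (some i) () = []) (hq : q (some i) () = []) :
    tauResp G H θ o ch q i = (θ i, [], askIf false, onMain []) := by
  rcases h : θ i with _ | x | _
  · exact tauResp_waitQubit_nil G hi h ho ch q
  · exact tauResp_waitCoin_nil G hi h hq o ch
  · exact tauResp_done G h o ch q

lemma real_chan {v : VState n} {c : CoinState n} (hc : c.phase ≠ .create) (hv : ¬ v.ready)
    (hcr : ¬ c.ready) (θ : Fin n → TauState n) {p : Party n} (hp : p ∉ H) (msg : Msg n) :
    Reacts m (realSystem G f H) (realAt G f H v c θ) (single p chanPort msg) []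
      (honestOut H (none' n _) (pack (none' n _) (chanRun (single p () msg)) (none' n _)))
      (realAt G f H v c θ) := by
  have h := realSystem_reacts_silent (m := m) hc hv hcr (θ := θ) hp (k := chanPort) (msg := msg)
    (G := G) (f := f) (by rw [mainOf_chan]; exact vRun_idle G f hv)
    (by rw [coinOf_chan]; exact cRun_idle hcr) hv hcr fun i hi => tauResp_nil hi rfl rfl
  rwa [chanOf_chan] at h

lemma flagMain_none : flagMain H none = none' n Unit := by
  funext p k
  simp [flagMain, extend, flagBatch, Batch.empty]

lemma gate_one_isometry : (⟨∅, 1⟩ : Gate n).mat.conjTranspose * (⟨∅, 1⟩ : Gate n).mat = 1 := by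
  simp

lemma ideal_chan {w : WState n} {v : VState n} {c : CoinState n} (hw : ¬ w.ready) (hv : ¬ v.ready)
    (hcr : ¬ c.ready) (held : Finset (Name n)) {p : Party n} (hp : p ∉ H) (msg : Msg n) :
    ∃ gs, Reacts m (idealSystem G f H) (idealAt G f H w ⟨.run, v, c⟩ held) (single p chanPort msg) gs
      (honestOut H (none' n _) (pack (none' n _) (chanRun (single p () msg)) (none' n _)))
      (idealAt G f H w ⟨.run, v, c⟩
        ((held ∪ msg.qubits) \ (restr H (chanRun (single p () msg))).names.toFinset)) ∧
      ∀ ρ : Mat n m, applyGates _ gs ρ = ρ := by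
  obtain ⟨h1, h2⟩ := names_restr_chan H p msg
  obtain ⟨gs, h3, h4⟩ := idealSystem_reacts_dishonest G f H m (w := w) (w₁ := w)
    (s := ⟨.run, v, c⟩) (held := held) hw rfl hp chanPort msg
    (control_chan G f H p msg hv hcr) (by rw [chanOf_chan])
    ⟨Finset.empty_subset _, gate_one_isometry, by rwa [restr_empty_names, zero_add], by
      rw [restr_empty_names, zero_add]; exact h2.trans Finset.subset_union_right,
      restr_empty_names H⟩ (wo := none' n _) (by rw [flagMain_none]; exact wRun_idle G hw) hw
    (by simp [Batch.empty])
  rw [restr_empty_names, zero_add] at h3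
  exact ⟨gs, h3, fun ρ => by rw [h4]; exact applyGates_one _ _ _⟩

lemma names_chanOut (p : Party n) (msg : Msg n) :
    (honestOut H (none' n _) (pack (none' n _) (chanRun (single p () msg)) (none' n _))).names.toFinset
      ⊆ msg.qubits :=
  names_honestOut_subset H (by simp [Batch.empty]) (by simp [Batch.empty])
    (fun s _ μ hμ => (chanRun_single_qubits p msg s μ hμ).le) (by simp [Batch.empty])

lemma ideal_coin {w w₁ : WState n} {v : VState n} {c : CoinState n} (hw : ¬ w.ready)
    (hv : ¬ v.ready) (held : Finset (Name n)) {p : Party n} (hp : p ∉ H) (msg : Msg n)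
    {c₁ : CoinState n} {q : Batch n (Party n) Unit} (hq : cRun c (single p () msg) = (c₁, q))
    {wo : Batch n (Party n) Unit}
    (hrun : wRun G w (flagMain H (flagOf H (none' n Unit) q)) = ([], w₁, wo))
    (hw₁ : ¬ w₁.ready) (hwo : ∀ p ∉ H, ∀ m ∈ wo p (), m.qubits = ∅) :
    ∃ gs, Reacts m (idealSystem G f H) (idealAt G f H w ⟨.run, v, c⟩ held) (single p coinPort msg) gs
      (honestOut H wo (pack (none' n _) (none' n _) q))
      (idealAt G f H w₁ ⟨.run, v, c₁⟩ (held ∪ msg.qubits)) ∧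
      ∀ ρ : Mat n m, applyGates _ gs ρ = ρ := by
  have hctrl := control_coin G f H p msg c hv
  have hqn := restr_cRun_names H c (single p () msg)
  rw [hq] at hctrl hqn
  obtain ⟨gs, h3, h4⟩ := idealSystem_reacts_dishonest G f H m (w := w) (w₁ := w₁)
    (s := ⟨.run, v, c⟩) (held := held) hw rfl hp coinPort msg
    hctrl (by rw [chanOf_coin, chanRun_empty])
    ⟨Finset.empty_subset _, gate_one_isometry, by simp [restr_empty_names], by
      simp [restr_empty_names], hqn⟩ hrun hw₁ hwo
  simp only [restr_empty_names, zero_add, Multiset.toFinset_zero, Finset.sdiff_empty] at h3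
  exact ⟨gs, h3, fun ρ => by rw [h4]; exact applyGates_one _ _ _⟩

lemma single_nil {p : Party n} (hp : p ∉ H) (msg : Msg n) {i : Fin n} (hi : i ∈ honest H) :
    single p () msg (some i) () = [] := by
  have : some i ≠ p := fun h => hp (h ▸ (mem_honest H).1 hi)
  simp [single, this]

/-! ### Before the resource with corrections has finished -/

/-- The channel only carries qubits that the distinguisher held, and those are disjoint from the
unsent graph qubits. Forwarding them never costs the simulator a qubit that it has to hand out
later. -/
lemma held_chan {A : Finset (Fin n)} {held h : Finset (Name n)} {p : Party n} {msg : Msg n}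
    (hmsg : msg.qubits ⊆ h) (hd : Disjoint h (names A)) (hA : names (dishonest H ∩ A) ⊆ held) :
    names (dishonest H ∩ A) ⊆
      (held ∪ msg.qubits) \ (restr H (chanRun (single p () msg))).names.toFinset := by
  intro q hq
  rw [Finset.mem_sdiff, Finset.mem_union]
  refine ⟨.inl (hA hq), fun h' => ?_⟩
  exact Finset.disjoint_left.1 hd (hmsg ((names_restr_chan H p msg).2 h'))
    (names_mono Finset.inter_subset_right hq)

lemma IsOpen.step_chan (f : CorrTest n) {v : VState n} {c : CoinState n} {held h : Finset (Name n)}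
    {ρ : Mat n m} (ok : IsOpen H v c held h ρ) {p : Party n} (hp : p ∉ H) {msg : Msg n}
    (hmsg : msg.qubits ⊆ h) : OpenStep G f H v c held h ρ p chanPort msg := by
  refine .stay v c ((held ∪ msg.qubits) \ (restr H (chanRun (single p () msg))).names.toFinset) [] _
    rfl ?_
    (fun x _ => real_chan (c := { c with x := x }) ok.coin.phase ok.ready ok.coin_ready _ hp msg)
    (fun y _ => ?_)
  · rw [applyGates_nil]
    refine { ok.mono (Finset.union_subset Finset.sdiff_subset ((names_chanOut p msg).trans hmsg)) with
      held := held_chan hmsg ok.fresh ok.held }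
  · obtain ⟨gs, h1, h2⟩ := ideal_chan (m := m) (G := G) (f := f) (c := { c with x := y })
      (wOpen_not_ready H hp) ok.ready ok.coin_ready held hp msg
    exact ⟨gs, h1, by rw [h2, applyGates_nil]⟩

/-- If there is an honest party, it has not asked yet, and the coin flip stays silent whatever the
string is. Otherwise the reaction may depend on the string, but then there is only one string to
consider. -/
lemma IsOpen.step_coin (f : CorrTest n) {v : VState n} {c : CoinState n} {held h : Finset (Name n)}
    {ρ : Mat n m} (ok : IsOpen H v c held h ρ) {p : Party n} (hp : p ∉ H) {msg : Msg n} :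
    OpenStep G f H v c held h ρ p coinPort msg := by
  obtain ⟨hc₁, hcr₁⟩ := ok.coin.run (single p () msg)
  have hsil : (honest H).Nonempty → ∀ x, cRun { c with x := x } (single p () msg) =
      (({ c with x := x } : CoinState n).record (single p () msg), none' n Unit) := by
    rintro ⟨i, hi⟩ x
    obtain ⟨h1, h2⟩ := ok.waiting ⟨i, hi⟩
    refine cRun_silent (i := i) h1 ?_
    simp [CoinState.record, h2 i hi, single_nil hp msg hi, firstOf]
  have hout : ∀ x, (honest H = ∅ → x = c.x) →
      cRun { c with x := x } (single p () msg) =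
        ({ (cRun c (single p () msg)).1 with x := x }, (cRun c (single p () msg)).2) := by
    intro x hx
    refine Prod.ext (cRun_set c x _) ?_
    rcases (honest H).eq_empty_or_nonempty with he | hne
    · rw [hx he]
    · rw [hsil hne x]
      exact (congrArg Prod.snd (hsil hne c.x)).symm
  have hnil : ∀ i ∈ honest H, (cRun c (single p () msg)).2 (some i) () = [] := fun i hi => by
    have := congrArg Prod.snd (hsil ⟨i, hi⟩ c.x)
    rw [this]
    rfl
  refine .stay v (cRun c (single p () msg)).1 (held ∪ msg.qubits) []
    (honestOut H (none' n _) (pack (none' n _) (none' n _) (cRun c (single p () msg)).2))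
    (cRun_x _ _) ?_ (fun x hx => ?_) (fun y hy => ?_)
  · rw [applyGates_nil]
    have hn : (honestOut H (none' n _) (pack (none' n _) (none' n _)
        (cRun c (single p () msg)).2)).names.toFinset ⊆ (∅ : Finset (Name n)) :=
      names_honestOut_subset H (by simp [Batch.empty]) (by simp [Batch.empty])
        (by simp [Batch.empty]) fun s _ μ hμ => (cRun_qubits _ _ s μ hμ).le
    refine { ok.mono (Finset.union_subset Finset.sdiff_subset (hn.trans (Finset.empty_subset h))) with
      coin := hc₁, coin_ready := hcr₁, held := ok.held.trans Finset.subset_union_left,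
      waiting := fun hne => ?_ }
    have h1 := congrArg Prod.fst (hsil hne c.x)
    obtain ⟨h2, h3⟩ := ok.waiting hne
    refine ⟨(congrArg CoinState.phase h1).trans h2, fun i hi => ?_⟩
    refine (congrFun (congrArg CoinState.c h1) i).trans ?_
    simp [CoinState.record, h3 i hi, single_nil hp msg hi, firstOf]
  · have h := realSystem_reacts_silent (m := m) (c := { c with x := x })
      (c₁ := { (cRun c (single p () msg)).1 with x := x }) ok.coin.phase ok.ready
      ok.coin_ready (θ := fun _ => .waitQubit) hp
      (k := coinPort) (msg := msg) (G := G) (f := f)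
      (by rw [mainOf_coin]; exact vRun_idle G f ok.ready) (by rw [coinOf_coin]; exact hout x hx)
      ok.ready hcr₁ fun i hi => tauResp_nil hi rfl (hnil i hi)
    rwa [chanOf_coin, chanRun_empty] at h
  · have hflag : flagOf H (none' n Unit) (cRun c (single p () msg)).2 = none :=
      flagOf_nil (by simp [Batch.empty]) hnil
    obtain ⟨gs, h1, h2⟩ := ideal_coin (m := m) (G := G) (f := f) (c := { c with x := y })
      (w := wOpen H) (w₁ := wOpen H) (wo := none' n _)
      (wOpen_not_ready H hp) ok.ready held hp msg (hout y hy)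
      (by rw [hflag, flagMain_none]; exact wRun_idle G (wOpen_not_ready H hp))
      (wOpen_not_ready H hp) (by simp [Batch.empty])
    exact ⟨gs, h1, by rw [h2, applyGates_nil]⟩

end Steps

end

end GraphVerif

/-! ### Messages on the main port before the resource with corrections has finished. -/

namespace GraphVerif

noncomputable section

open Matrix
open scoped ComplexOrder

section MainStep

variable {n : ℕ} {G : SimpleGraph (Fin n)} [DecidableRel G.Adj] {f : CorrTest n}
  {H : Finset (Party n)} {m : ℕ}

lemma sendTo_mem_qubits {A : Finset (Fin n)} {s : Party n} (hs : s ∉ H) :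
    ∀ μ ∈ sendTo A qubitOf s (), μ.qubits ⊆ names (dishonest H ∩ A) := by
  intro μ hμ
  rcases s with _ | i
  · simp [sendTo] at hμ
  · by_cases hi : i ∈ A
    · simp only [sendTo, if_pos hi, List.mem_singleton] at hμ
      subst hμ
      simpa [Msg.qubits, mem_names, mem_dishonest] using ⟨hs, hi⟩
    · simp [sendTo, hi] at hμ

lemma flagOf_abort {A : Finset (Fin n)} (hA : honest H ⊆ A) (hne : (honest H).Nonempty)
    (q : Batch n (Party n) Unit) : flagOf H (sendTo A fun _ => .bot) q = some false := by
  obtain ⟨i, hi⟩ := hne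
  rw [flagOf, if_pos ⟨i, hi, .inl (by simp [sendTo, hA hi])⟩]

lemma no_bot {A : Finset (Fin n)} : ∀ i ∈ honest H, Msg.bot ∉ sendTo A qubitOf (some i) () := by
  intro i _ h
  by_cases hi : i ∈ A <;> simp [sendTo, hi] at h

lemma granted_iff {A : Finset (Fin n)} :
    Granted H (sendTo A qubitOf) ↔ (honest H ∩ A).Nonempty := by
  constructor
  · rintro ⟨i, hi, h⟩
    by_cases hA : i ∈ A
    · exact ⟨i, Finset.mem_inter.2 ⟨hi, hA⟩⟩
    · simp [sendTo, hA] at h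
  · rintro ⟨i, hi⟩
    rw [Finset.mem_inter] at hi
    exact ⟨i, hi.1, by simp [sendTo, hi.2]⟩

lemma not_granted_bot {A : Finset (Fin n)} : ¬ Granted H (sendTo A fun _ => .bot) := by
  rintro ⟨i, _, h⟩
  by_cases hi : i ∈ A <;> simp [sendTo, hi] at h

/-- When the real resource finally creates the graph state, the factor for the creation moves from
the relating operator into the real density matrix; in the ideal system it has been there from the
start. -/
lemma conj_openU_create {v : VState n} (hv : v.phase = .waitSource) (y : Fin n → ZMod 2)
    (ρ : Mat n m) : conj (openU G H m v y) ρ =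
      conj (stab G _ (honest H) y) (applyGates _ [createGraph G] ρ) := by
  rw [openU, if_pos hv, applyGates_singleton, conj_conj]
  rfl

lemma openU_of_ne {v : VState n} (hv : v.phase ≠ .waitSource) (y : Fin n → ZMod 2) :
    openU G H m v y = stab G _ (honest H) y := if_neg hv

/-- Honest parties announce `0`, so their qubits stay with the resource, and all the qubits released
are dishonest ones, which the simulator holds and passes on. No operator is applied, except possibly
the creation of the graph state in the real system. -/
lemma IsOpen.step_stay {v v' : VState n} {c : CoinState n} {held h : Finset (Name n)}
    {ρ : Mat n m} (ok : IsOpen H v c held h ρ) {p : Party n} (hp : p ∉ H) {msg : Msg n}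
    {g : List (Gate n)} (hg : mainGates G f v (single p () msg) = g)
    (hrun : (vRun G f v (single p () msg)).2.2 = none' n Unit ∨
      ¬ (vRun G f v (single p () msg)).2.1.ready)
    (hm : mainRun G f v (single p () msg) = (v', sendTo (v.left \ v'.left) qubitOf))
    (hr : ¬ v'.ready) (phase : v'.phase ≠ .done) (good : VGood H v')
    (left : v'.left ⊆ v.left)
    (gates : (v.phase = .waitSource ∧ v'.phase ≠ .waitSource ∧ g = [createGraph G]) ∨
        ((v.phase = .waitSource ↔ v'.phase = .waitSource) ∧ g = [])) :
    OpenStep G f H v c held h ρ p mainPort msg := by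
  have hA : ∀ i ∈ honest H, i ∉ v.left \ v'.left := fun i hi h' =>
    (Finset.mem_sdiff.1 h').2 (good.honest_subset hi)
  have hng : ¬ Granted H (sendTo (v.left \ v'.left) qubitOf) := by
    rw [granted_iff]
    rintro ⟨i, hi⟩
    rw [Finset.mem_inter] at hi
    exact hA i hi.1 hi.2
  have hfix : fixGate f H v v' = ⟨∅, 1⟩ := if_neg fun h' => phase h'.2.1
  obtain ⟨hnd, hnames⟩ := names_restr_qubits H (v.left \ v'.left)
  have hsub : names (dishonest H ∩ (v.left \ v'.left)) ⊆ names (dishonest H ∩ v.left) :=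
    names_mono (Finset.inter_subset_inter_left Finset.sdiff_subset)
  have hout : (honestOut H (none' n _) (pack (sendTo (v.left \ v'.left) qubitOf) (none' n _)
      (none' n _))).names.toFinset ⊆ names (dishonest H ∩ (v.left \ v'.left)) :=
    names_honestOut_subset H (by simp [Batch.empty]) (fun s hs => sendTo_mem_qubits hs)
      (by simp [Batch.empty]) (by simp [Batch.empty])
  have hdl : Disjoint (names (dishonest H ∩ (v.left \ v'.left))) (names v'.left) :=
    disjoint_names (Finset.disjoint_left.2 fun i hi hi' =>
      (Finset.mem_sdiff.1 (Finset.mem_inter.1 hi).2).2 hi')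
  refine .stay v' c ((held ∪ msg.qubits) \ names (dishonest H ∩ (v.left \ v'.left))) g
    (honestOut H (none' n _) (pack (sendTo (v.left \ v'.left) qubitOf) (none' n _) (none' n _)))
    rfl ?_ (fun x _ => ?_) (fun y _ => ?_)
  · refine ⟨phase, good, hr, ok.coin, ok.coin_ready, ok.waiting, ?_, ?_,
      applyGates_posSemidef _ _ ok.psd⟩
    · rw [Finset.disjoint_union_left]
      exact ⟨(ok.fresh.mono_left Finset.sdiff_subset).mono_right (names_mono left),
        hdl.mono_left hout⟩
    · intro q hq
      rw [Finset.mem_sdiff, Finset.mem_union]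
      refine ⟨.inl (ok.held (names_mono (Finset.inter_subset_inter_left left) hq)), fun hq' => ?_⟩
      exact Finset.disjoint_left.1 hdl hq' (names_mono Finset.inter_subset_right hq)
  · have h1 := realSystem_runs_main (G := G) (f := f) (H := H) m (c := { c with x := x })
      ok.coin.phase ok.coin_ready (fun _ => .waitQubit) p msg hrun hm hr
      (t := fun _ => .waitQubit) (q := false) (w := none' n _)
      fun i hi => tauResp_nil hi (by simp only [sendTo, if_neg (hA i hi)]) rfl
    rw [updHonest_self fun _ _ => rfl, if_neg (by simp), pack_empty, hg] at h1
    exact realSystem_reacts (c := { c with x := x }) ok.coin.phase ok.ready ok.coin_ready hp h1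
  · have hctrl := control_main_of_not G f H p msg (c := { c with x := y }) ok.coin_ready hm hng
    rw [flagOf_empty H _ no_bot, hfix] at hctrl
    obtain ⟨gs, h3, h4⟩ := idealSystem_reacts_dishonest G f H m (w := wOpen H) (w₁ := wOpen H)
      (s := ⟨.run, v, { c with x := y }⟩) (held := held) (wOpen_not_ready H hp) rfl hp mainPort msg
      hctrl (by rw [chanOf_main, chanRun_empty])
      ⟨Finset.empty_subset _, gate_one_isometry, by simpa only [restr_empty_names, add_zero], by
        simp only [restr_empty_names, add_zero, hnames]
        exact (hsub.trans ok.held).trans Finset.subset_union_left, restr_empty_names H⟩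
      (wo := none' n _)
      (by rw [flagMain_none]; exact wRun_idle G (wOpen_not_ready H hp)) (wOpen_not_ready H hp)
      (by simp [Batch.empty])
    simp only [restr_empty_names, add_zero, hnames] at h3
    refine ⟨gs, h3, ?_⟩
    rw [h4, applyGates_one]
    rcases gates with ⟨h5, h6, rfl⟩ | ⟨h5, rfl⟩
    · rw [conj_openU_create h5, openU_of_ne h6]
    · rw [applyGates_nil]
      simp only [openU, h5]

/-- An abort releases no qubit, neither now nor later, so the operator that separates the two
density matrices may stay for ever. No shift of the string is needed. -/
lemma IsOpen.step_abort {v v' : VState n} {c : CoinState n} {held h : Finset (Name n)}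
    {ρ : Mat n m} (ok : IsOpen H v c held h ρ) {p : Party n} (hp : p ∉ H) {msg : Msg n}
    {g : List (Gate n)} (hg : mainGates G f v (single p () msg) = g)
    (hrun : (vRun G f v (single p () msg)).2.2 = none' n Unit ∨
      ¬ (vRun G f v (single p () msg)).2.1.ready)
    (hm : mainRun G f v (single p () msg) = (v', sendTo Finset.univ fun _ => .bot))
    (hr : ¬ v'.ready) (phase : v'.phase = .done)
    (gates : g = [] ∨ (v.phase = .waitSource ∧ g = [createGraph G]))
    (fix : fixGate f H v v' = ⟨∅, 1⟩) :
    OpenStep G f H v c held h ρ p mainPort msg := by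
  set o : Batch n (Party n) Unit := sendTo Finset.univ fun _ => .bot with ho
  have hflag : (honest H).Nonempty → flagOf H o (none' n _) = some false := fun hne =>
    flagOf_abort (Finset.subset_univ _) hne _
  have hflag' : honest H = ∅ → flagOf H o (none' n _) = none := fun he =>
    flagOf_empty H _ (by simp [he])
  have hnames : (restr H o).names = 0 := names_restr_bot H _
  obtain ⟨w', hw1, hw2, hw3, hw4⟩ := wRun_wOpen G H hp (flagOf H o (none' n _))
  -- Either the real resource did nothing and the old operator remains, possibly with the creation
  -- of the graph state in it, or the graph state has been created in this very round and just the
  -- honest operator remains.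
  have hU : ∀ y, ∃ U : Mat n m, ActsOn _ (names v.left) U ∧
      conj (openU G H m v y) ρ = conj U (applyGates _ g ρ) := by
    intro y
    rcases gates with rfl | ⟨h5, rfl⟩
    · exact ⟨_, ActsOn.openU ok.good y, by rw [applyGates_nil]⟩
    · exact ⟨_, (ActsOn.stab G (honest H) (names_subset_register _) y).mono
        (names_mono ok.good.honest_subset), conj_openU_create h5 y ρ⟩
  refine .leave 0 (fun _ => rfl) fun y _ => ?_
  rw [add_zero]
  have h1 := realSystem_runs_main (G := G) (f := f) (H := H) m (c := { c with x := y })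
      ok.coin.phase ok.coin_ready (fun _ => .waitQubit) p msg hrun hm hr
      (t := fun _ => .done) (q := false) (w := wReply H (flagOf H o (none' n _)))
      fun i hi => by
        rw [tauResp_waitQubit_bot G hi rfl (by simp [ho, sendTo]), hflag ⟨i, hi⟩]
        rfl
  rw [if_neg (by simp), pack_empty, hg] at h1
  have h2 := realSystem_reacts (c := { c with x := y }) ok.coin.phase ok.ready ok.coin_ready hp h1
  have hctrl := control_main_of_not G f H p msg (c := { c with x := y }) ok.coin_ready hm
    not_granted_bot
  rw [fix] at hctrl
  obtain ⟨gs, h3, h4⟩ := idealSystem_reacts_dishonest G f H m (w := wOpen H) (w₁ := w')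
    (s := ⟨.run, v, { c with x := y }⟩) (held := held) (wOpen_not_ready H hp) rfl hp mainPort msg
    hctrl (by rw [chanOf_main, chanRun_empty])
    ⟨Finset.empty_subset _, gate_one_isometry, by simp [restr_empty_names, hnames], by
      simp [restr_empty_names, hnames], restr_empty_names H⟩
    hw1 hw2 (fun p hp => wReply_notMem H hp)
  obtain ⟨U, hU1, hU2⟩ := hU y
  refine ⟨g, gs, _, _, _, h2, h3, ?_⟩
  rw [h4, applyGates_one, hU2]
  refine .closed v' phase { c with x := y } ⟨ok.coin.phase, ok.coin.confirm⟩ ok.coin_ready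
    (updHonest H (fun _ => .waitQubit) fun _ => .done) (fun i hi => by simp [updHonest, hi]) w' hw2 (fun hne => hw4 (by rw [hflag hne]; simp)) _ rfl
    (fun _ => rfl) _ _ (names v.left) ?_ U hU1 _ (applyGates_posSemidef _ _ ok.psd)
  refine ok.fresh.mono_left (Finset.union_subset Finset.sdiff_subset ?_)
  refine (names_honestOut_subset H (S := ∅) (fun i hi => ?_) (fun s _ μ hμ => ?_)
    (by simp [Batch.empty]) (by simp [Batch.empty])).trans (Finset.empty_subset h)
  · rw [hflag ⟨i, hi⟩]
    simp [wReply, Msg.qubits]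
  · exact (sendTo_qubits (fun _ => rfl) s μ hμ).le

/-- Here the strings are matched: ideal string `y` with real string `y` plus the shift. By `hfix`
the corrections leave the two density matrices related by the honest operator for the real string.
The honest parties ask for the coin in the same round, which is then left to `late_of_coin`. -/
lemma IsOpen.step_success {v v' : VState n} {c : CoinState n} {held h : Finset (Name n)}
    {ρ : Mat n m} (ok : IsOpen H v c held h ρ) {p : Party n} (hp : p ∉ H) {msg : Msg n}
    {g : List (Gate n)} (hg : mainGates G f v (single p () msg) = g)
    (hrun : (vRun G f v (single p () msg)).2.2 = none' n Unit ∨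
      ¬ (vRun G f v (single p () msg)).2.1.ready)
    (hm : mainRun G f v (single p () msg) = (v', sendTo v.left qubitOf))
    (hr : ¬ v'.ready) (phase : v'.phase = .done)
    (hsupp : (fixGate f H v v').supp ⊆ names (dishonest H ∩ v.left))
    (hiso : (fixGate f H v v').mat.conjTranspose * (fixGate f H v v').mat = 1)
    (hfix : ∀ y, applyGates _ [fixGate f H v v'] (conj (openU G H m v y) ρ) =
      conj (stab G _ (honest H) (y + shift G H v v')) (applyGates _ g ρ)) :
    OpenStep G f H v c held h ρ p mainPort msg := by
  have hA := ok.good.honest_subset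
  obtain ⟨hnd, hnames⟩ := names_restr_qubits H v.left
  have hshift : honest H = ∅ → shift G H v v' = 0 := fun he => dif_neg fun h' => by
    simpa [he] using h'.1.2
  have hps := applyGates_posSemidef (register n m) g ok.psd
  refine .leave (shift G H v v') hshift fun y _ => ?_
  rcases (honest H).eq_empty_or_nonempty with he | hne
  · have hng : ¬ Granted H (sendTo v.left qubitOf) := by
      rw [granted_iff, he]
      simp
    have h1 := realSystem_runs_main (G := G) (f := f) (H := H) m (c := { c with x := y })
      ok.coin.phase ok.coin_ready (fun _ => .waitQubit) p msg hrun hm hr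
      (t := fun _ => .waitQubit) (q := false) (w := none' n _) (fun i hi => by simp [he] at hi)
    rw [if_neg (by simp), pack_empty, hg] at h1
    have h2 := realSystem_reacts (c := { c with x := y }) ok.coin.phase ok.ready ok.coin_ready hp h1
    have hctrl := control_main_of_not G f H p msg (c := { c with x := y }) ok.coin_ready hm hng
    rw [flagOf_empty H _ no_bot] at hctrl
    obtain ⟨gs, h3, h4⟩ := idealSystem_reacts_dishonest G f H m (w := wOpen H) (w₁ := wOpen H)
      (s := ⟨.run, v, { c with x := y }⟩) (held := held) (wOpen_not_ready H hp) rfl hp mainPort msg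
      hctrl (by rw [chanOf_main, chanRun_empty])
      ⟨(hsupp.trans ok.held).trans Finset.subset_union_left, hiso,
        by simpa only [restr_empty_names, add_zero], by
        simp only [restr_empty_names, add_zero, hnames]
        exact ok.held.trans Finset.subset_union_left, restr_empty_names H⟩
      (wo := none' n _)
      (by rw [flagMain_none]; exact wRun_idle G (wOpen_not_ready H hp)) (wOpen_not_ready H hp)
      (by simp [Batch.empty])
    rw [hshift he, add_zero]
    refine ⟨g, gs, _, _, _, h2, h3, ?_⟩
    rw [h4, hfix, hshift he, add_zero]
    exact .closed v' phase { c with x := y } ⟨ok.coin.phase, ok.coin.confirm⟩ ok.coin_ready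
      (updHonest H (fun _ => .waitQubit) fun _ => .waitQubit)
      (fun i hi => by simp [he] at hi) _ (wOpen_not_ready H hp) (fun hne => by simp [he] at hne) _
      rfl (fun _ => rfl) _ _ (names (honest H)) (by simp [he, names]) _
      (ActsOn.stab G (honest H) (names_subset_register _) y) _ hps
  · have hgr : Granted H (sendTo v.left qubitOf) := by
      rwa [granted_iff, Finset.inter_eq_left.2 hA]
    rcases hq : cRun { c with x := y + shift G H v v' } (sendTo (honest H) fun _ => .top)
      with ⟨c₁, q⟩
    have h1 := realSystem_runs_main (G := G) (f := f) (H := H) m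
      (c := { c with x := y + shift G H v v' })
      ok.coin.phase ok.coin_ready (fun _ => .waitQubit) p msg hrun hm hr
      (t := fun i => .waitCoin (.inl i)) (q := true) (w := none' n _) fun i hi =>
        tauResp_waitQubit_qubit G hi rfl (by simp [sendTo, hA hi]) _ _
    rw [if_pos rfl, hg] at h1
    obtain ⟨hw, hcn⟩ := ok.waiting hne
    have hqn := fun s => cRun_qubits { c with x := y + shift G H v v' }
      (sendTo (honest H) fun _ => .top) s
    rw [hq] at hqn
    -- The coin flip is continued with the real string, that is, the shifted one. From here on the
    -- simulator runs its coin flip in the same state as the real one.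
    obtain ⟨gs₂, θ', h2, hlate⟩ := late_of_coin (G := G) (f := f) m ⟨p, hp⟩ hne (v := v') phase
      (c := { c with x := y + shift G H v v' }) ⟨ok.coin.phase, ok.coin.confirm⟩
      (θ := updHonest H (fun _ => .waitQubit) fun i => .waitCoin (.inl i))
      (fun i hi => by simp [updHonest, hi])
      (a := pack (none' n _) (none' n _) (sendTo (honest H) fun _ => .top)) rfl rfl
      (fun i hi => by
        change firstOf readFlag (c.c i) (sendTo (honest H) (fun _ => Msg.top) (some i) ()) = _
        simp [hcn i hi, sendTo, hi, firstOf, readFlag])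
      hq (o := sendTo v.left qubitOf) no_bot
    have h3 := realSystem_reacts (c := { c with x := y + shift G H v v' }) ok.coin.phase ok.ready
      ok.coin_ready hp (h1.trans h2)
    rw [honestOut_append, pack_append, Batch.empty_append, Batch.empty_append, Batch.empty_append,
      Batch.append_empty] at h3
    have hctrl := control_main_of_granted G f H p msg (c := { c with x := y }) ok.coin_ready hm hgr
      hq
    obtain ⟨w', hw1, hw2, hw3, hw4⟩ := wRun_wOpen G H hp (flagOf H (sendTo v.left qubitOf) q)
    have hqr : (restr H q).names = 0 := names_eq_zero fun i _ μ hμ => hqn i.1 μ hμ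
    obtain ⟨gs, h5, h6⟩ := idealSystem_reacts_dishonest G f H m (w := wOpen H) (w₁ := w')
      (s := ⟨.run, v, { c with x := y }⟩) (held := held) (wOpen_not_ready H hp) rfl hp mainPort msg
      hctrl (by rw [chanOf_main, chanRun_empty])
      ⟨(hsupp.trans ok.held).trans Finset.subset_union_left, hiso,
        by simpa only [restr_empty_names, add_zero], by
        simp only [restr_empty_names, add_zero, hnames]
        exact ok.held.trans Finset.subset_union_left, hqr⟩ hw1 hw2 (fun p hp => wReply_notMem H hp)
    refine ⟨_, gs, _, _, _, h3, h5, ?_⟩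
    rw [h6, hfix, applyGates_append]
    refine hlate _ hps w' _ _ hw2 hw3 hw4 fun hflag => ?_
    rw [Finset.disjoint_union_left]
    refine ⟨(ok.fresh.mono_left Finset.sdiff_subset).mono_right (names_mono hA), ?_⟩
    refine Disjoint.mono_left (names_honestOut_subset H (S := names (dishonest H))
      (fun i hi μ hμ => ?_) (fun s hs μ hμ => ?_) (by simp [Batch.empty])
      (fun s _ μ hμ => ?_)) (disjoint_names disjoint_compl_left)
    · rcases hf : flagOf H (sendTo v.left qubitOf) q with _ | (_ | _)
      · rw [hf] at hμ; simp [wReply, Batch.empty] at hμ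
      · rw [hf] at hμ
        simp only [wReply, List.mem_singleton] at hμ
        subst hμ
        exact Finset.empty_subset _
      · exact absurd hf hflag
    · exact (sendTo_mem_qubits hs μ hμ).trans (names_mono Finset.inter_subset_left)
    · rw [hqn s μ hμ]
      exact Finset.empty_subset _

/-- The test only accepts corrections that are, up to a sign, restrictions of stabilizers. -/
def TestOK (G : SimpleGraph (Fin n)) [DecidableRel G.Adj] (f : CorrTest n) : Prop :=
  ∀ (M : Finset (Fin n)) (x z : Fin n → ZMod 2), f M (fun i => x i) (fun i => z i) →
    ∃ a, IsShift G M x z a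

/-- Only accepted corrections involve the test. A release without corrections is the case of shift
zero, where at most the creation of the graph state has to be accounted for. -/
lemma IsOpen.step_main (hf : TestOK G f) {v : VState n} {c : CoinState n}
    {held h : Finset (Name n)} {ρ : Mat n m} (ok : IsOpen H v c held h ρ) {p : Party n}
    (hp : p ∉ H) {msg : Msg n} : OpenStep G f H v c held h ρ p mainPort msg := by
  obtain ⟨hout, hr, hrun⟩ := ok.good.outcome G f ok.phase (single p () msg)
  rcases hm : mainRun G f v (single p () msg) with ⟨v', o⟩
  rw [hm] at hout hr
  generalize hg : mainGates G f v (single p () msg) = g at hout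
  dsimp only at hout hr
  cases hout with
  | stay _ _ phase good left gates =>
    exact ok.step_stay hp hg hrun hm hr phase good left gates
  | abort _ _ phase gates fix => exact ok.step_abort hp hg hrun hm hr phase gates fix
  | grant _ _ phase gates =>
    have hne : v.phase ≠ .waitCorrections := by
      rcases gates with ⟨h1, -⟩ | ⟨h1, -⟩ <;> simp [h1]
    have hfix := fixGate_of_ne (v' := v') (H := H) f hne
    have hsh : shift G H v v' = 0 := dif_neg fun h' => hne h'.1.1
    refine ok.step_success hp hg hrun hm hr phase (by rw [hfix]; exact Finset.empty_subset _)
      (by rw [hfix]; exact gate_one_isometry) fun y => ?_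
    rw [hfix, applyGates_one, hsh, add_zero]
    rcases gates with ⟨h1, rfl⟩ | ⟨h1, rfl⟩
    · exact conj_openU_create h1 y ρ
    · rw [applyGates_nil, openU_of_ne (by simp [h1])]
  | correct _ phase phase' hM test =>
    have hfix : fixGate f H v v' =
        pauli (names (dishonest H \ v'.M)) (Sum.elim v'.x 0) (Sum.elim v'.z 0) :=
      if_pos ⟨phase', phase, test⟩
    have hleft : v.left = v'.Mᶜ := by rw [VState.left, if_pos phase', hM]
    have hset : dishonest H \ v'.M = v'.Mᶜ \ honest H := by
      ext i
      simp only [Finset.mem_sdiff, dishonest, Finset.mem_compl]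
      tauto
    have hA : honest H ⊆ v'.Mᶜ := hleft ▸ ok.good.honest_subset
    refine ok.step_success hp hg hrun hm hr phase ?_ ?_ fun y => ?_
    · rw [hfix, hleft]
      refine names_mono fun i hi => ?_
      rw [Finset.mem_sdiff] at hi
      exact Finset.mem_inter.2 ⟨hi.1, by simpa using hi.2⟩
    · rw [hfix]
      exact pauli_isometry _ _ _
    -- Honest parties lie outside M, so the shift reproduces the corrections at their qubits. What
    -- the simulator cannot correct there is thus absorbed into the string, while it corrects the
    -- remaining qubits outside M itself.
    · have hshift : ∀ i ∈ honest H, shift G H v v' i = v'.x i ∧ nbr G (shift G H v v') i = v'.z i := by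
        intro i hi
        have h1 : (v.phase = .waitCorrections ∧ (honest H).Nonempty) ∧
          ∃ a, IsShift G v'.M v'.x v'.z a := ⟨⟨phase', i, hi⟩, hf _ _ _ test⟩
        rw [shift, dif_pos h1]
        exact h1.2.choose_spec i (by simpa using hA hi)
      rw [hfix, applyGates_pauli (names_subset_register _), applyGates_pauli
        (names_subset_register _), cutoff_names, cutoff_names, cutoff_names, cutoff_names, hset,
        openU_of_ne (by simp [phase']), conj_pauliOn_stab G hA hshift]

end MainStep

end

end GraphVerif

/-! ### The bisimulation after and before the release of the qubits. -/

namespace GraphVerif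

noncomputable section

open Matrix
open scoped ComplexOrder

section Bisimulation

variable {n : ℕ} {G : SimpleGraph (Fin n)} [DecidableRel G.Adj] {f : CorrTest n}
  {H : Finset (Party n)} {m : ℕ}

lemma real_honest {v : VState n} {c : CoinState n} (hc : c.phase ≠ .create) (hv : ¬ v.ready)
    (hcr : ¬ c.ready) (θ : Fin n → TauState n) {p : Party n} (hp : p ∈ H) (k : RealPort)
    (msg : Msg n) :
    Reacts m (realSystem G f H) (realAt G f H v c θ) (single p k msg) [] (none' n _)
      (realAt G f H v c θ) := by
  have h1 := realSystem_reacts_inject G f H m hc hv hcr θ (single p k msg)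
  rwa [dishonestPart_single_mem hp] at h1

lemma real_main_done {v : VState n} {c : CoinState n} (hc : c.phase ≠ .create)
    (hv : v.phase = .done) (hcr : ¬ c.ready) (θ : Fin n → TauState n) {p : Party n} (hp : p ∉ H)
    (msg : Msg n) :
    Reacts m (realSystem G f H) (realAt G f H v c θ) (single p mainPort msg) [] (none' n _)
      (realAt G f H (v.record (single p () msg)) c θ) := by
  have hd : ¬ (v.record (single p () msg)).ready :=
    VState.not_ready_of_done (v := v.record (single p () msg)) hv
  have h := realSystem_reacts_silent (m := m) hc (VState.not_ready_of_done hv) hcr (θ := θ) hp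
    (k := mainPort) (msg := msg) (G := G) (f := f)
    (by rw [mainOf_main]; exact vRun_of_not_ready G f hd)
    (by rw [coinOf_main]; exact cRun_idle hcr) hd hcr fun i hi => tauResp_nil hi rfl rfl
  rwa [chanOf_main, chanRun_empty, pack_empty, honestOut_empty] at h

lemma ideal_main_done {w : WState n} {v : VState n} {c : CoinState n} (hw : ¬ w.ready)
    (hv : v.phase = .done) (hcr : ¬ c.ready) (held : Finset (Name n)) {p : Party n} (hp : p ∉ H)
    (msg : Msg n) :
    ∃ gs, Reacts m (idealSystem G f H) (idealAt G f H w ⟨.run, v, c⟩ held) (single p mainPort msg) gs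
      (none' n _) (idealAt G f H w ⟨.run, v.record (single p () msg), c⟩ (held ∪ msg.qubits)) ∧
      ∀ ρ : Mat n m, applyGates _ gs ρ = ρ := by
  have hctrl := control_main_of_not G f H p msg (c := c) hcr (mainRun_done G f hv _)
    (not_granted_empty H)
  rw [flagOf_empty H _ (by simp [Batch.empty]), fixGate_of_ne f (by simp [hv])] at hctrl
  obtain ⟨gs, h3, h4⟩ := idealSystem_reacts_dishonest G f H m (w := w) (w₁ := w)
    (s := ⟨.run, v, c⟩) (held := held) hw rfl hp mainPort msg
    hctrl (by rw [chanOf_main, chanRun_empty])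
    ⟨Finset.empty_subset _, gate_one_isometry, by simp [restr_empty_names], by
      simp [restr_empty_names], restr_empty_names H⟩ (wo := none' n _)
    (by rw [flagMain_none]; exact wRun_idle G hw) hw (by simp [Batch.empty])
  simp only [restr_empty_names, zero_add, Multiset.toFinset_zero, Finset.sdiff_empty, pack_empty,
    honestOut_empty] at h3
  exact ⟨gs, h3, fun ρ => by rw [h4]; exact applyGates_one _ _ _⟩

/-- The reaction of related configurations to a message. -/
def LateStep (s : (realSystem G f H).State) (ρ : Mat n m) (t : (idealSystem G f H).State)
    (ρ' : Mat n m) (h : Finset (Name n)) (p : Party n) (k : RealPort) (msg : Msg n) : Prop :=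
  ∃ gs gs' out s' t', Reacts m (realSystem G f H) s (single p k msg) gs out s' ∧
    Reacts m (idealSystem G f H) t (single p k msg) gs' out t' ∧
    Late G f H s' (applyGates _ gs ρ) t' (applyGates _ gs' ρ')
      ((h \ msg.qubits) ∪ out.names.toFinset)

lemma names_none_subset (h S : Finset (Name n)) :
    (h \ S) ∪ (none' n RealPort).names.toFinset ⊆ h := by
  rw [Batch.names_empty]
  simp

lemma names_coin_subset {q : Batch n (Party n) Unit} (hq : ∀ s, ∀ μ ∈ q s (), μ.qubits = ∅)
    {w : Batch n (Party n) Unit} (hw : ∀ i ∈ honest H, ∀ μ ∈ w (some i) (), μ.qubits = ∅)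
    (h S : Finset (Name n)) :
    (h \ S) ∪ (honestOut H w (pack (none' n _) (none' n _) q)).names.toFinset ⊆ h :=
  Finset.union_subset Finset.sdiff_subset ((names_honestOut_subset H (S := ∅)
    (fun i hi μ hμ => (hw i hi μ hμ).le) (by simp [Batch.empty]) (by simp [Batch.empty])
    fun s _ μ hμ => (hq s μ hμ).le).trans (Finset.empty_subset h))

lemma Late.step_honest {s : (realSystem G f H).State} {t : (idealSystem G f H).State}
    {ρ ρ' : Mat n m} {h : Finset (Name n)} (hl : Late G f H s ρ t ρ' h) {p : Party n}
    (hp : p ∈ H) (k : RealPort) (msg : Msg n) : LateStep s ρ t ρ' h p k msg := by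
  have key : ∀ gs : List (Gate n), Reacts m (realSystem G f H) s (single p k msg) [] (none' n _) s →
      Reacts m (idealSystem G f H) t (single p k msg) [⟨∅, 1⟩] (none' n _) t →
      LateStep s ρ t ρ' h p k msg := fun gs h1 h2 =>
    ⟨[], _, _, _, _, h1, h2, by
      rw [applyGates_nil, applyGates_one]
      exact hl.mono (names_none_subset h _)⟩
  cases hl with
  | opened hH he v c held _ ρ ok =>
    obtain ⟨p', hp'⟩ := hH
    exact key [] (real_honest ok.coin.phase ok.ready ok.coin_ready _ hp k msg)
      (idealSystem_reacts_honest G f H m (wOpen_not_ready H hp') rfl hp k msg)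
  | pending hH hne v hv c hc hcr ht θ hθ held _ hd ρ hρ =>
    obtain ⟨p', hp'⟩ := hH
    exact key [] (real_honest hc.phase (VState.not_ready_of_done hv) hcr _ hp k msg)
      (idealSystem_reacts_honest G f H m (wOpen_not_ready H hp') rfl hp k msg)
  | closed v hv c hc hcr θ hθ w hw hw' s hs hs' held _ Z hd U hU ρ hρ =>
    exact key [] (real_honest hc.phase (VState.not_ready_of_done hv) hcr _ hp k msg)
      (idealSystem_reacts_honest G f H m hw hs hp k msg)

/-- Without honest parties the shift is zero, so the configuration is matched with the one with the
same string and no family is needed. -/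
lemma late_step_open (hH : ∃ p, p ∉ H) (he : honest H = ∅) {v : VState n} {c : CoinState n}
    {held h : Finset (Name n)} {ρ : Mat n m} {p : Party n} {k : RealPort} {msg : Msg n}
    (hs : OpenStep G f H v c held h ρ p k msg) :
    LateStep (realAt G f H v c fun _ => .waitQubit) ρ (idealAt G f H (wOpen H) ⟨.run, v, c⟩ held)
      (conj (openU G H m v c.x) ρ) h p k msg := by
  cases hs with
  | stay v' c' held' gs out x_eq ok real ideal =>
    have h1 := real c.x fun _ => rfl
    obtain ⟨gs', h2, h3⟩ := ideal c.x fun _ => rfl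
    rw [← x_eq] at h2 h3
    have h4 : (⟨c.phase, c'.x, c.c, c.c'⟩ : CoinState n) = c := by rw [x_eq]
    have h5 : (⟨c'.phase, c.x, c'.c, c'.c'⟩ : CoinState n) = c' := by rw [← x_eq]
    rw [h5] at h1
    rw [h4] at h2
    refine ⟨gs, gs', out, _, _, h1, h2, ?_⟩
    rw [← x_eq, h3]
    exact .opened hH he v' c' held' _ _ ok
  | leave a ha matched =>
    obtain ⟨gs, gs', out, s', t', h1, h2, h3⟩ := matched c.x fun _ => rfl
    rw [ha he, add_zero] at h1
    exact ⟨gs, gs', out, s', t', h1, h2, h3⟩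

/-- Only the coin flip can still matter. The simulator's copy of it has the same string as the real
one, so the analysis of `late_of_coin` applies again, with the silent main port. -/
lemma late_step_pending (hne : (honest H).Nonempty) {v : VState n} (hv : v.phase = .done)
    {c : CoinState n} (hc : CGood c) (hcr : ¬ c.ready)
    (ht : ∀ i ∈ honest H, c.c i = some true) {θ : Fin n → TauState n}
    (hθ : ∀ i ∈ honest H, θ i = .waitCoin (.inl i)) {held h : Finset (Name n)}
    (hd : Disjoint h (names (honest H))) {ρ : Mat n m} (hρ : ρ.PosSemidef) {p : Party n}
    (hp : p ∉ H) (k : RealPort) {msg : Msg n} (hmsg : msg.qubits ⊆ h) :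
    LateStep (realAt G f H v c θ) ρ (idealAt G f H (wOpen H) ⟨.run, v, c⟩ held)
      (conj (stab G (register n m) (honest H) c.x) ρ) h p k msg := by
  have hvr := VState.not_ready_of_done hv
  have hw := wOpen_not_ready H hp
  rcases k with (⟨⟩ | ⟨⟩) | ⟨⟩
  · obtain ⟨gs, h1, h2⟩ := ideal_main_done (m := m) (G := G) (f := f) hw hv hcr held hp msg
    refine ⟨[], gs, _, _, _, real_main_done hc.phase hv hcr θ hp msg, h1, ?_⟩
    rw [h2, applyGates_nil]
    exact .pending ⟨p, hp⟩ hne (v.record (single p () msg)) hv c hc hcr ht θ hθ _ _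
      (hd.mono_left (names_none_subset h _)) ρ hρ
  · obtain ⟨gs, h1, h2⟩ := ideal_chan (m := m) (G := G) (f := f) hw hvr hcr held hp msg
    refine ⟨[], gs, _, _, _, real_chan hc.phase hvr hcr θ hp msg, h1, ?_⟩
    rw [h2, applyGates_nil]
    exact .pending ⟨p, hp⟩ hne v hv c hc hcr ht θ hθ _ _
      (hd.mono_left (Finset.union_subset Finset.sdiff_subset ((names_chanOut p msg).trans hmsg))) ρ hρ
  · rcases hq : cRun c (single p () msg) with ⟨c₁, q⟩
    have hqn := cRun_qubits c (single p () msg)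
    rw [hq] at hqn
    obtain ⟨gs, θ', h1, h2⟩ := late_of_coin (G := G) (f := f) m ⟨p, hp⟩ hne hv hc hθ
      (c₁ := c₁) (q := q) (a := single p coinPort msg) (mainOf_coin p msg) (chanOf_coin p msg)
      (fun i hi => by simp only [CoinState.record, ht i hi, firstOf_some])
      (by rw [coinOf_coin]; exact hq) (o := none' n _) (by simp [Batch.empty])
    obtain ⟨w', hw1, hw2, hw3, hw4⟩ := wRun_wOpen G H hp (flagOf H (none' n _) q)
    obtain ⟨gs', h3, h4⟩ := ideal_coin (m := m) (G := G) (f := f) hw hvr held hp msg hq hw1 hw2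
      (fun p hp => wReply_notMem H hp)
    refine ⟨gs, gs', _, _, _, realSystem_reacts hc.phase hvr hcr hp h1, h3, ?_⟩
    rw [h4]
    refine h2 ρ hρ w' _ _ hw2 hw3 hw4 fun hflag => hd.mono_left (names_coin_subset hqn ?_ h _)
    intro i hi μ hμ
    rcases hf : flagOf H (none' n _) q with _ | (_ | _)
    · rw [hf] at hμ; simp [wReply, Batch.empty] at hμ
    · rw [hf] at hμ
      simp only [wReply, List.mem_singleton] at hμ
      subst hμ
      rfl
    · exact absurd hf hflag

/-- Honest parties have stopped, and dishonest interfaces talk to identical copies of the resources.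
No further graph qubit is released, so the remaining operator stays out of reach. -/
lemma late_step_closed {v : VState n} (hv : v.phase = .done)
    {c : CoinState n} (hc : CGood c) (hcr : ¬ c.ready) {θ : Fin n → TauState n}
    (hθ : ∀ i ∈ honest H, θ i = .done) {w : WState n} (hw : ¬ w.ready)
    (hw' : (honest H).Nonempty → w.phase = .done) {held h Z : Finset (Name n)}
    (hd : Disjoint h Z) {U : Mat n m} (hU : ActsOn (register n m) Z U) {ρ : Mat n m}
    (hρ : ρ.PosSemidef) {p : Party n}
    (hp : p ∉ H) (k : RealPort) {msg : Msg n} (hmsg : msg.qubits ⊆ h) :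
    LateStep (realAt G f H v c θ) ρ (idealAt G f H w ⟨.run, v, c⟩ held) (conj U ρ) h p k msg := by
  have hvr := VState.not_ready_of_done hv
  rcases k with (⟨⟩ | ⟨⟩) | ⟨⟩
  · obtain ⟨gs, h1, h2⟩ := ideal_main_done (m := m) (G := G) (f := f) hw hv hcr held hp msg
    refine ⟨[], gs, _, _, _, real_main_done hc.phase hv hcr θ hp msg, h1, ?_⟩
    rw [h2, applyGates_nil]
    exact .closed (v.record (single p () msg)) hv c hc hcr θ hθ w hw hw' _ rfl (fun _ => rfl) _ _ Z
      (hd.mono_left (names_none_subset h _)) U hU ρ hρ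
  · obtain ⟨gs, h1, h2⟩ := ideal_chan (m := m) (G := G) (f := f) hw hvr hcr held hp msg
    refine ⟨[], gs, _, _, _, real_chan hc.phase hvr hcr θ hp msg, h1, ?_⟩
    rw [h2, applyGates_nil]
    exact .closed v hv c hc hcr θ hθ w hw hw' _ rfl (fun _ => rfl) _ _ Z
      (hd.mono_left (Finset.union_subset Finset.sdiff_subset ((names_chanOut p msg).trans hmsg)))
      U hU ρ hρ
  · rcases hq : cRun c (single p () msg) with ⟨c₁, q⟩
    have hqn := cRun_qubits c (single p () msg)
    obtain ⟨hc₁, hcr₁⟩ := hc.run (single p () msg)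
    rw [hq] at hqn hc₁ hcr₁
    -- The coin flip may still produce messages for honest parties and thus a flag, but a finished
    -- ideal resource does not answer it. Without honest parties no flag is ever raised.
    have hwr : ∃ w₁, wRun G w (flagMain H (flagOf H (none' n _) q)) = ([], w₁, none' n _) ∧
        ¬ w₁.ready ∧ ((honest H).Nonempty → w₁.phase = .done) := by
      rcases (honest H).eq_empty_or_nonempty with he | hne
      · rw [flagOf_nil (by simp [he]) (by simp [he]), flagMain_none]
        exact ⟨w, wRun_idle G hw, hw, hw'⟩
      · obtain ⟨w₁, h1, h2⟩ := wRun_done G (hw' hne) (flagMain H (flagOf H (none' n _) q))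
        exact ⟨w₁, h1, WState.not_ready_of_done h2, fun _ => h2⟩
    obtain ⟨w₁, hw1, hw2, hw3⟩ := hwr
    have h1 := realSystem_reacts_silent (m := m) hc.phase hvr hcr (θ := θ) hp
      (k := coinPort) (msg := msg) (G := G) (f := f)
      (by rw [mainOf_coin]; exact vRun_idle G f hvr) (by rw [coinOf_coin]; exact hq) hvr hcr₁
      fun i hi => by rw [tauResp_done G (hθ i hi), hθ i hi]
    rw [chanOf_coin, chanRun_empty] at h1
    obtain ⟨gs', h3, h4⟩ := ideal_coin (m := m) (G := G) (f := f) hw hvr held hp msg hq hw1 hw2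
      (by simp [Batch.empty])
    refine ⟨[], gs', _, _, _, h1, h3, ?_⟩
    rw [h4, applyGates_nil]
    exact .closed v hv c₁ hc₁ hcr₁ θ hθ w₁ hw2 hw3 _ rfl (fun _ => rfl) _ _ Z
      (hd.mono_left (names_coin_subset hqn (by simp [Batch.empty]) h _)) U hU ρ hρ

lemma IsOpen.step (hf : TestOK G f) {v : VState n} {c : CoinState n}
    {held h : Finset (Name n)} {ρ : Mat n m} (ok : IsOpen H v c held h ρ) {p : Party n}
    (hp : p ∉ H) (k : RealPort) {msg : Msg n} (hmsg : msg.qubits ⊆ h) :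
    OpenStep G f H v c held h ρ p k msg := by
  rcases k with (⟨⟩ | ⟨⟩) | ⟨⟩
  · exact ok.step_main hf hp
  · exact ok.step_chan f hp hmsg
  · exact ok.step_coin f hp

lemma Late.step (hf : TestOK G f) {s : (realSystem G f H).State} {t : (idealSystem G f H).State}
    {ρ ρ' : Mat n m} {h : Finset (Name n)} (hl : Late G f H s ρ t ρ' h) (p : Party n)
    (k : RealPort) (msg : Msg n) (hmsg : msg.qubits ⊆ h) : LateStep s ρ t ρ' h p k msg := by
  by_cases hp : p ∈ H
  · exact hl.step_honest hp k msg
  cases hl with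
  | opened hH he v c held _ ρ ok => exact late_step_open hH he (ok.step hf hp k hmsg)
  | pending hH hne v hv c hc hcr ht θ hθ held _ hd ρ hρ =>
    exact late_step_pending hne hv hc hcr ht hθ hd hρ hp k hmsg
  | closed v hv c hc hcr θ hθ w hw hw' s hs hs' held _ Z hd U hU ρ hρ =>
    rw [hs' ⟨p, hp⟩]
    exact late_step_closed hv hc hcr hθ hw hw' hd hU hρ hp k hmsg

/-- Once the strings are matched, families of one member suffice, and there is nothing left to
rearrange: the exit relation is empty. -/
lemma late_isBisim (hf : TestOK G f) : IsBisim (Y := Unit) m (realSystem G f H) (idealSystem G f H)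
    (fun s ρ t ρ' h => Late G f H (s ()) (ρ ()) (t ()) (ρ' ()) h) (fun _ _ _ _ _ => False) := by
  refine fun s ρ t ρ' h hl => ⟨fun _ => hl.basic, fun K => hl.after_gate K, fun p k msg hmsg => ?_⟩
  obtain ⟨gs, gs', out, s', t', h1, h2, h3⟩ := hl.step hf p k msg hmsg
  exact ⟨fun _ => gs, fun _ => out, fun _ => s', fun _ => gs', fun _ => out, fun _ => t',
    fun _ => h1, fun _ => h2, .inl ⟨out, fun _ => ⟨rfl, rfl⟩, h3⟩⟩

lemma Late.value_eq (hf : TestOK G f) {D : Distinguisher n RealPort}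
    {s : (realSystem G f H).State} {t : (idealSystem G f H).State}
    {ρ ρ' : Mat n D.anc} {h : Finset (Name n)} (hl : Late G f H s ρ t ρ' h)
    (box : Batch n (Party n) RealPort) (mem : D.Mem) :
    value (realSystem G f H) D s box mem h ρ = value (idealSystem G f H) D t box mem h ρ' := by
  have := (late_isBisim (H := H) (m := D.anc) hf).sum_value_eq (fun _ _ _ _ _ h => h.elim)
    (s := fun _ => s) (t := fun _ => t) (ρ := fun _ => ρ) (ρ' := fun _ => ρ') hl box mem
  simpa using this

/-- The relation between the families of configurations that are indexed by the string of the coin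
flip and by the string that the simulator has sampled. -/
def Early (s : (Fin n → ZMod 2) → (realSystem G f H).State) (ρ : (Fin n → ZMod 2) → Mat n m)
    (t : (Fin n → ZMod 2) → (idealSystem G f H).State) (ρ' : (Fin n → ZMod 2) → Mat n m)
    (h : Finset (Name n)) : Prop :=
  ∃ v c held ρ₀, IsOpen H v c held h ρ₀ ∧
    (s = fun x => realAt G f H v { c with x := x } fun _ => .waitQubit) ∧ (ρ = fun _ => ρ₀) ∧
    (t = fun y => idealAt G f H (wOpen H) ⟨.run, v, { c with x := y }⟩ held) ∧
    ρ' = fun y => conj (openU G H m v y) ρ₀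

/-- Before the release nothing that the distinguisher sees depends on the string, so all strings
share one real density matrix and one reaction. An accepted correction ends this stage by a
translation of the strings, other releases and aborts by the identity. -/
lemma early_isBisim (hf : TestOK G f) (hH : ∃ p, p ∉ H) (hne : (honest H).Nonempty) :
    IsBisim m (realSystem G f H) (idealSystem G f H) Early (Late G f H) := by
  rintro _ _ _ _ h ⟨v, c, held, ρ, ok, rfl, rfl, rfl, rfl⟩
  have hne' : honest H ≠ ∅ := hne.ne_empty
  obtain ⟨p', hp'⟩ := hH
  refine ⟨fun y => ⟨realAt_not_active ok.ready (c := { c with x := y }) ok.coin_ready,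
    idealAt_not_active (wOpen_not_ready H hp') rfl, ok.psd, conj_posSemidef _ ok.psd,
    (trace_conj (ActsOn.openU ok.good _).isometry _).symm⟩, fun K => ?_, fun p k msg hmsg => ?_⟩
  · refine ⟨v, c, held, _, ok.after_gates [⟨h, K⟩], rfl, rfl, rfl, ?_⟩
    funext y
    exact (ActsOn.openU ok.good _).applyGates_conj ok.fresh K ρ
  by_cases hp : p ∈ H
  · refine ⟨fun _ => [], fun _ => none' n _, _, fun _ => [⟨∅, 1⟩], fun _ => none' n _, _,
      fun y => real_honest (c := { c with x := y }) ok.coin.phase ok.ready ok.coin_ready _ hp k msg,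
      fun y => idealSystem_reacts_honest G f H m (wOpen_not_ready H hp') rfl hp k msg,
      .inl ⟨none' n _, fun _ => ⟨rfl, rfl⟩, v, c, held, ρ, ok.mono (names_none_subset h _), rfl,
        ?_, rfl, ?_⟩⟩
    · simp [applyGates_nil]
    · simp [applyGates_one]
  cases ok.step hf hp k hmsg with
  | stay v' c' held' gs out x_eq ok' real ideal =>
    choose gs' h1 h2 using fun y => ideal y (fun he => absurd he hne')
    exact ⟨fun _ => gs, fun _ => out, _, gs', fun _ => out, _,
      fun x => real x fun he => absurd he hne', h1, .inl ⟨out, fun _ => ⟨rfl, rfl⟩, v', c', held', _,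
        ok', rfl, rfl, rfl, funext h2⟩⟩
  | leave a ha matched =>
    choose gs gs' out s' t' h1 h2 h3 using fun y => matched y (fun he => absurd he hne')
    -- Translation by the shift. It is a bijection because the shift depends on the corrections only
    -- and not on the string, which is where the secrecy of the coin enters.
    set e : (Fin n → ZMod 2) ≃ (Fin n → ZMod 2) := Equiv.addRight a with he
    refine ⟨fun x => gs (e.symm x), fun x => out (e.symm x), fun x => s' (e.symm x), gs', out, t',
      fun x => ?_, h2, .inr ⟨e, fun y => ?_⟩⟩
    · have h4 := h1 (e.symm x)
      rwa [show e.symm x + a = x from e.apply_symm_apply x] at h4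
    · simp only [Equiv.symm_apply_apply, true_and]
      exact h3 y

lemma early_value_eq (hf : TestOK G f) (hH : ∃ p, p ∉ H) (hne : (honest H).Nonempty)
    {D : Distinguisher n RealPort} {v : VState n} {c : CoinState n} {held h : Finset (Name n)}
    {ρ : Mat n D.anc} (ok : IsOpen H v c held h ρ) (box : Batch n (Party n) RealPort)
    (mem : D.Mem) :
    ∑ x, value (realSystem G f H) D (realAt G f H v { c with x := x } fun _ => .waitQubit) box mem h
        ρ =
      ∑ y, value (idealSystem G f H) D (idealAt G f H (wOpen H) ⟨.run, v, { c with x := y }⟩ held)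
        box mem h (conj (openU G H D.anc v y) ρ) :=
  (early_isBisim (m := D.anc) hf hH hne).sum_value_eq (fun _ _ _ _ _ hl => hl.value_eq hf)
    ⟨v, c, held, ρ, ok, rfl, rfl, rfl, rfl⟩ box mem

end Bisimulation

end

end GraphVerif

namespace GraphVerif

noncomputable section

open Matrix
open scoped ComplexOrder

/-! ### The start of the real system -/

section RealStart

variable {n : ℕ} (G : SimpleGraph (Fin n)) [DecidableRel G.Adj] (f : CorrTest n)
  (H : Finset (Party n))

lemma chanOf_hello : chanOf (hello H) = none' n Unit := by
  funext p k
  by_cases hp : p ∈ H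
  · rcases p with _ | i <;> simp [chanOf, hello, hp, onMain, Batch.empty]
  · simp [chanOf, hello, hp, Batch.empty]

lemma coinOf_hello : coinOf (hello H) = none' n Unit := by
  funext p k
  by_cases hp : p ∈ H
  · rcases p with _ | i <;> simp [coinOf, hello, hp, onMain, Batch.empty]
  · simp [coinOf, hello, hp, Batch.empty]

/-- The state of the resource with corrections that has received the messages of the filters. -/
def vHello (phase : VPhase) : VState n where
  phase := phase
  source := if none ∈ H then some true else none
  c i := if some i ∈ H then some .zero else none
  corr _ := none

lemma record_hello : (vInit n).record (mainOf (hello H)) = vHello H .waitSource := by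
  simp only [VState.record, vInit, vHello]
  congr 1
  · by_cases hp : (none : Party n) ∈ H <;> simp [mainOf, hello, hp, onMain, firstOf, readFlag]
  · funext i
    by_cases hp : (some i : Party n) ∈ H <;> simp [mainOf, hello, hp, onMain, firstOf, readAnnounce]

lemma vRun_hello_of_mem (h : none ∈ H) :
    vRun G f (vInit n) (mainOf (hello H)) = ([createGraph G], vHello H .waitParties, none' n Unit) := by
  rw [vRun, record_hello, if_pos (by simp [VState.ready, vHello, h])]
  simp only [VState.advance, vHello, if_pos h, if_true]
  rfl

lemma vRun_hello_of_notMem (h : none ∉ H) :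
    vRun G f (vInit n) (mainOf (hello H)) = ([], vHello H .waitSource, none' n Unit) := by
  rw [vRun, record_hello, if_neg (by simp [VState.ready, vHello, h])]

lemma VGood.vHello {ph : VPhase} (h : ph ≠ .waitCorrections) : VGood H (vHello H ph) where
  zero i hi := by simp [GraphVerif.vHello, (mem_honest H).1 hi]
  corr _ _ := rfl
  isSome hp := absurd hp h

lemma vHello_not_ready {p : Party n} (hp : p ∉ H) (h : none ∈ H) :
    ¬ (vHello H .waitParties).ready := by
  rcases p with _ | i
  · exact absurd h hp
  · intro hr
    have := hr i
    simp [vHello, hp] at this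

/-- The start of the resource with corrections, if there is a dishonest interface. -/
lemma vStart_spec {p : Party n} (hp : p ∉ H) : ∃ g,
    vRun G f (vInit n) (mainOf (hello H)) = (g, vStart G f H, none' n Unit) ∧
      (vStart G f H).phase ≠ .done ∧ VGood H (vStart G f H) ∧ ¬ (vStart G f H).ready ∧
      (vStart G f H).left = Finset.univ ∧
      (((vStart G f H).phase = .waitSource ∧ g = []) ∨
        ((vStart G f H).phase ≠ .waitSource ∧ g = [createGraph G])) := by
  by_cases h : none ∈ H
  · have h1 := vRun_hello_of_mem G f H h
    have h2 : vStart G f H = vHello H .waitParties := by rw [vStart, h1]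
    rw [h1, h2]
    exact ⟨_, rfl, by simp [vHello], .vHello H (by simp), vHello_not_ready H hp h,
      left_of_ne (by simp [vHello]), .inr ⟨by simp [vHello], rfl⟩⟩
  · have h1 := vRun_hello_of_notMem G f H h
    have h2 : vStart G f H = vHello H .waitSource := by rw [vStart, h1]
    rw [h1, h2]
    exact ⟨_, rfl, by simp [vHello], .vHello H (by simp), by simp [VState.ready, vHello, h],
      left_of_ne (by simp [vHello]), .inl ⟨rfl, rfl⟩⟩

lemma cInit_good (y : Fin n → ZMod 2) : CGood (cInit y) := ⟨by simp [cInit], fun _ _ => rfl⟩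

lemma cRun_cInit (y : Fin n → ZMod 2) :
    cRun (cInit y) (none' n Unit) = (cStart y, none' n Unit) := by
  refine Prod.ext rfl ?_
  -- The coin flip can be ready without any request only for n = 0, when there is nobody to send the
  -- string to.
  by_cases hr : (cInit y).ready
  · have : IsEmpty (Fin n) := ⟨fun i => by simpa [cInit] using hr i⟩
    rw [cRun, CoinState.record_empty, if_pos hr]
    simp only [cAdvance, cInit]
    refine (congrArg Prod.snd (if_pos (Subsingleton.elim _ _))).trans ?_
    rw [Finset.univ_eq_empty, sendTo_empty]
  · rw [cRun_idle hr]

lemma cStart_good (y : Fin n → ZMod 2) : CGood (cStart y) ∧ ¬ (cStart y).ready :=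
  (cInit_good y).run _

lemma cStart_x (y : Fin n → ZMod 2) : (cStart y).x = y := cRun_x _ _

lemma cStart_set (x y : Fin n → ZMod 2) : { cStart x with x := y } = cStart y :=
  (cRun_set (cInit x) y (none' n Unit)).symm

lemma cStart_eq (i : Fin n) (y : Fin n → ZMod 2) : cStart y = cInit y := by
  have hr : ¬ (cInit y).ready := fun hr => by simpa [cInit] using hr i
  rw [cStart, cRun_idle hr]

/-- The density matrix in the real system after the string has been sampled. -/
abbrev sampled (n m : ℕ) : Mat n m := applyGates _ [sampleGate n] (Matrix.single 0 0 1)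

lemma single_posSemidef (m : ℕ) : (Matrix.single 0 0 1 : Mat n m).PosSemidef := by
  have : (Matrix.single 0 0 1 : Mat n m) = Matrix.diagonal (Pi.single 0 1) := by
    rw [Matrix.diagonal_single]
  rw [this]
  refine Matrix.PosSemidef.diagonal fun s => ?_
  by_cases hs : s = 0
  · subst hs; simp
  · simp [hs]

lemma sampled_posSemidef (m : ℕ) : (sampled n m).PosSemidef :=
  applyGates_posSemidef _ _ (single_posSemidef m)

/-- The first step splits the execution into one summand per string. The factor 2⁻ⁿ is contained in
the density matrix, which is the same for all strings. -/
lemma value_real_init (D : Distinguisher n RealPort) (box : Batch n (Party n) RealPort)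
    (mem : D.Mem) (h : Finset (Name n)) :
    value (realSystem G f H) D (realSystem G f H).init box mem h (Matrix.single 0 0 1) =
      ∑ x, value (realSystem G f H) D (realState G f H (vInit n) (cInit x) (fun _ => .waitQubit)
        (hello H) (none' n _) (none' n _) (none' n _)) box mem h (sampled n D.anc) := by
  have hact : (realSystem G f H).active (realSystem G f H).init := .inl (.inl (.inr trivial))
  rw [value_active _ _ _ _ _ _ _ (single_posSemidef _) hact, realSystem_step_init, List.map_map,
    ← Finset.sum_map_toList]
  refine congrArg List.sum (List.map_congr_left fun x _ => ?_)
  simp only [Function.comp, Batch.append_empty, Batch.names_empty, Multiset.toFinset_zero,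
    Finset.union_empty]

lemma realSystem_runs_start (m : ℕ) {g : List (Gate n)}
    (hv : vRun G f (vInit n) (mainOf (hello H)) = (g, vStart G f H, none' n Unit))
    (hr : ¬ (vStart G f H).ready) (x : Fin n → ZMod 2) :
    Runs m (realSystem G f H) (realState G f H (vInit n) (cInit x) (fun _ => .waitQubit)
      (hello H) (none' n _) (none' n _) (none' n _)) g (none' n _)
      (realAt G f H (vStart G f H) (cStart x) fun _ => .waitQubit) := by
  have hresp : ∀ i ∈ honest H, tauResp G H (fun _ => .waitQubit) (none' n _)
      (chanRun (chanOf (hello H))) (none' n _) i =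
      (.waitQubit, [], askIf false, onMain (none' n Unit (some i) ())) := fun i hi =>
    tauResp_waitQubit_nil G hi rfl rfl _ _
  have h1 := realSystem_runs_respond G f m (cInit_good x).phase (fun _ => .waitQubit) (hello H) hv
    (by rw [coinOf_hello]; exact cRun_cInit x) hr (cStart_good x).2 hresp
  rwa [tauGates_nil G fun i hi => by rw [show tauStep _ _ _ _ = _ from hresp i hi],
    updHonest_self fun _ _ => rfl, chanOf_hello, chanRun_empty, pack_empty, honestOut_empty,
    if_neg (by simp), pack_empty, List.append_nil] at h1

end RealStart

/-! ### The real execution with honest interfaces only. -/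

section Correctness

variable {n : ℕ} (G : SimpleGraph (Fin n)) [DecidableRel G.Adj] (f : CorrTest n)

lemma honest_univ : honest (Finset.univ : Finset (Party n)) = Finset.univ := by
  ext i; simp [mem_honest]

lemma dishonest_univ : dishonest (Finset.univ : Finset (Party n)) = ∅ := by
  ext i; simp [mem_dishonest]

lemma vRun_vHello_univ : vRun G f (vHello Finset.univ .waitParties) (none' n Unit) =
    ([], vHello Finset.univ .done, sendTo Finset.univ qubitOf) := by
  have hr : (vHello (n := n) Finset.univ .waitParties).ready := fun i => by simp [vHello]
  rw [vRun_none_of_ready G f hr]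
  have hM : (vHello (n := n) Finset.univ .waitParties).M = ∅ := by
    ext i; simp [VState.M, vHello]
  simp only [VState.advance, hM]
  simp [vHello]

lemma cRun_top (x : Fin n → ZMod 2) (i : Fin n) :
    (cRun (cStart x) (sendTo Finset.univ fun _ => .top)).2 (some i) () = [.bits x] := by
  have hrec : (cInit x).record (sendTo Finset.univ fun _ => .top) =
      ⟨.waitParties, x, fun _ => some true, fun _ => none⟩ := by
    simp [CoinState.record, cInit, sendTo, firstOf, readFlag]
  have hA : CoinState.A (⟨.waitParties, x, fun _ => some true, fun _ => none⟩ : CoinState n) = ∅ := by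
    ext; simp [CoinState.A]
  have hr : CoinState.ready
      (⟨.waitParties, x, fun _ => some true, fun _ => none⟩ : CoinState n) := fun i => rfl
  rw [cStart_eq i, cRun, hrec, if_pos hr]
  simp only [cAdvance, hA, if_true]
  simp [sendTo]

/-- The execution with honest interfaces only. -/
lemma realSystem_runs_univ (m : ℕ) (x : Fin n → ZMod 2) : ∃ gs c,
    Runs m (realSystem G f Finset.univ) (realState G f Finset.univ (vInit n) (cInit x)
      (fun _ => .waitQubit) (hello Finset.univ) (none' n _) (none' n _) (none' n _)) gs
      (honestOut Finset.univ (sendTo Finset.univ qubitOf) (none' n _))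
      (realAt G f Finset.univ (vHello Finset.univ .done) c fun _ => .done) ∧
    CGood c ∧ ¬ c.ready ∧ ∀ ρ : Mat n m, applyGates _ gs ρ =
      conj (stab G _ Finset.univ x) (applyGates _ [createGraph G] ρ) := by
  obtain ⟨hc, hcr⟩ := cStart_good x
  -- Three stages: the source has the graph state created, the parties get their qubits and ask for
  -- the coin, and the coin makes them apply their operators and output the qubits. No input from
  -- outside is needed.
  have e1 := realSystem_runs_step G f Finset.univ m (cInit_good x).phase (v := vInit n)
    (fun _ => .waitQubit) (hello Finset.univ) (none' n _) (none' n _) (none' n _)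
  rw [vRun_hello_of_mem G f _ (Finset.mem_univ _), coinOf_hello, chanOf_hello, cRun_cInit] at e1
  simp only [tauGates_empty, tauNext_empty, tauOut_empty, tauIn_empty, filtIn_empty,
    filtOut_empty, chanRun_empty, pack_empty, List.append_nil] at e1
  have hd : ¬ (vHello (n := n) Finset.univ .done).ready := VState.not_ready_of_done rfl
  have hresp : ∀ i ∈ honest (Finset.univ : Finset (Party n)),
      tauResp G Finset.univ (fun _ => .waitQubit) (sendTo Finset.univ qubitOf)
      (chanRun (chanOf (none' n _))) (none' n _) i =
      (.waitCoin (.inl i), [], askIf true, onMain (none' n Unit (some i) ())) := fun i hi =>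
    tauResp_waitQubit_qubit G hi rfl (by simp [sendTo]) _ _
  have e2 := realSystem_runs_respond G f m hc.phase (fun _ => .waitQubit) (none' n _)
    (vRun_vHello_univ G f) (cRun_idle hcr) hd hcr (t := fun i => .waitCoin (.inl i)) hresp
  rw [tauGates_nil G fun i hi => by rw [show tauStep _ _ _ _ = _ from hresp i hi], if_pos rfl,
    honest_univ] at e2
  rcases hq : cRun (cStart x) (sendTo Finset.univ fun _ => .top) with ⟨c₁, q⟩
  obtain ⟨hc₁, hcr₁⟩ := hc.run (sendTo Finset.univ fun _ => .top)
  have hbits := cRun_top x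
  rw [hq] at hc₁ hcr₁ hbits
  set θ : Fin n → TauState n := updHonest (Finset.univ : Finset (Party n)) (fun _ => .waitQubit)
    fun i => .waitCoin (.inl i) with hθ
  have hresp' : ∀ i ∈ honest (Finset.univ : Finset (Party n)),
      tauResp G Finset.univ θ (none' n _) (chanRun (chanOf (pack (none' n _) (none' n _)
        (sendTo Finset.univ fun _ => .top)))) q i =
      (.done, [pauli {.inl i} (fun _ => x i) (fun _ => nbr G x i)], askIf false,
        onMain (sendTo Finset.univ qubitOf (some i) ())) := fun i hi => by
    rw [tauResp_waitCoin_bits G hi (q := .inl i) (by simp [hθ, updHonest, honest_univ]) (hbits i)]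
    simp [sendTo]
  have e3 := realSystem_runs_respond G f m hc.phase θ
    (pack (none' n _) (none' n _) (sendTo Finset.univ fun _ => .top)) (vRun_idle G f hd)
    (by exact hq) hd hcr₁ (t := fun _ => .done) hresp'
  rw [if_neg (by simp), pack_empty] at e3
  have e4 := (e1.trans e2).trans e3
  have hout : ∀ b : Batch n (Party n) RealPort, ∀ w, honestOut Finset.univ w b =
      honestOut Finset.univ w (none' n _) := fun b w => by
    funext p k
    simp [honestOut]
  rw [hout _ (none' n Unit), hout _ (sendTo Finset.univ qubitOf), honestOut_empty, Batch.empty_append, Batch.empty_append,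
    show updHonest (Finset.univ : Finset (Party n)) θ (fun _ => .done) = fun _ => .done by
      funext i; simp [updHonest, honest_univ]] at e4
  refine ⟨_, c₁, e4, hc₁, hcr₁, fun ρ => ?_⟩
  rw [applyGates_append, applyGates_append, applyGates_append, applyGates_append, applyGates_nil,
    applyGates_nil, applyGates_nil, applyGates_tauGates G (x := x)
    (names_subset_register Finset.univ) fun i hi => by
      rw [show tauStep _ _ _ _ = _ from hresp' i hi], honest_univ]

end Correctness

end

end GraphVerif

namespace GraphVerif

noncomputable section

open Matrix
open scoped ComplexOrder

/-! ### The start of the ideal system -/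

section IdealStart

variable {n : ℕ} (G : SimpleGraph (Fin n)) [DecidableRel G.Adj] (f : CorrTest n)
  (H : Finset (Party n))

/-- The initial state of the resource without corrections. -/
def wInit (n : ℕ) : WState n := ⟨.create, fun _ => none, fun _ => none⟩

/-- The messages that the filters and the simulator send at the start. -/
def greet : Batch n (Party n) (Unit ⊕ Unit) := fun p k =>
  Sum.elim (fun _ => if p ∈ H then [.top] else [.bot]) (fun _ => []) k

lemma wRun_init :
    wRun G (wInit n) (none' n Unit) = ([createGraph G], { wInit n with phase := .waitParties },
      none' n Unit) := by
  rw [wRun, WState.record_empty, if_pos (by simp [wInit, WState.ready])]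
  rfl

lemma record_greet : ({ wInit n with phase := .waitParties } : WState n).record
      (fun i k => greet H i (.inl k)) =
    ⟨.waitParties, fun p => some (decide (p ∈ H)), fun _ => none⟩ := by
  simp only [WState.record, wInit, greet]
  congr 1
  · funext p
    by_cases hp : p ∈ H <;> simp [hp, firstOf, readFlag]

lemma wRun_greet_univ : wRun G { wInit n with phase := .waitParties }
      (fun i k => greet Finset.univ i (.inl k)) =
    ([], ⟨.done, fun _ => some true, fun _ => none⟩, sendTo Finset.univ qubitOf) := by
  rw [wRun, record_greet, if_pos (by simp [WState.ready])]
  have hA : WState.A (⟨.waitParties, fun p => some (decide (p ∈ (Finset.univ : Finset (Party n)))),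
      fun _ => none⟩ : WState n) = ∅ := by
    ext p; simp [WState.A]
  simp only [WState.advance, hA]
  simp

lemma wRun_greet {p : Party n} (hp : p ∉ H) : wRun G { wInit n with phase := .waitParties }
      (fun i k => greet H i (.inl k)) = ([], wOpen H, sendTo (dishonest H) qubitOf) := by
  rw [wRun, record_greet, if_pos (by simp [WState.ready])]
  have hA : WState.A (⟨.waitParties, fun p => some (decide (p ∈ H)), fun _ => none⟩ : WState n) =
      Hᶜ := by
    ext p; simp [WState.A]
  have hne : Hᶜ ≠ ∅ := fun h => hp (by
    have : p ∉ Hᶜ := by simp [h]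
    simpa using this)
  have hd : Finset.univ.filter (fun i : Fin n => some i ∈ Hᶜ) = dishonest H := by
    ext i; simp [mem_dishonest]
  simp only [WState.advance, hA, if_neg hne, hd]
  rfl

lemma joint_ideal_step_init :
    (joint H (filterIdeal n) (simulator G f H)).step
      (joint H (filterIdeal n) (simulator G f H)).init (none' n _, none' n _) =
      [([⟨∅, 1⟩], ((startedIdeal H, (⟨.wait, vInit n, cInit 0⟩, ∅)), greet H, none' n _))] := by
  have h1 : (simulator G f H).step (⟨.start, vInit n, cInit 0⟩, ∅)
      (Batch.empty n _ _, Batch.empty n _ _) = _ :=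
    guarded_step (r := ⟨∅, [(1, ⟨.wait, vInit n, cInit 0⟩, flagBatch n _ (some false),
      Batch.empty n _ _)]⟩) rfl
      { subset := Finset.empty_subset _
        complete := by simp
        nodup := fun b hb => by
          rw [List.mem_singleton] at hb
          subst hb
          simp [names_flagBatch, Batch.names_empty]
        sent_subset := fun b hb => by
          rw [List.mem_singleton] at hb
          subst hb
          simp [sent, names_flagBatch, Batch.names_empty] }
  simp only [joint]
  erw [h1]
  simp only [List.map_cons, List.map_nil]
  refine congrArg (fun x => [x]) (Prod.ext ?_ (Prod.ext (Prod.ext ?_ ?_) (Prod.ext ?_ ?_)))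
  · have : ((parties n).filter (· ∈ H)).flatMap (fun i =>
        ((filterIdeal n i).step ((filterIdeal n i).init) (none' n _ i) (none' n _ i)).2.1) = [] := by
      rw [List.flatMap_eq_nil_iff]
      intro p _
      rfl
    erw [this]
    rfl
  · funext p
    by_cases hp : p ∈ H <;> simp [startedIdeal, filterIdeal, hp]
  · simp only [avail_empty, Finset.empty_sdiff]
    rfl
  · funext p k
    by_cases hp : p ∈ H
    · rcases k with k | k <;> simp [hp, filterIdeal, greet]
    · rcases k with k | k <;> simp [hp, greet, flagBatch]
  · funext p k
    by_cases hp : p ∈ H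
    · rcases k with (k | k) | k <;> simp [hp, filterIdeal, Batch.empty, onMain]
    · simp [hp, Batch.empty]

lemma idealSystem_step_init :
    (idealSystem G f H).step (idealSystem G f H).init (none' n _) =
      [([createGraph G, ⟨∅, 1⟩], idealState G f H { wInit n with phase := .waitParties }
        ⟨.wait, vInit n, cInit 0⟩ ∅ (greet H) (none' n _), none' n _)] := by
  have h1 := verif_step G (wInit n) (none' n _)
  have h2 : wRun G (wInit n) (fun i k => none' n (Unit ⊕ Unit) i (.inl k)) = _ := wRun_init G
  have h3 : chanRun (fun i k => none' n (Unit ⊕ Unit) i (.inr k)) = none' n Unit := chanRun_empty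
  rw [h2, h3, packW_empty] at h1
  have h4 := System.attach_step' (joint H (filterIdeal n) (simulator G f H))
    (joint H (filterIdeal n) (simulator G f H)).init (none' n _) (none' n _) h1
  rw [joint_ideal_step_init] at h4
  exact h4

/-- The start of the ideal system, until the simulator samples a string. -/
lemma idealSystem_runs_start (m : ℕ) {w : WState n} {o : Batch n (Party n) Unit}
    (hw : wRun G { wInit n with phase := .waitParties } (fun i k => greet H i (.inl k)) =
      ([], w, o)) :
    ∃ gs, Runs m (idealSystem G f H) (idealSystem G f H).init gs (none' n _)
      (idealState G f H w ⟨.sample, vInit n, cInit 0⟩ ∅ (none' n _) (packW o (none' n _))) ∧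
      ∀ ρ : Mat n m, applyGates _ gs ρ = applyGates _ [createGraph G] ρ := by
  have h1 := idealSystem_step G f H { wInit n with phase := .waitParties }
    ⟨.wait, vInit n, cInit 0⟩ ∅ (greet H) (none' n _) (none' n _)
    (r := ⟨∅, [(1, ⟨.sample, vInit n, cInit 0⟩, Batch.empty n _ _, Batch.empty n _ _)]⟩) rfl
    (feasible_trivial _ _)
  have h2 : chanRun (fun i k => greet H i (.inr k)) = none' n Unit := chanRun_empty
  rw [hw, h2, restr_empty, restr_empty, avail_empty] at h1
  simp only [List.map_cons, List.map_nil, sent_empty, extend_empty, Finset.sdiff_empty,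
    glueOut_empty, List.nil_append] at h1
  have ha : (idealSystem G f H).active (idealSystem G f H).init := .inl (.inl trivial)
  have ha' : (idealSystem G f H).active (idealState G f H { wInit n with phase := .waitParties }
        ⟨.wait, vInit n, cInit 0⟩ ∅ (greet H) (none' n _)) := by
    rw [idealState_active]
    exact .inr (.inl (by simp))
  have h3 := Runs.cons (m := m) (idealSystem_step_init G f H) (fun h => absurd ha h)
    (Runs.cons h1 (fun h => absurd ha' h) (.refl _))
  rw [Batch.empty_append, Batch.empty_append] at h3
  refine ⟨_, h3, fun ρ => ?_⟩
  rw [show [createGraph G, ⟨∅, 1⟩] ++ ([⟨∅, 1⟩] ++ []) = [createGraph G] ++ ([⟨∅, 1⟩] ++ [⟨∅, 1⟩])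
    from rfl, applyGates_append, applyGates_append, applyGates_one, applyGates_one]

/-- The string is chosen with probability `2⁻ⁿ`. -/
lemma sample_norm : ((Real.sqrt ((2 : ℝ) ^ n) : ℂ)⁻¹) * star ((Real.sqrt ((2 : ℝ) ^ n) : ℂ)⁻¹) =
    ((2 : ℂ) ^ n)⁻¹ := by
  rw [star_inv₀, ← mul_inv]
  have : star (Real.sqrt ((2 : ℝ) ^ n) : ℂ) = (Real.sqrt ((2 : ℝ) ^ n) : ℂ) :=
    Complex.conj_ofReal _
  rw [this, ← Complex.ofReal_mul, Real.mul_self_sqrt (by positivity)]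
  push_cast
  rfl

/-- The operator that the simulator applies when it samples the string `y`. -/
def sampleMat (y : Fin n → ZMod 2) :
    Matrix (names (dishonest H) → ZMod 2) (names (dishonest H) → ZMod 2) ℂ :=
  (Real.sqrt ((2 : ℝ) ^ n) : ℂ)⁻¹ •
    (pauli (names (dishonest H)) (Sum.elim y 0) (Sum.elim (nbr G y) 0)).mat

lemma sampleMat_isometry (y : Fin n → ZMod 2) :
    (sampleMat G H y)ᴴ * sampleMat G H y = ((2 : ℂ) ^ n)⁻¹ • 1 := by
  have h : ∀ A : Matrix (names (dishonest H) → ZMod 2) (names (dishonest H) → ZMod 2) ℂ,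
      Aᴴ * A = 1 → ((Real.sqrt ((2 : ℝ) ^ n) : ℂ)⁻¹ • A)ᴴ * ((Real.sqrt ((2 : ℝ) ^ n) : ℂ)⁻¹ • A) =
        ((2 : ℂ) ^ n)⁻¹ • 1 := fun A hA => by
    rw [Matrix.conjTranspose_smul, Matrix.smul_mul, Matrix.mul_smul, hA, smul_smul, mul_comm,
      sample_norm]
  exact h _ (pauli_isometry _ _ _)

/-- There are 2ⁿ strings, and each contributes an isometry with weight 2⁻ⁿ. -/
lemma sampleMat_complete : ((Finset.univ : Finset (Fin n → ZMod 2)).toList.map fun y =>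
    (sampleMat G H y)ᴴ * sampleMat G H y).sum = 1 := by
  rw [Finset.sum_map_toList, Finset.sum_congr rfl fun y _ => sampleMat_isometry G H y,
    Finset.sum_const, Finset.card_univ, Fintype.card_fun, ZMod.card, Fintype.card_fin,
    ← Nat.cast_smul_eq_nsmul ℂ, smul_smul]
  push_cast
  rw [mul_inv_cancel₀ (by positivity), one_smul]

lemma embed_sampleMat (m : ℕ) (y : Fin n → ZMod 2) :
    Gate.embed ⟨names (dishonest H), sampleMat G H y⟩ (register n m) =
      (Real.sqrt ((2 : ℝ) ^ n) : ℂ)⁻¹ • stab G _ (dishonest H) y := by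
  rw [stab, ← cutoff_names, ← cutoff_names, ← pauli_embed _ (names_subset_register _)]
  exact embed_smul _ _ _

lemma idealSystem_step_sample {w : WState n} (hw : ¬ w.ready) {A : Finset (Fin n)}
    (hA : dishonest H ⊆ A) :
    (idealSystem G f H).step (idealState G f H w ⟨.sample, vInit n, cInit 0⟩ ∅ (none' n _)
      (packW (sendTo A qubitOf) (none' n _))) (none' n _) =
      (Finset.univ : Finset (Fin n → ZMod 2)).toList.map fun y =>
        ([⟨names (dishonest H), sampleMat G H y⟩],
          idealAt G f H w ⟨.run, vStart G f H, cStart y⟩ (names (dishonest H)),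
          honestOut H (sendTo A qubitOf) (none' n _)) := by
  have hav : avail ∅ (restr H (packW (sendTo A qubitOf) (none' n _)),
      restr H (none' n RealPort)) = names (dishonest H) := by
    have h1 : (restr H (packW (sendTo A qubitOf) (none' n _))).names =
        (restr H (sendTo A qubitOf)).names := by
      simp only [Batch.names, restr, packW, Fintype.sum_sum_type, Sum.elim_inl, Sum.elim_inr,
        Finset.sum_add_distrib]
      simp [Batch.empty]
    rw [avail, h1, restr_empty]
    simp only [Batch.names_empty, (names_restr_qubits H A).2, Finset.inter_eq_left.2 hA]
    simp
  have h1 := idealSystem_step G f H w ⟨.sample, vInit n, cInit 0⟩ ∅ (none' n _)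
    (packW (sendTo A qubitOf) (none' n _)) (none' n _) (r := ⟨names (dishonest H), _⟩) rfl
    { subset := hav.ge
      complete := by
        rw [List.map_map]
        exact sampleMat_complete G H
      nodup := fun b hb => by
        obtain ⟨y, -, rfl⟩ := List.mem_map.1 hb
        simp [Batch.names_empty]
      sent_subset := fun b hb => by
        obtain ⟨y, -, rfl⟩ := List.mem_map.1 hb
        simp [sent_empty] }
  have h3 : wRun G w (fun i k => none' n (Unit ⊕ Unit) i (.inl k)) = ([], w, none' n Unit) :=
    wRun_idle G hw
  have h4 : chanRun (fun i k => none' n (Unit ⊕ Unit) i (.inr k)) = none' n Unit := chanRun_empty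
  rw [h3, h4, packW_empty, hav] at h1
  refine h1.trans ?_
  rw [List.map_map]
  refine List.map_congr_left fun y _ => ?_
  simp only [Function.comp, List.nil_append, sent_empty, extend_empty, Finset.sdiff_empty]
  refine Prod.ext rfl (Prod.ext rfl ?_)
  funext p k
  by_cases hp : p ∈ H
  · simp [glueOut, honestOut, hp, packW]
  · simp [glueOut, honestOut, hp, Batch.empty]

lemma conj_smul_left {ι : Type*} [Fintype ι] (c : ℂ) (U ρ : Matrix ι ι ℂ) :
    conj (c • U) ρ = (c * star c) • conj U ρ := by
  rw [conj, Matrix.conjTranspose_smul, Matrix.smul_mul, Matrix.smul_mul, Matrix.mul_smul, smul_smul,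
    conj]

lemma conj_smul_right {ι : Type*} [Fintype ι] (c : ℂ) (U ρ : Matrix ι ι ℂ) :
    conj U (c • ρ) = c • conj U ρ := by
  rw [conj, Matrix.mul_smul, Matrix.smul_mul, conj]

/-- This is where the stabilizer property enters the simulation: on the graph state, what the
simulator does to the dishonest qubits equals the operator of the honest parties. The weight of its
sample is the one with which the real coin flip draws the string. -/
lemma applyGates_sample (m : ℕ) (y : Fin n → ZMod 2) :
    applyGates (register n m) [⟨names (dishonest H), sampleMat G H y⟩]
        (applyGates _ [createGraph G] (Matrix.single 0 0 1)) =
      conj (stab G _ (honest H) y) (applyGates _ [createGraph G] (sampled n m)) := by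
  have h2 : sampled n m = ((2 : ℂ) ^ n)⁻¹ • Matrix.single 0 0 1 := by
    rw [sampled, applyGates_singleton, sampleGate, embed_smul, embed_one, conj_smul_left, conj_one,
      sample_norm]
  rw [h2, applyGates_singleton, applyGates_singleton, applyGates_singleton, embed_sampleMat,
    conj_smul_left, sample_norm, conj_smul_right, conj_smul_right]
  exact congrArg _ (conj_stab_compl_create G (names_subset_register Finset.univ) (honest H) y)

/-- Until the simulator samples, the ideal system is deterministic. The set `A` covers two cases:
only the dishonest qubits are sent at the start, or all qubits, if every interface is honest. -/
lemma value_ideal_init (D : Distinguisher n RealPort) (mem : D.Mem) (h : Finset (Name n))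
    {w : WState n} (hw : ¬ w.ready) {A : Finset (Fin n)} (hA : dishonest H ⊆ A)
    (hrun : wRun G { wInit n with phase := .waitParties } (fun i k => greet H i (.inl k)) =
      ([], w, sendTo A qubitOf)) :
    value (idealSystem G f H) D (idealSystem G f H).init (none' n _) mem h (Matrix.single 0 0 1) =
      ∑ y, value (idealSystem G f H) D
        (idealAt G f H w ⟨.run, vStart G f H, cStart y⟩ (names (dishonest H)))
        (honestOut H (sendTo A qubitOf) (none' n _)) mem
        (h ∪ (honestOut H (sendTo A qubitOf) (none' n _)).names.toFinset)
        (conj (stab G _ (honest H) y) (applyGates _ [createGraph G] (sampled n D.anc))) := by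
  obtain ⟨gs, h1, h2⟩ := idealSystem_runs_start G f H D.anc hrun
  have hact : (idealSystem G f H).active (idealState G f H w ⟨.sample, vInit n, cInit 0⟩ ∅
      (none' n _) (packW (sendTo A qubitOf) (none' n _))) := by
    rw [idealState_active]
    exact .inr (.inl (by simp))
  rw [h1.value_eq _ _ _ _ (single_posSemidef _), h2, value_active _ _ _ _ _ _ _
    (applyGates_posSemidef _ _ (single_posSemidef _)) hact, idealSystem_step_sample G f H hw hA,
    List.map_map, ← Finset.sum_map_toList]
  refine congrArg List.sum (List.map_congr_left fun y _ => ?_)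
  simp only [Function.comp, applyGates_sample, Batch.empty_append, Batch.names_empty,
    Multiset.toFinset_zero, Finset.union_empty]

end IdealStart

/-! ### Security -/

section Security

variable {n : ℕ} {G : SimpleGraph (Fin n)} [DecidableRel G.Adj] {f : CorrTest n}
  {H : Finset (Party n)}

/-- The executions agree string by string. The string of the simulator acts on no qubit, but
`applyGates_sample` rewrites this as a full stabilizer, which is just what all parties together
apply in the real execution. -/
lemma value_init_eq_univ (hf : TestOK G f) (D : Distinguisher n RealPort) (mem : D.Mem)
    (h : Finset (Name n)) :
    value (realSystem G f Finset.univ) D (realSystem G f Finset.univ).init (none' n _) mem h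
        (Matrix.single 0 0 1) =
      value (idealSystem G f Finset.univ) D (idealSystem G f Finset.univ).init (none' n _) mem h
        (Matrix.single 0 0 1) := by
  have hw : ¬ WState.ready (⟨.done, fun _ => some true, fun _ => none⟩ : WState n) :=
    WState.not_ready_of_done rfl
  rw [value_real_init, value_ideal_init G f _ D mem h hw (by simp [dishonest_univ])
    (wRun_greet_univ G)]
  refine Finset.sum_congr rfl fun x _ => ?_
  obtain ⟨gs, c, h1, hc, hcr, h2⟩ := realSystem_runs_univ G f D.anc x
  rw [h1.value_eq _ _ _ _ (sampled_posSemidef _), h2, Batch.empty_append]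
  have hl := Late.closed (G := G) (f := f) (H := Finset.univ) (m := D.anc)
    (vHello Finset.univ .done) rfl c hc hcr (fun _ => .done) (fun _ _ => rfl) _ hw (fun _ => rfl)
    ⟨.run, vStart G f Finset.univ, cStart x⟩ rfl (fun ⟨p, hp⟩ => absurd (Finset.mem_univ p) hp)
    (names (dishonest Finset.univ))
    (h ∪ (honestOut Finset.univ (sendTo Finset.univ qubitOf) (none' n _)).names.toFinset) ∅
    (Finset.disjoint_empty_right _) 1 (.one _ _)
    (conj (stab G _ Finset.univ x) (applyGates _ [createGraph G] (sampled n D.anc)))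
    (conj_posSemidef _ (applyGates_posSemidef _ _ (sampled_posSemidef _)))
  rw [conj_one] at hl
  rw [honest_univ]
  exact hl.value_eq hf _ _

/-- With an honest party, the sums over strings are compared by `early_value_eq`, as a later shift
may rearrange them. Without one, they agree term by term. -/
lemma value_init_eq (hf : TestOK G f) {p : Party n} (hp : p ∉ H) (D : Distinguisher n RealPort)
    (mem : D.Mem) {h : Finset (Name n)} (hh : Disjoint h (graphQubits n)) :
    value (realSystem G f H) D (realSystem G f H).init (none' n _) mem h (Matrix.single 0 0 1) =
      value (idealSystem G f H) D (idealSystem G f H).init (none' n _) mem h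
        (Matrix.single 0 0 1) := by
  have hout : honestOut H (sendTo (dishonest H) qubitOf) (none' n _) = none' n RealPort := by
    rw [← honestOut_empty H]
    funext q k
    by_cases hq : q ∈ H
    · rcases q with _ | i
      · simp [honestOut, hq]
      · simp [honestOut, hq, sendTo, mem_dishonest, Batch.empty]
    · simp [honestOut, hq]
  rw [value_real_init, value_ideal_init G f H D mem h (wOpen_not_ready H hp) subset_rfl
    (wRun_greet G H hp), hout, Batch.names_empty, Multiset.toFinset_zero, Finset.union_empty]
  obtain ⟨g, hv, hph, hgood, hr, hleft, hg⟩ := vStart_spec G f H hp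
  have hreal := fun x => (realSystem_runs_start G f H D.anc hv hr x).value_eq (none' n _) mem h
    (sampled n D.anc) (sampled_posSemidef _)
  simp only [Batch.empty_append, Batch.names_empty, Multiset.toFinset_zero,
    Finset.union_empty] at hreal
  -- An honest source has the real graph state created in the first round. With a dishonest one it
  -- does not exist yet, and its creation is accounted for by the operator `openU`.
  have hU : ∀ y, conj (stab G _ (honest H) y) (applyGates _ [createGraph G] (sampled n D.anc)) =
      conj (openU G H D.anc (vStart G f H) y) (applyGates _ g (sampled n D.anc)) := fun y => by
    rcases hg with ⟨h1, rfl⟩ | ⟨h1, rfl⟩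
    · rw [conj_openU_create h1, applyGates_nil]
    · rw [openU_of_ne h1]
  simp only [hreal, hU]
  have ok : ∀ y, IsOpen H (vStart G f H) (cStart y) (names (dishonest H)) h
      (applyGates _ g (sampled n D.anc)) := fun y =>
    { phase := hph
      good := hgood
      ready := hr
      coin := (cStart_good y).1
      coin_ready := (cStart_good y).2
      waiting := fun ⟨i, _⟩ => by rw [cStart_eq i]; exact ⟨rfl, fun _ _ => rfl⟩
      fresh := by rw [hleft]; exact hh
      held := names_mono Finset.inter_subset_left
      psd := applyGates_posSemidef _ _ (sampled_posSemidef _) }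
  rcases (honest H).eq_empty_or_nonempty with he | hne
  · refine Finset.sum_congr rfl fun y _ => ?_
    have hl := Late.opened (G := G) (f := f) ⟨p, hp⟩ he _ _ _ _ _ (ok y)
    rw [cStart_x] at hl
    exact hl.value_eq hf _ _
  · have := early_value_eq hf ⟨p, hp⟩ hne (ok 0) (none' n _) mem
    simpa only [cStart_set] using this

/-- The protocol realizes the resource without corrections for every test that only admits
corrections that are shifts. -/
theorem securelyRealizes_of_testOK (hf : TestOK G f) :
    SecurelyRealizes 0 ((verifCorr G f).par (coinFlip n)) (filterReal n) (tau G) (verif G)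
      (filterIdeal n) := by
  intro H
  refine ⟨simulator G f H, guarded_isPhysical _ _ _, fun D => ?_⟩
  have h1 : Disjoint (ancQubits n D.anc) (graphQubits n) := by
    rw [Finset.disjoint_left]
    rintro q hq hq'
    obtain ⟨k, -, rfl⟩ := Finset.mem_map.1 hq
    exact inr_notMem_names hq'
  have h2 : outputProb (realSystem G f H) D = outputProb (idealSystem G f H) D := by
    refine congrArg ENNReal.toReal ?_
    by_cases hH : ∃ p, p ∉ H
    · obtain ⟨p, hp⟩ := hH
      exact value_init_eq hf hp D D.init h1
    · have : H = Finset.univ := Finset.eq_univ_of_forall fun p => by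
        by_contra hp
        exact hH ⟨p, hp⟩
      subst this
      exact value_init_eq_univ hf D D.init _
  exact (abs_eq_zero.2 (sub_eq_zero.2 h2)).le

lemma testOK_allowed (F : ∀ M : Finset (Fin n), GaussForm (biadj G M)) :
    TestOK G (allowed G F) := fun _ _ _ h => exists_isShift G h

end Security

end

end GraphVerif

theorem mainTheorem3 (n : ℕ) (G : SimpleGraph (Fin n)) [DecidableRel G.Adj]
    (F : ∀ M : Finset (Fin n), GraphVerif.GaussForm (GraphVerif.biadj G M)) :
    GraphVerif.SecurelyRealizes 0
      ((GraphVerif.verifCorr G (GraphVerif.allowed G F)).par (GraphVerif.coinFlip n))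
      (GraphVerif.filterReal n) (GraphVerif.tau G)
      (GraphVerif.verif G) (GraphVerif.filterIdeal n) :=
  GraphVerif.securelyRealizes_of_testOK (GraphVerif.testOK_allowed F)
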